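/- Let $\mathbb F$ be an algebraically closed field of characteristic $0$, let $V$ be a finite-dimensional vector space over $\mathbb F$, and let $\mathfrak g$ be one of $\mathfrak{sl}(V)$, $\mathfrak{sp}(V)$, $\mathfrak{so}(V)$, the last two being taken with respect to a non-degenerate alternating, respectively symmetric, bilinear form on $V$. Let $e\in\mathfrak g$ be a non-zero nilpotent element, included in an $\mathfrak{sl}_2$-triple $e,h,f\in\mathfrak g$, so that $[e,f]=h$, $[h,e]=2e$, $[h,f]=-2f$. Let $\mathfrak g=\bigoplus_{j=-d}^{d}\mathfrak g_j$, $\mathfrak g_{\pm d}\neq 0$, be the grading of $\mathfrak g$ by the eigenvalues of $\operatorname{ad}h$; the number $d$ is called the depth of $e$. A cyclic element associated with $e$ is an element $e+E$ with $0\ne E\in\mathfrak g_{-d}$. One says that $e$ is of semisimple type (respectively, of regular semisimple type) if $e+E$ is semisimple (respectively, semisimple with centralizer in $\mathfrak g$ a Cartan subalgebra) for all non-zero $E$ in some non-empty Zariski open subset of $\mathfrak g_{-d}$. Assume that the depth $d$ of $e$ is even, and let $n_1\ge n_2\ge\dots\ge n_p\ge 1$ be the orders of the Jordan blocks of $e$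 on $V$. 1) If $\mathfrak g=\mathfrak{sl}(V)$ or $\mathfrak g=\mathfrak{sp}(V)$, then $e$ is of semisimple type if and only if the partition $(n_1,\dots,n_p)$ is of the form $(n_1,\dots,n_1,1,\dots,1)$ (there may be no ones), and $e$ is of regular semisimple type if and only if, moreover, $1$ occurs at most once in it. 2) If $\mathfrak g=\mathfrak{so}(V)$, then $e$ is of semisimple type if and only if one of the following three possibilities holds: (a) $n_1$ has even multiplicity and all the other parts are $1$; (b) $p\ge 2$, $n_1=2m+1$, $n_2=2m-1$ for some $m\geq 1$, and all the other parts are $1$; (c) $n_1\geq 5$ and $n_2=\dots=n_p=1$, or $p=1$. Moreover, $e$ is of regular semisimple type if and only if (a) holds with $n_1$ odd and $1$ occurring at most twice, or (b) holds with $p\leq 4$, or (c) holds with $p\leq 2$. -/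

import Mathlib

/-! ### Cyclic elements and types of nilpotent elements

`L` is a finite-dimensional Lie algebra over a field `F`, and `e ∈ L` belongs to an
`sl₂`-triple `(h, e, f)`, that is, `IsSl2Triple h e f`. -/

/-- The component of degree `j` of the `ℤ`-grading of `L` by the eigenvalues of `ad h`. -/
def gradedPiece (F : Type*) {L : Type*} [Field F] [LieRing L] [LieAlgebra F L]
    (h : L) (j : ℤ) : Submodule F L :=
  (LieAlgebra.ad F L h).eigenspace (j : F)

/-- The depth of the grading: the largest `d` such that the component of degree `d` is non-zero.
(The set is non-empty and bounded for every `sl₂`-triple in a finite-dimensional `L` over a field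
of characteristic zero.) -/
noncomputable def gradingDepth (F : Type*) {L : Type*} [Field F] [LieRing L] [LieAlgebra F L]
    (h : L) : ℕ :=
  sSup {d : ℕ | gradedPiece F h (d : ℤ) ≠ ⊥}

/-- `P` holds for a generic vector of `W`, i.e. on a non-empty Zariski open subset: there is a
polynomial function on `W` (a polynomial `q` in linear forms on `W`), not identically zero on `W`,
such that `P w` holds at every `w` at which the function does not vanish. -/
def HoldsGenerically (F : Type*) {W : Type*} [Field F] [AddCommGroup W] [Module F W]
    (P : W → Prop) : Prop :=
  ∃ q : MvPolynomial (Module.Dual F W) F,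
    (∃ w : W, MvPolynomial.eval (fun φ : Module.Dual F W => φ w) q ≠ 0) ∧
    ∀ w : W, MvPolynomial.eval (fun φ : Module.Dual F W => φ w) q ≠ 0 → P w

/-- The centralizer of an element `x`, as a Lie subalgebra. -/
def elementCentralizer (F : Type*) {L : Type*} [Field F] [LieRing L] [LieAlgebra F L]
    (x : L) : LieSubalgebra F L :=
  { LinearMap.ker (LieAlgebra.ad F L x) with
    lie_mem' := by
      intro a b ha hb
      have ha' : ⁅x, a⁆ = 0 := ha
      have hb' : ⁅x, b⁆ = 0 := hb
      change ⁅x, ⁅a, b⁆⁆ = 0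
      rw [leibniz_lie, ha', hb', zero_lie, lie_zero, add_zero] }

/-- `x` is a semisimple element of `L`: `ad x` is a semisimple operator. -/
def IsSemisimpleElement (F : Type*) {L : Type*} [Field F] [LieRing L] [LieAlgebra F L]
    (x : L) : Prop :=
  (LieAlgebra.ad F L x).IsSemisimple

/-- `x` is a regular semisimple element of `L`: it is semisimple and its centralizer is a Cartan
subalgebra. -/
def IsRegularSemisimpleElement (F : Type*) {L : Type*} [Field F] [LieRing L] [LieAlgebra F L]
    (x : L) : Prop :=
  IsSemisimpleElement F x ∧ (elementCentralizer F x).IsCartanSubalgebra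

/-- `e`, taken in an `sl₂`-triple `(h, e, f)`, is of semisimple type: a generic cyclic element
`e + E`, with `0 ≠ E` in the component of degree `-d`, `d` being the depth, is semisimple. -/
def IsOfSemisimpleType (F : Type*) {L : Type*} [Field F] [LieRing L] [LieAlgebra F L]
    (h e : L) : Prop :=
  HoldsGenerically F fun E : gradedPiece F h (-(gradingDepth F h : ℤ)) =>
    E ≠ 0 → IsSemisimpleElement F (e + (E : L))

/-- `e`, taken in an `sl₂`-triple `(h, e, f)`, is of regular semisimple type: a generic cyclic
element `e + E`, with `0 ≠ E` in the component of degree `-d`, is regular semisimple. -/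
def IsOfRegularSemisimpleType (F : Type*) {L : Type*} [Field F] [LieRing L] [LieAlgebra F L]
    (h e : L) : Prop :=
  HoldsGenerically F fun E : gradedPiece F h (-(gradingDepth F h : ℤ)) =>
    E ≠ 0 → IsRegularSemisimpleElement F (e + (E : L))

/-! ### Classical Lie algebras and Jordan types -/

-- The commutator bracket, which Mathlib has as a local instance only.
attribute [local instance 100] LieRing.ofAssociativeRing

/-- `sl(V)`: the operators of trace zero. (The algebras `so(V)` and `sp(V)` are Mathlib's
`skewAdjointLieSubalgebra B`, with `B` symmetric, respectively alternating.) -/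
noncomputable def slSubalgebra (F V : Type*) [Field F] [AddCommGroup V] [Module F V] :
    LieSubalgebra F (Module.End F V) :=
  { LinearMap.ker (LinearMap.trace F V) with
    lie_mem' := by
      intro a b _ _
      change LinearMap.trace F V ⁅a, b⁆ = 0
      rw [Ring.lie_def, map_sub, LinearMap.trace_mul_comm, sub_self] }

/-- The nilpotent operator `x` has Jordan blocks of orders given by the multiset `s`: there is a
basis of `V` consisting of Jordan chains of lengths `n 0, …, n (p - 1)`, whose multiset is `s`. -/
def HasJordanType {F V : Type*} [Field F] [AddCommGroup V] [Module F V]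
    (x : Module.End F V) (s : Multiset ℕ) : Prop :=
  ∃ (p : ℕ) (n : Fin p → ℕ) (b : Module.Basis (Σ i : Fin p, Fin (n i)) F V),
    Finset.univ.val.map n = s ∧
    ∀ (i : Fin p) (j : Fin (n i)),
      x (b ⟨i, j⟩) = if hj : (j : ℕ) + 1 < n i then b ⟨i, ⟨(j : ℕ) + 1, hj⟩⟩ else 0

/-!
# Cyclic elements of even depth in the classical Lie algebras

Let `N` be the highest eigenvalue of `h` on `V`. By `sl₂`-theory the largest Jordan block of `e` has
order `N + 1`, its multiplicity `k` is the dimension of the component of lowest weight `-N`, and `V` is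
the direct sum of the span of the chains that begin there (`bottomChains`) and of an `e`-stable
complement `core e f N`, which carries the other Jordan blocks (`IsSl2Triple.exists_parts_eq`). That `h`
is diagonalizable with integral eigenvalues is proved with the Casimir operator
(`IsSl2Triple.iSup_weightSpace`).

*From `ad` to `V`.* By the Jordan decomposition, an element of one of the three Lie algebras is
semisimple if and only if it is semisimple as an operator on `V`
(`DetectsSemisimplicity.isSemisimpleElement_iff`). It is regular if its eigenvalues are simple, or, in
the orthogonal case, if the only multiple eigenvalue is `0`, with multiplicity two; otherwise its
centralizer contains a two-dimensional non-abelian Lie algebra.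

*Genericity.* Suppose that the minimal polynomials of all operators of an affine family have degree
at most `r`. The determinant of the Hankel matrix of the traces of powers is a polynomial function on
the family, which is non-zero at an operator if and only if this operator is semisimple and has `r`
eigenvalues. So one operator with `r` eigenvalues suffices for a generic operator to be of this kind
(`generically_isSemisimple`).

*Depth `2N`.* This is the case of `sl`, of `sp`, and of `so` with `k ≥ 2`. An element `E` of degree
`-2N` vanishes on `core`, so `e + E` acts there as the nilpotent operator `e`, and `e` has to vanish on
`core`: all the other Jordan blocks have order `1`. Conversely, on the rest of `V` the spectrum of
`e + E` consists of the `(N + 1)`-st roots of the eigenvalues of `A = E e ^ N` on the component of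
weight `-N`, and it remains to find an `E` for which `A` has as many eigenvalues as possible
(`IsSl2Triple.semisimpleType_iff`). The form `B m (e ^ N m')` on that component decides which `A`
occur. For `sl`, for `sp`, and for `so` with `k` and `N` even, `A` can have simple non-zero spectrum.
For `so` with `N` odd, `A` is self-adjoint for an alternating form, so all its eigenvalues have even
multiplicity and `e + E` is never regular. For `so` with `k ≥ 3` odd, `N` is even and `A` is skew-adjoint
for a symmetric form on a space of odd dimension; it is singular, and `e + E` is not semisimple.

*`so` with `k = 1`.* Here `N = n + 2` is even, and evenness of the depth excludes the weight `n + 1`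
(`exists_hasSimpleTop`), so the depth is `2n + 2`. If `u` spans the component of lowest weight, then the
lowest component of `so(V)` consists of the operators `u ∧ (α e u + v)` with `v` of weight `-n`
orthogonal to the chain of `u`. If there is no such `v ≠ 0`, then `X = e + E` satisfies
`X ^ (n + 3) u = 2α X u`, and again `e` has to vanish on `core`. Otherwise `B v (e ^ n v) ≠ 0` for a
generic `v`, the chains of `u` and `v` span a non-degenerate subspace of dimension `2(n + 2)`, on which
`X ^ (2(n + 2)) = 2α X ^ (n + 2) + γ` for a scalar `γ ≠ 0`, and `e` has to vanish on its orthogonal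
complement: the Jordan type is `(N + 1, N - 1, 1, …, 1)`.
-/

open Module Polynomial

/-! ### Generic vectors and the discriminant of the trace form -/

section PolynomialFunctions

variable {F W : Type*} [Field F] [AddCommGroup W] [Module F W]

/-- The algebra of polynomial functions on a vector space `W`, i.e. of polynomials in the linear
forms on `W`. -/
noncomputable def polyFunctionAlgebra (F W : Type*) [Field F] [AddCommGroup W] [Module F W] :
    Subalgebra F (W → F) :=
  (MvPolynomial.aeval (fun φ : Dual F W => fun w : W => φ w)).range

lemma eval_dual_eq_aeval (q : MvPolynomial (Dual F W) F) (w : W) :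
    MvPolynomial.eval (fun φ : Dual F W => φ w) q =
      MvPolynomial.aeval (fun φ : Dual F W => fun w : W => φ w) q w := by
  induction q using MvPolynomial.induction_on with
  | C a => simp
  | add p q hp hq => simp [hp, hq]
  | mul_X p i hp => simp [hp]

lemma linear_mem_polyFunctionAlgebra (φ : W →ₗ[F] F) :
    (fun w => φ w) ∈ polyFunctionAlgebra F W :=
  ⟨MvPolynomial.X φ, by simp⟩

lemma const_mem_polyFunctionAlgebra (c : F) : (fun _ : W => c) ∈ polyFunctionAlgebra F W :=
  (polyFunctionAlgebra F W).algebraMap_mem c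

lemma bilin_mem_polyFunctionAlgebra {V : Type*} [AddCommGroup V] [Module F V]
    [FiniteDimensional F V] (B : LinearMap.BilinForm F V) (f g : W →ₗ[F] V) :
    (fun w => B (f w) (g w)) ∈ polyFunctionAlgebra F W := by
  set b := finBasis F V
  have : (fun w => B (f w) (g w)) =
      ∑ i, (fun w => b.coord i (f w)) * (fun w => B (b i) (g w)) := by
    funext w
    simp only [Finset.sum_apply, Pi.mul_apply, Basis.coord_apply]
    conv_lhs => rw [← b.sum_repr (f w), map_sum, LinearMap.sum_apply]
    simp only [map_smul, LinearMap.smul_apply, smul_eq_mul]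
  rw [this]
  exact Subalgebra.sum_mem _ fun i _ => Subalgebra.mul_mem _
    (linear_mem_polyFunctionAlgebra (b.coord i ∘ₗ f)) (linear_mem_polyFunctionAlgebra (B (b i) ∘ₗ g))

lemma HoldsGenerically.of_polynomialFunction {P : W → Prop} {g : W → F}
    (hg : g ∈ polyFunctionAlgebra F W) {w₀ : W} (h₀ : g w₀ ≠ 0) (h : ∀ w, g w ≠ 0 → P w) :
    HoldsGenerically F P := by
  obtain ⟨q, rfl⟩ := hg
  refine ⟨q, ⟨w₀, ?_⟩, fun w hw => h w ?_⟩
  · rw [eval_dual_eq_aeval]; exact h₀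
  · rw [eval_dual_eq_aeval] at hw; exact hw

lemma HoldsGenerically.mono {P Q : W → Prop} (h : HoldsGenerically F P) (hPQ : ∀ w, P w → Q w) :
    HoldsGenerically F Q := by
  obtain ⟨q, h₁, h₂⟩ := h
  exact ⟨q, h₁, fun w hw => hPQ w (h₂ w hw)⟩

lemma HoldsGenerically.of_forall {P : W → Prop} (h : ∀ w, P w) : HoldsGenerically F P :=
  ⟨1, ⟨0, by simp⟩, fun w _ => h w⟩

/-- Two non-empty open sets meet: on the line through a point of each, the two polynomials
restrict to non-zero polynomials in one variable. -/
lemma HoldsGenerically.and [Infinite F] {P Q : W → Prop} (hP : HoldsGenerically F P)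
    (hQ : HoldsGenerically F Q) : HoldsGenerically F fun w => P w ∧ Q w := by
  obtain ⟨p, ⟨w₁, h₁⟩, hp⟩ := hP
  obtain ⟨q, ⟨w₂, h₂⟩, hq⟩ := hQ
  let T : MvPolynomial (Dual F W) F →ₐ[F] F[X] :=
    MvPolynomial.aeval fun φ : Dual F W => C (φ w₁) + X * C (φ (w₂ - w₁))
  have hT : ∀ (r : MvPolynomial (Dual F W) F) (t : F), (T r).eval t =
      MvPolynomial.eval (fun φ : Dual F W => φ (w₁ + t • (w₂ - w₁))) r := by
    intro r t
    induction r using MvPolynomial.induction_on with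
    | C a => simp [T]
    | add p q hp hq => simp [hp, hq]
    | mul_X p i hp =>
      simp only [map_mul, eval_mul, hp, MvPolynomial.eval_X]
      simp [T]
  have hp0 : T p ≠ 0 := by
    intro h0
    have := hT p 0
    simp [h0] at this
    exact h₁ this.symm
  have hq0 : T q ≠ 0 := by
    intro h0
    have := hT q 1
    simp [h0] at this
    exact h₂ this.symm
  obtain ⟨t, ht⟩ : ∃ t, (T p * T q).eval t ≠ 0 := by
    by_contra! hall
    exact mul_ne_zero hp0 hq0 (Polynomial.funext fun t => by simpa using hall t)
  rw [eval_mul, hT, hT] at ht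
  refine ⟨p * q, ⟨_, by rw [map_mul]; exact ht⟩, fun w hw => ?_⟩
  rw [map_mul] at hw
  exact ⟨hp w (left_ne_zero_of_mul hw), hq w (right_ne_zero_of_mul hw)⟩

/-- The condition `E ≠ 0` in the definition of a cyclic element does not matter: it holds on a
non-empty open set. -/
lemma HoldsGenerically.exists_ne_zero [Infinite F] {P : W → Prop} (hP : HoldsGenerically F P)
    {w₀ : W} (h₀ : w₀ ≠ 0) : ∃ w, w ≠ 0 ∧ P w := by
  obtain ⟨ψ, hψ⟩ : ∃ ψ : Dual F W, ψ w₀ ≠ 0 := by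
    by_contra! h
    exact h₀ ((Module.forall_dual_apply_eq_zero_iff F w₀).1 h)
  obtain ⟨q, ⟨w, hw⟩, hq⟩ := hP.and (HoldsGenerically.of_polynomialFunction (P := fun w => w ≠ 0)
    (linear_mem_polyFunctionAlgebra ψ) hψ fun w hw h => hw (by simp [h]))
  exact ⟨w, (hq w hw).2, (hq w hw).1⟩

variable {V : Type*} [AddCommGroup V] [Module F V] [FiniteDimensional F V]

lemma coeff_pow_mem_polyFunctionAlgebra (x : End F V) (ι : W →ₗ[F] End F V) (i : ℕ) :
    ∀ (φ : Dual F V) (v : V), (fun w => φ (((x + ι w) ^ i) v)) ∈ polyFunctionAlgebra F W := by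
  induction i with
  | zero => intro φ v; simpa using const_mem_polyFunctionAlgebra (W := W) (φ v)
  | succ i ih =>
    intro φ v
    set b := finBasis F V
    have : (fun w => φ (((x + ι w) ^ (i + 1)) v)) =
        ∑ j, ((fun w => φ (((x + ι w) ^ i) (b j))) *
          ((fun _ => b.coord j (x v)) + fun w => b.coord j (ι w v))) := by
      funext w
      rw [pow_succ, Module.End.mul_apply]
      conv_lhs => rw [← b.sum_repr ((x + ι w) v)]
      simp [mul_comm]
    rw [this]
    exact Subalgebra.sum_mem _ fun j _ => Subalgebra.mul_mem _ (ih φ (b j)) (Subalgebra.add_mem _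
      (const_mem_polyFunctionAlgebra _)
      (linear_mem_polyFunctionAlgebra (b.coord j ∘ₗ LinearMap.applyₗ v ∘ₗ ι)))

lemma trace_pow_mem_polyFunctionAlgebra (x : End F V) (ι : W →ₗ[F] End F V) (i : ℕ) :
    (fun w => LinearMap.trace F V ((x + ι w) ^ i)) ∈ polyFunctionAlgebra F W := by
  set b := finBasis F V
  have : (fun w => LinearMap.trace F V ((x + ι w) ^ i)) =
      ∑ j, fun w => b.coord j (((x + ι w) ^ i) (b j)) := by
    funext w
    rw [LinearMap.trace_eq_matrix_trace F b]
    simp [Matrix.trace, LinearMap.toMatrix_apply]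
  rw [this]
  exact Subalgebra.sum_mem _ fun j _ => coeff_pow_mem_polyFunctionAlgebra x ι i _ _

end PolynomialFunctions

section Hankel

variable {F V : Type*} [Field F] [AddCommGroup V] [Module F V]

/-- The Hankel matrix of the power sums of `x`, the Gram matrix of the trace form on the powers
`1, x, …, x ^ (r - 1)`. -/
noncomputable def traceHankel (x : End F V) (r : ℕ) : Matrix (Fin r) (Fin r) F :=
  Matrix.of fun i j => LinearMap.trace F V (x ^ (i + j : ℕ))

/-- The polynomial with given coefficients in degrees `< r`. -/
noncomputable def polyOfCoeffs {r : ℕ} (c : Fin r → F) : F[X] := ∑ j, C (c j) * X ^ (j : ℕ)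

lemma traceHankel_mulVec (x : End F V) {r : ℕ} (c : Fin r → F) (i : Fin r) :
    (traceHankel x r).mulVec c i =
      LinearMap.trace F V (x ^ (i : ℕ) * aeval x (polyOfCoeffs c)) := by
  simp only [Matrix.mulVec, dotProduct, traceHankel, Matrix.of_apply, polyOfCoeffs, map_sum,
    map_mul, aeval_C, map_pow, aeval_X, Finset.mul_sum, pow_add]
  refine Finset.sum_congr rfl fun j _ => ?_
  rw [Algebra.algebraMap_eq_smul_one, smul_mul_assoc, one_mul, mul_smul_comm, map_smul, smul_eq_mul,
    mul_comm]

lemma polyOfCoeffs_coeff {r : ℕ} (c : Fin r → F) (j : Fin r) :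
    (polyOfCoeffs c).coeff j = c j := by
  simp only [polyOfCoeffs, finsetSum_coeff, coeff_C_mul, coeff_X_pow]
  rw [Finset.sum_eq_single j]
  · simp
  · intro k _ hk
    rw [if_neg (fun h => hk (Fin.ext h.symm)), mul_zero]
  · simp

lemma polyOfCoeffs_degree {r : ℕ} (c : Fin r → F) : (polyOfCoeffs c).degree < r := by
  rw [degree_lt_iff_coeff_zero]
  intro m hm
  simp only [polyOfCoeffs, finsetSum_coeff, coeff_C_mul, coeff_X_pow]
  refine Finset.sum_eq_zero fun j _ => ?_
  rw [if_neg (by have := j.2; omega), mul_zero]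

lemma eq_polyOfCoeffs {r : ℕ} {p : F[X]} (hp : p.degree < r) :
    p = polyOfCoeffs fun j : Fin r => p.coeff j := by
  ext n
  by_cases hn : n < r
  · exact (polyOfCoeffs_coeff (fun j : Fin r => p.coeff j) ⟨n, hn⟩).symm
  · rw [coeff_eq_zero_of_degree_lt, coeff_eq_zero_of_degree_lt]
    · exact (polyOfCoeffs_degree _).trans_le (by exact_mod_cast not_lt.1 hn)
    · exact hp.trans_le (by exact_mod_cast not_lt.1 hn)

variable [FiniteDimensional F V]

/-- If the trace form is non-degenerate on `1, x, …, x ^ (r - 1)` and these powers span `F[x]`, then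
`F[x]` has no nilpotent elements, and `x` is its own semisimple part. -/
lemma isSemisimple_of_traceHankel_det_ne_zero [PerfectField F] {x : End F V} {r : ℕ}
    (hr : (minpoly F x).natDegree ≤ r) (hdet : (traceHankel x r).det ≠ 0) :
    x.IsSemisimple ∧ (minpoly F x).natDegree = r := by
  have key : ∀ p : F[X], p.degree < r →
      (∀ i : ℕ, LinearMap.trace F V (x ^ i * aeval x p) = 0) → p = 0 := by
    intro p hp h
    have hc : (traceHankel x r).mulVec (fun j : Fin r => p.coeff j) = 0 := by
      funext i
      rw [traceHankel_mulVec, ← eq_polyOfCoeffs hp]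
      exact h i
    have := Matrix.eq_zero_of_mulVec_eq_zero hdet hc
    rw [eq_polyOfCoeffs hp, this]
    simp [polyOfCoeffs]
  have hint : IsIntegral F x := Algebra.IsIntegral.isIntegral x
  have hmon := minpoly.monic hint
  constructor
  · obtain ⟨n, hn, s, -, hnil, hss, hx⟩ := Module.End.exists_isNilpotent_isSemisimple (f := x)
    obtain ⟨p, rfl⟩ := Algebra.adjoin_singleton_eq_range_aeval F x ▸ hn
    replace hnil : IsNilpotent (aeval x p) := hnil
    replace hx : x = aeval x p + s := hx
    have hmod : aeval x (p %ₘ minpoly F x) = aeval x p := by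
      conv_rhs => rw [← modByMonic_add_div p (minpoly F x)]
      simp
    have h0 : p %ₘ minpoly F x = 0 := by
      apply key
      · refine (degree_modByMonic_lt _ hmon).trans_le ?_
        rw [degree_eq_natDegree hmon.ne_zero]
        exact_mod_cast hr
      · intro i
        rw [hmod]
        have hcomm : Commute (x ^ i) (aeval x p) := by
          have := Polynomial.aeval_X (R := F) x
          rw [← this, ← map_pow, aeval_X]
          exact (Commute.all (X ^ i) p).map (aeval x)
        exact (LinearMap.isNilpotent_trace_of_isNilpotent (hcomm.isNilpotent_mul_left hnil)).eq_zero
    rw [← hmod, h0, map_zero, zero_add] at hx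
    rwa [hx]
  · by_contra hne
    apply hmon.ne_zero
    apply key
    · rw [degree_eq_natDegree hmon.ne_zero]
      exact_mod_cast lt_of_le_of_ne hr hne
    · simp

/-- If `F[x]` is reduced of dimension `r`, then the trace form is non-degenerate on it: an element
that does not vanish has a multiple which is a non-zero scalar multiple of an idempotent. -/
lemma traceHankel_det_ne_zero [IsAlgClosed F] [CharZero F] {x : End F V} (hx : x.IsSemisimple) :
    (traceHankel x (minpoly F x).natDegree).det ≠ 0 := by
  intro hdet
  obtain ⟨c, hc, hc0⟩ := Matrix.exists_mulVec_eq_zero_iff.2 hdet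
  have hint : IsIntegral F x := Algebra.IsIntegral.isIntegral x
  have hmon := minpoly.monic hint
  set p := polyOfCoeffs c with hpdef
  have hpdeg : p.degree < (minpoly F x).natDegree := polyOfCoeffs_degree c
  have hp0 : p ≠ 0 := by
    intro h
    apply hc
    funext j
    rw [← polyOfCoeffs_coeff c j, ← hpdef, h]
    simp
  have hsmall : ∀ q : F[X], q.degree < (minpoly F x).natDegree →
      LinearMap.trace F V (aeval x q * aeval x p) = 0 := by
    intro q hq
    rw [eq_polyOfCoeffs hq]
    simp only [polyOfCoeffs, map_sum, Finset.sum_mul, map_mul, aeval_C, map_pow, aeval_X]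
    refine Finset.sum_eq_zero fun j _ => ?_
    rw [Algebra.algebraMap_eq_smul_one, smul_mul_assoc, one_mul, smul_mul_assoc, map_smul,
      hpdef, ← traceHankel_mulVec, hc0]
    simp
  -- an eigenvalue at which `p` does not vanish
  obtain ⟨μ, hμ, hpμ⟩ : ∃ μ, (minpoly F x).IsRoot μ ∧ ¬ p.IsRoot μ := by
    by_contra! h
    have hsq : Squarefree (minpoly F x) := hx.minpoly_squarefree
    have hsep : (minpoly F x).Separable := PerfectField.separable_iff_squarefree.2 hsq
    have hdvd : minpoly F x ∣ p := by
      rw [(IsAlgClosed.splits (minpoly F x)).dvd_iff_roots_le_roots hmon.ne_zero hp0]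
      rw [Multiset.le_iff_subset (nodup_roots hsep)]
      intro a ha
      rw [mem_roots hp0]
      exact h a ((mem_roots hmon.ne_zero).1 ha)
    have := degree_le_of_dvd hdvd hp0
    rw [degree_eq_natDegree hmon.ne_zero] at this
    exact absurd hpdeg (not_lt.2 this)
  obtain ⟨q, hq⟩ := dvd_iff_isRoot.2 hμ
  have hq0 : q ≠ 0 := by rintro rfl; exact hmon.ne_zero (by simpa using hq)
  have hqdeg : q.degree < (minpoly F x).natDegree := by
    rw [← degree_eq_natDegree hmon.ne_zero, hq, degree_mul, degree_X_sub_C,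
      degree_eq_natDegree hq0]
    exact_mod_cast (by omega : q.natDegree < 1 + q.natDegree)
  have hqμ : q.eval μ ≠ 0 := by
    intro h0
    obtain ⟨s, hs⟩ := dvd_iff_isRoot.2 h0
    have hsq : Squarefree (minpoly F x) := hx.minpoly_squarefree
    have := hsq (X - C μ) ⟨s, by rw [hq, hs, mul_assoc]⟩
    exact not_isUnit_X_sub_C μ this
  -- `g` lives on the eigenspace for `μ`, hence it is a multiple of the projection to it
  set g := aeval x q * aeval x p with hg
  have hann : ∀ s : F[X], aeval x s * g = s.eval μ • g := by
    intro s
    have : (X - C μ) ∣ (s - C (s.eval μ)) := dvd_iff_isRoot.2 (by simp)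
    obtain ⟨s', hs'⟩ := this
    have h1 : aeval x (s - C (s.eval μ)) * g = 0 := by
      rw [hs', hg, ← map_mul, ← map_mul,
        show (X - C μ) * s' * (q * p) = ((X - C μ) * q) * (s' * p) by ring, ← hq, map_mul,
        minpoly.aeval, zero_mul]
    rw [map_sub, sub_mul, sub_eq_zero, aeval_C, Algebra.algebraMap_eq_smul_one, smul_mul_assoc,
      one_mul] at h1
    exact h1
  have hgg : g * g = (q.eval μ * p.eval μ) • g := by
    conv_lhs => rw [hg, mul_assoc, ← hg, hann, mul_smul_comm, hann, smul_smul]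
    rw [mul_comm]
  set d := q.eval μ * p.eval μ with hd
  have hd0 : d ≠ 0 := mul_ne_zero hqμ hpμ
  have hidem : IsIdempotentElem (d⁻¹ • g) := by
    rw [IsIdempotentElem, smul_mul_smul_comm, hgg, smul_smul]
    congr 1
    field_simp
  have htr : LinearMap.trace F V (d⁻¹ • g) = 0 := by
    rw [map_smul, hg, hsmall q hqdeg, smul_zero]
  have hzero := (LinearMap.IsIdempotentElem.trace_eq_zero_iff hidem).1 htr
  have hev : x.HasEigenvalue μ := Module.End.hasEigenvalue_of_isRoot hμ
  obtain ⟨v, hv⟩ := hev.exists_hasEigenvector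
  have h2 : g v = d • v := by
    rw [hg, Module.End.mul_apply, Module.End.aeval_apply_of_hasEigenvector hv, map_smul,
      Module.End.aeval_apply_of_hasEigenvector hv, smul_smul, hd, mul_comm]
  have h3 : (d⁻¹ • g) v = v := by
    rw [LinearMap.smul_apply, h2, smul_smul, inv_mul_cancel₀ hd0, one_smul]
  rw [hzero] at h3
  exact hv.2 h3.symm

lemma le_natDegree_minpoly_of_eigenvalues {x : End F V} {Z : Finset F}
    (hZ : ∀ ζ ∈ Z, x.HasEigenvalue ζ) : Z.card ≤ (minpoly F x).natDegree := by
  classical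
  have hmon := minpoly.monic (Algebra.IsIntegral.isIntegral (R := F) x)
  have hsub : Z ⊆ (minpoly F x).roots.toFinset := fun ζ hζ => by
    rw [Multiset.mem_toFinset, mem_roots hmon.ne_zero]
    exact Module.End.isRoot_of_hasEigenvalue (hZ ζ hζ)
  exact (Finset.card_le_card hsub).trans
    ((Multiset.toFinset_card_le _).trans (card_roots' _))

lemma isSemisimple_of_eigenvalues [IsAlgClosed F] {x : End F V} {Z : Finset F}
    (hZ : ∀ ζ ∈ Z, x.HasEigenvalue ζ) (hcard : (minpoly F x).natDegree ≤ Z.card) :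
    x.IsSemisimple := by
  have hmon := minpoly.monic (Algebra.IsIntegral.isIntegral (R := F) x)
  have hdvd : ∏ ζ ∈ Z, (X - C ζ) ∣ minpoly F x := by
    apply Finset.prod_dvd_of_coprime
    · intro a _ b _ hab
      exact isCoprime_X_sub_C_of_isUnit_sub (sub_ne_zero.2 hab).isUnit
    · intro ζ hζ
      exact dvd_iff_isRoot.2 (Module.End.isRoot_of_hasEigenvalue (hZ ζ hζ))
  have heq : minpoly F x = ∏ ζ ∈ Z, (X - C ζ) := by
    refine (eq_of_monic_of_dvd_of_natDegree_le (monic_prod_of_monic _ _ fun ζ _ => monic_X_sub_C ζ)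
      hmon hdvd ?_)
    rwa [natDegree_prod_of_monic _ _ fun ζ _ => monic_X_sub_C ζ, Finset.sum_congr rfl
      fun ζ _ => natDegree_X_sub_C ζ, Finset.sum_const, smul_eq_mul, mul_one]
  refine Module.End.isSemisimple_of_squarefree_aeval_eq_zero (p := ∏ ζ ∈ Z, (X - C ζ)) ?_ ?_
  · exact (separable_prod_X_sub_C_iff' (f := fun ζ : F => ζ) |>.2 fun a _ b _ h => h).squarefree
  · rw [← heq, minpoly.aeval]

/-- Semisimplicity with `r` distinct eigenvalues is an open condition on an affine family of
operators on which minimal polynomials generically have degree at most `r`. -/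
theorem generically_isSemisimple [IsAlgClosed F] [CharZero F] {W : Type*} [AddCommGroup W]
    [Module F W] (x : End F V) (ι : W →ₗ[F] End F V) {r : ℕ}
    (hdeg : HoldsGenerically F fun w => (minpoly F (x + ι w)).natDegree ≤ r) {w₀ : W}
    (h₀ : (minpoly F (x + ι w₀)).natDegree ≤ r) {Z : Finset F} (hZ : r ≤ Z.card)
    (hZ' : ∀ ζ ∈ Z, (x + ι w₀).HasEigenvalue ζ) :
    HoldsGenerically F fun w =>
      (x + ι w).IsSemisimple ∧ (minpoly F (x + ι w)).natDegree = r := by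
  have hss := isSemisimple_of_eigenvalues hZ' (h₀.trans hZ)
  have hr : (minpoly F (x + ι w₀)).natDegree = r :=
    le_antisymm h₀ (hZ.trans (le_natDegree_minpoly_of_eigenvalues hZ'))
  have hmem : (fun w => (traceHankel (x + ι w) r).det) ∈ polyFunctionAlgebra F W := by
    have : (fun w => (traceHankel (x + ι w) r).det) = ∑ σ : Equiv.Perm (Fin r),
        ((Equiv.Perm.sign σ : ℤ) : F) • ∏ i : Fin r,
          fun w => LinearMap.trace F V ((x + ι w) ^ ((σ i : ℕ) + (i : ℕ))) := by
      funext w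
      simp [Matrix.det_apply', traceHankel]
    rw [this]
    exact Subalgebra.sum_mem _ fun σ _ => Subalgebra.smul_mem _ (Subalgebra.prod_mem _ fun i _ =>
      trace_pow_mem_polyFunctionAlgebra x ι _) _
  have hopen : HoldsGenerically F fun w => (traceHankel (x + ι w) r).det ≠ 0 :=
    HoldsGenerically.of_polynomialFunction hmem (w₀ := w₀)
      (by rw [← hr]; exact traceHankel_det_ne_zero hss) fun w hw => hw
  exact (hdeg.and hopen).mono fun w hw => isSemisimple_of_traceHankel_det_ne_zero hw.1 hw.2

end Hankel

/-! ### Representations of sl₂: weights -/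

section Sl2

variable {F V : Type*} [Field F] [AddCommGroup V] [Module F V]

/-- The weight space of weight `j`. -/
noncomputable abbrev weightSpace (h : End F V) (j : ℤ) : Submodule F V :=
  h.eigenspace (j : F)

/-- The operator `y` has degree `c` for the grading of `End V` given by `h`. -/
def HasDegree (h y : End F V) (c : ℤ) : Prop :=
  ∀ v, h (y v) = y (h v) + (c : F) • y v

lemma mem_weightSpace {h : End F V} {j : ℤ} {v : V} :
    v ∈ weightSpace h j ↔ h v = (j : F) • v := Module.End.mem_eigenspace_iff

lemma HasDegree.apply_mem {h y : End F V} {c : ℤ} (hy : HasDegree h y c) {j : ℤ} {v : V}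
    (hv : v ∈ weightSpace h j) : y v ∈ weightSpace h (j + c) := by
  rw [mem_weightSpace] at hv ⊢
  rw [hy, hv, map_smul, ← add_smul, Int.cast_add]

lemma HasDegree.mul {h y z : End F V} {c d : ℤ} (hy : HasDegree h y c) (hz : HasDegree h z d) :
    HasDegree h (y * z) (c + d) := by
  intro v
  simp only [Module.End.mul_apply]
  rw [hy, hz, map_add, map_smul, add_assoc, ← add_smul]
  push_cast
  rw [add_comm (d : F)]

lemma HasDegree.pow {h y : End F V} {c : ℤ} (hy : HasDegree h y c) (n : ℕ) :
    HasDegree h (y ^ n) (n * c) := by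
  induction n with
  | zero => intro v; simp
  | succ n ih =>
    have := ih.mul hy
    rw [pow_succ]
    convert this using 1
    push_cast; ring

variable {h e f : End F V}

lemma IsSl2Triple.hasDegree_e (t : IsSl2Triple h e f) : HasDegree h e 2 := by
  intro v
  have := congrArg (fun g : End F V => g v) t.lie_h_e_nsmul
  simp only [Ring.lie_def, LinearMap.sub_apply, Module.End.mul_apply, LinearMap.smul_apply] at this
  rw [sub_eq_iff_eq_add] at this
  rw [this, add_comm]
  push_cast
  rw [two_smul, two_smul]

lemma IsSl2Triple.hasDegree_f (t : IsSl2Triple h e f) : HasDegree h f (-2) := by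
  intro v
  have := congrArg (fun g : End F V => g v) t.lie_h_f_nsmul
  simp only [Ring.lie_def, LinearMap.sub_apply, Module.End.mul_apply, LinearMap.smul_apply,
    LinearMap.neg_apply] at this
  rw [sub_eq_iff_eq_add] at this
  rw [this, add_comm]
  push_cast
  rw [neg_smul, two_smul, two_smul]

lemma IsSl2Triple.e_f_apply (t : IsSl2Triple h e f) (v : V) : e (f v) = f (e v) + h v := by
  have := congrArg (fun g : End F V => g v) t.lie_e_f
  simp only [Ring.lie_def, LinearMap.sub_apply, Module.End.mul_apply] at this
  rw [← this]; abel

lemma IsSl2Triple.e_f_pow_apply (t : IsSl2Triple h e f) (n : ℕ) {v : V} (hv : e v = 0) :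
    e ((f ^ (n + 1)) v) = ((n : F) + 1) • (f ^ n) (h v - (n : F) • v) := by
  induction n with
  | zero => simp [t.e_f_apply, hv]
  | succ n ih =>
    rw [pow_succ', Module.End.mul_apply, t.e_f_apply, ih, map_smul,
      ← Module.End.mul_apply f, ← pow_succ', (t.hasDegree_f.pow (n + 1)) v]
    simp only [map_sub, map_smul, smul_sub, smul_smul]
    push_cast
    module

lemma aeval_X_sub_C_apply (h : End F V) (a : F) (v : V) :
    aeval h (X - C a) v = h v - a • v := by
  rw [map_sub, aeval_X, aeval_C, LinearMap.sub_apply, Module.algebraMap_end_apply]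

/-- On the kernel of `e`, the operator `e ^ n f ^ n` is the polynomial `n! ∏ (X - i)` in `h`. -/
lemma IsSl2Triple.e_pow_f_pow_apply (t : IsSl2Triple h e f) (n : ℕ) : ∀ {v : V}, e v = 0 →
    (e ^ n) ((f ^ n) v) = aeval h (C (n.factorial : F) * ∏ i ∈ Finset.range n, (X - C (i : F))) v := by
  induction n with
  | zero => intro v _; simp
  | succ n ih =>
    intro v hv
    have hv' : e (h v - (n : F) • v) = 0 := by
      have := t.hasDegree_e v
      rw [map_sub, map_smul, hv, smul_zero, sub_zero]
      rw [hv, map_zero, smul_zero, add_zero] at this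
      exact this.symm
    rw [pow_succ, Module.End.mul_apply, t.e_f_pow_apply n hv, map_smul, ih hv',
      Finset.prod_range_succ, ← mul_assoc, map_mul _ _ (X - C (n : F)), Module.End.mul_apply]
    rw [aeval_X_sub_C_apply, Nat.factorial_succ]
    simp only [Nat.cast_mul, map_mul, Module.End.mul_apply, aeval_C,
      Module.algebraMap_end_apply]
    push_cast
    rfl

lemma eq_zero_of_coprime_aeval {p q : F[X]} (hpq : IsCoprime p q) {v : V}
    (hp : aeval h p v = 0) (hq : aeval h q v = 0) : v = 0 := by
  obtain ⟨a, b, hab⟩ := hpq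
  have := congrArg (fun r => aeval h r v) hab
  simpa [hp, hq] using this.symm

/-- The Casimir operator. -/
noncomputable def casimir (h e f : End F V) : End F V := 4 • (f * e) + h * h + 2 • h

lemma IsSl2Triple.casimir_e (t : IsSl2Triple h e f) : Commute (casimir h e f) e := by
  ext v
  simp only [casimir, Module.End.mul_apply, LinearMap.add_apply, LinearMap.smul_apply, map_add,
    map_nsmul, t.e_f_apply, t.hasDegree_e _, map_smul]
  push_cast
  module

lemma IsSl2Triple.casimir_h (t : IsSl2Triple h e f) : Commute (casimir h e f) h := by
  ext v
  simp only [casimir, Module.End.mul_apply, LinearMap.add_apply, LinearMap.smul_apply, map_add,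
    map_nsmul, t.hasDegree_f _, t.hasDegree_e _, map_smul]
  push_cast
  module

lemma IsSl2Triple.sub_pow_e (t : IsSl2Triple h e f) (μ : F) (k : ℕ) (v : V) :
    ((h - (μ + 2) • 1) ^ k) (e v) = e (((h - μ • 1) ^ k) v) := by
  induction k generalizing v with
  | zero => simp
  | succ k ih =>
    have : (h - (μ + 2) • (1 : End F V)) (e v) = e ((h - μ • (1 : End F V)) v) := by
      simp only [LinearMap.sub_apply, LinearMap.smul_apply, Module.End.one_apply, map_sub, map_smul,
        t.hasDegree_e _]
      push_cast
      module
    rw [pow_succ, pow_succ, Module.End.mul_apply, Module.End.mul_apply, this, ih]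

lemma IsSl2Triple.sub_pow_e_pow (t : IsSl2Triple h e f) (μ : F) (k j : ℕ) (v : V) :
    ((h - (μ + 2 * j) • 1) ^ k) ((e ^ j) v) = (e ^ j) (((h - μ • 1) ^ k) v) := by
  induction j with
  | zero => simp
  | succ j ih =>
    rw [pow_succ', Module.End.mul_apply, Module.End.mul_apply, ← ih, ← t.sub_pow_e]
    push_cast
    rw [mul_add, mul_one, add_assoc]

section Diagonal

variable [FiniteDimensional F V] [CharZero F]

lemma HasDegree.isNilpotent {y : End F V} {c : ℤ} (hc : c ≠ 0) (hy : HasDegree h y c) :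
    IsNilpotent y := by
  by_contra hnil
  have hfin := Module.End.finite_hasEigenvalue (LieAlgebra.ad F (End F V) h)
  refine Set.infinite_of_injective_forall_mem (f := fun n : ℕ => ((n * c : ℤ) : F)) ?_ ?_ hfin
  · intro m n hmn
    replace hmn : ((m * c : ℤ) : F) = ((n * c : ℤ) : F) := hmn
    have : (m * c : ℤ) = n * c := Int.cast_injective hmn
    exact_mod_cast mul_right_cancel₀ hc this
  · intro n
    refine Module.End.hasEigenvalue_of_hasEigenvector (x := y ^ n) ⟨?_, fun h0 => hnil ⟨n, h0⟩⟩
    rw [Module.End.mem_eigenspace_iff]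
    ext v
    have := hy.pow n v
    simp only [LieAlgebra.ad_apply, Ring.lie_def, LinearMap.sub_apply, Module.End.mul_apply,
      LinearMap.smul_apply, this]
    abel

/-- A generalized weight vector killed by `e` is a weight vector, of natural weight. -/
lemma IsSl2Triple.weight_of_e_eq_zero (t : IsSl2Triple h e f) {w : V} (hw : e w = 0) {μ : F}
    {k : ℕ} (hk : ((h - μ • 1) ^ k) w = 0) (hw0 : w ≠ 0) : (∃ n : ℕ, μ = n) ∧ h w = μ • w := by
  obtain ⟨n, hn⟩ := (t.hasDegree_f).isNilpotent (by norm_num)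
  have hprod : aeval h (∏ i ∈ Finset.range n, (X - C (i : F))) w = 0 := by
    have := t.e_pow_f_pow_apply n hw
    rw [hn, LinearMap.zero_apply, map_zero, map_mul, Module.End.mul_apply, aeval_C,
      Module.algebraMap_end_apply] at this
    exact (smul_eq_zero.1 this.symm).resolve_left (by exact_mod_cast n.factorial_ne_zero)
  have hk' : aeval h ((X - C μ) ^ k) w = 0 := by
    rw [map_pow, map_sub, aeval_X, aeval_C, Algebra.algebraMap_eq_smul_one]
    exact hk
  have hcop : ∀ {s : Finset ℕ}, (∀ i ∈ s, (i : F) ≠ μ) →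
      IsCoprime (∏ i ∈ s, (X - C (i : F))) ((X - C μ) ^ k) := fun {s} hs =>
    IsCoprime.prod_left fun i hi => IsCoprime.pow_right
      (isCoprime_X_sub_C_of_isUnit_sub (sub_ne_zero.2 (hs i hi)).isUnit)
  by_cases hμ : ∃ i ∈ Finset.range n, (i : F) = μ
  · obtain ⟨i, hi, rfl⟩ := hμ
    refine ⟨⟨i, rfl⟩, ?_⟩
    rw [← Finset.mul_prod_erase _ _ hi, mul_comm, map_mul, Module.End.mul_apply] at hprod
    rw [← sub_eq_zero, ← aeval_X_sub_C_apply]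
    refine eq_zero_of_coprime_aeval (hcop (s := (Finset.range n).erase i) fun j hj => ?_) hprod ?_
    · exact_mod_cast (Finset.mem_erase.1 hj).1
    · rw [← Module.End.mul_apply, ← map_mul, mul_comm, map_mul, Module.End.mul_apply, hk', map_zero]
  · exact absurd (eq_zero_of_coprime_aeval (hcop fun i hi h => hμ ⟨i, hi, h⟩) hprod hk') hw0

/-- The last non-zero vector `e ^ j v` is primitive, so its weight is a natural number `n`, and `v`
lies in the generalized eigenspace of the Casimir operator for `n (n + 2)`, and of `h` for `n - 2j`.
-/
lemma IsSl2Triple.exists_weight (t : IsSl2Triple h e f) {c μ : F} {v : V}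
    (hc : v ∈ (casimir h e f).maxGenEigenspace c) (hμ : v ∈ h.maxGenEigenspace μ) (hv : v ≠ 0) :
    ∃ (j n : ℕ), (e ^ j) v ≠ 0 ∧ (e ^ (j + 1)) v = 0 ∧ μ + 2 * j = n ∧ (n : F) * n + 2 * n = c := by
  obtain ⟨m, hm⟩ := t.hasDegree_e.isNilpotent (by norm_num)
  classical
  have hex : ∃ m, (e ^ m) v = 0 := ⟨m, by rw [hm, LinearMap.zero_apply]⟩
  obtain ⟨j, hj⟩ : ∃ j, Nat.find hex = j + 1 :=
    Nat.exists_eq_succ_of_ne_zero fun h0 => hv (by simpa [h0] using Nat.find_spec hex)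
  have hj1 : (e ^ (j + 1)) v = 0 := hj ▸ Nat.find_spec hex
  have hj0 : (e ^ j) v ≠ 0 := Nat.find_min hex (by omega)
  have hej : e ((e ^ j) v) = 0 := by rw [← Module.End.mul_apply, ← pow_succ', hj1]
  obtain ⟨k, hk⟩ := (Module.End.mem_maxGenEigenspace _ _ _).1 hμ
  have hk' : ((h - (μ + 2 * j) • 1) ^ k) ((e ^ j) v) = 0 := by
    rw [t.sub_pow_e_pow, hk, map_zero]
  obtain ⟨⟨n, hn⟩, hw⟩ := t.weight_of_e_eq_zero hej hk' hj0
  refine ⟨j, n, hj0, hj1, hn, ?_⟩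
  obtain ⟨l, hl⟩ := (Module.End.mem_maxGenEigenspace _ _ _).1 hc
  have hl' : ((casimir h e f - c • 1) ^ l) ((e ^ j) v) = 0 := by
    have hcomm : Commute ((casimir h e f - c • 1) ^ l) (e ^ j) :=
      ((t.casimir_e.sub_left ((Commute.one_left e).smul_left c)).pow_pow l j)
    rw [← Module.End.mul_apply, hcomm.eq, Module.End.mul_apply, hl, map_zero]
  have hcas : (casimir h e f - c • (1 : End F V)) ((e ^ j) v) =
      ((n : F) * n + 2 * n - c) • (e ^ j) v := by
    simp only [casimir, LinearMap.sub_apply, LinearMap.add_apply, LinearMap.smul_apply,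
      Module.End.mul_apply, hej, map_zero, hw, hn, map_smul, Module.End.one_apply]
    module
  have hpow : ∀ l : ℕ, ((casimir h e f - c • (1 : End F V)) ^ l) ((e ^ j) v) =
      ((n : F) * n + 2 * n - c) ^ l • (e ^ j) v := by
    intro l
    induction l with
    | zero => simp
    | succ l ih => rw [pow_succ', Module.End.mul_apply, ih, map_smul, hcas, smul_smul, pow_succ]
  rw [hpow] at hl'
  exact sub_eq_zero.1 (eq_zero_of_pow_eq_zero ((smul_eq_zero.1 hl').resolve_right hj0))

/-- Inside a generalized eigenspace of the Casimir operator all primitive vectors have the same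
weight. So if `w = (h - μ) v` is non-zero and `e ^ j w` is primitive, then `e ^ j v` is
primitive too, hence a weight vector, and `e ^ j w = 0`. -/
lemma IsSl2Triple.apply_eq_of_mem (t : IsSl2Triple h e f) {c μ : F} {v : V}
    (hc : v ∈ (casimir h e f).maxGenEigenspace c) (hμ : v ∈ h.maxGenEigenspace μ) :
    h v = μ • v := by
  by_contra hne
  set w := (h - μ • (1 : End F V)) v with hw
  have hw0 : w ≠ 0 := by
    rw [hw]; simpa [sub_eq_zero] using hne
  have hcommh : Commute h (h - μ • (1 : End F V)) :=
    (Commute.refl h).sub_right ((Commute.one_right h).smul_right μ)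
  have hwc : w ∈ (casimir h e f).maxGenEigenspace c :=
    Module.End.mapsTo_maxGenEigenspace_of_comm
      (t.casimir_h.sub_right ((Commute.one_right _).smul_right μ)) c hc
  have hwμ : w ∈ h.maxGenEigenspace μ := Module.End.mapsTo_maxGenEigenspace_of_comm hcommh μ hμ
  obtain ⟨j, n, hj0, hj1, hn, hcn⟩ := t.exists_weight hwc hwμ hw0
  obtain ⟨k, hk⟩ := (Module.End.mem_maxGenEigenspace _ _ _).1 hμ
  have hmem : (e ^ j) v ∈ (casimir h e f).maxGenEigenspace c :=
    Module.End.mapsTo_maxGenEigenspace_of_comm (t.casimir_e.pow_right j) c hc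
  have hv0 : (e ^ j) v ≠ 0 := by
    intro h0
    apply hj0
    have := t.sub_pow_e_pow μ 1 j v
    rw [pow_one, pow_one, h0, map_zero] at this
    exact this.symm
  have hμj : (e ^ j) v ∈ h.maxGenEigenspace (μ + 2 * j) :=
    (Module.End.mem_maxGenEigenspace _ _ _).2 ⟨k, by rw [t.sub_pow_e_pow, hk, map_zero]⟩
  obtain ⟨i, m, hi0, hi1, hm, hcm⟩ := t.exists_weight hmem hμj hv0
  -- `n (n + 2) = m (m + 2)` has no other solution in natural numbers
  have hnm : n = m := by
    have : (n * n + 2 * n : ℕ) = m * m + 2 * m := by exact_mod_cast hcn.trans hcm.symm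
    nlinarith
  have hi : i = 0 := by
    subst hnm
    rw [hn] at hm
    have : (n + 2 * i : ℕ) = n := by exact_mod_cast hm
    omega
  subst hi
  have hev : e ((e ^ j) v) = 0 := by simpa using hi1
  have hk' : ((h - (μ + 2 * j) • 1) ^ k) ((e ^ j) v) = 0 := by
    rw [t.sub_pow_e_pow, hk, map_zero]
  have := (t.weight_of_e_eq_zero hev hk' hv0).2
  apply hj0
  have h2 := t.sub_pow_e_pow μ 1 j v
  rw [pow_one, pow_one, ← hw] at h2
  rw [← h2]
  simp [this]

/-- `h` is diagonalizable with integral eigenvalues. -/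
theorem IsSl2Triple.iSup_weightSpace [IsAlgClosed F] (t : IsSl2Triple h e f) :
    ⨆ j : ℤ, weightSpace h j = ⊤ := by
  rw [eq_top_iff, ← Module.End.iSup_maxGenEigenspace_eq_top (casimir h e f)]
  refine iSup_le fun c => ?_
  have hinv : ∀ x ∈ (casimir h e f).maxGenEigenspace c, h x ∈ (casimir h e f).maxGenEigenspace c :=
    fun x hx => Module.End.mapsTo_maxGenEigenspace_of_comm t.casimir_h c hx
  rw [Submodule.eq_iSup_inf_genEigenspace (f := h) ⊤ hinv
    (Module.End.iSup_maxGenEigenspace_eq_top h)]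
  refine iSup_le fun μ => ?_
  rintro v ⟨hc, hμ⟩
  by_cases hv : v = 0
  · rw [hv]; exact zero_mem _
  obtain ⟨j, n, -, -, hn, -⟩ := t.exists_weight hc hμ hv
  refine Submodule.mem_iSup_of_mem ((n : ℤ) - 2 * j) ?_
  rw [mem_weightSpace, t.apply_eq_of_mem hc hμ]
  congr 1
  push_cast
  rw [← hn]; ring

end Diagonal

end Sl2

/-! ### Jordan chains -/

section Chains

variable {F V : Type*} [Field F] [AddCommGroup V] [Module F V]

/-- The vectors `c ⟨i, 0⟩, …, c ⟨i, n i - 1⟩` form a chain for `e` which ends in `0`, for every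
`i`. -/
def IsChainFamily (e : End F V) {p : ℕ} (n : Fin p → ℕ) (c : (Σ i : Fin p, Fin (n i)) → V) : Prop :=
  ∀ (i : Fin p) (j : Fin (n i)),
    e (c ⟨i, j⟩) = if hj : (j : ℕ) + 1 < n i then c ⟨i, ⟨(j : ℕ) + 1, hj⟩⟩ else 0

variable {e : End F V} {p : ℕ} {n : Fin p → ℕ} {c : (Σ i : Fin p, Fin (n i)) → V}

lemma IsChainFamily.pow_apply (hc : IsChainFamily e n c) (s : ℕ) (i : Fin p) (j : Fin (n i)) :
    (e ^ s) (c ⟨i, j⟩) = if hj : (j : ℕ) + s < n i then c ⟨i, ⟨(j : ℕ) + s, hj⟩⟩ else 0 := by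
  induction s with
  | zero => simp
  | succ s ih =>
    rw [pow_succ', Module.End.mul_apply, ih]
    by_cases h : (j : ℕ) + s < n i
    · rw [dif_pos h, hc]
      rfl
    · rw [dif_neg h, map_zero, dif_neg (by omega)]

/-- A family of chains is linearly independent as soon as the last vectors of the chains are. -/
lemma IsChainFamily.linearIndependent (hc : IsChainFamily e n c) (hn : ∀ i, 0 < n i)
    (htop : LinearIndependent F fun i : Fin p => c ⟨i, ⟨n i - 1, Nat.sub_lt (hn i) one_pos⟩⟩) :
    LinearIndependent F c := by
  rw [Fintype.linearIndependent_iff] at htop ⊢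
  intro a ha
  have step : ∀ s : ℕ, (∀ i (j : Fin (n i)), a ⟨i, j⟩ ≠ 0 → n i ≤ j + (s + 1)) →
      ∀ i (j : Fin (n i)), a ⟨i, j⟩ ≠ 0 → n i ≤ j + s := by
    intro s hs i j hij
    by_contra hlt
    -- apply `e ^ s`: only the coefficients at distance `s` from the ends of the chains survive
    set b : Fin p → F := fun i =>
      if h : s < n i then a ⟨i, ⟨n i - 1 - s, by omega⟩⟩ else 0 with hb
    have hsum : ∑ i, b i • c ⟨i, ⟨n i - 1, Nat.sub_lt (hn i) one_pos⟩⟩ = 0 := by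
      have h0 := congrArg (e ^ s) ha
      rw [map_sum, map_zero, Fintype.sum_sigma] at h0
      rw [← h0]
      refine Finset.sum_congr rfl fun i _ => ?_
      by_cases h : s < n i
      · rw [Finset.sum_eq_single (⟨n i - 1 - s, by omega⟩ : Fin (n i))]
        · rw [map_smul, hc.pow_apply, dif_pos (by simp only; omega)]
          simp only [hb, dif_pos h]
          congr 3
          ext
          simp only
          omega
        · intro j _ hj
          have hj' : (j : ℕ) ≠ n i - 1 - s := fun h => hj (Fin.ext h)
          rw [map_smul, hc.pow_apply]
          by_cases h2 : (j : ℕ) + s < n i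
          · by_cases h3 : a ⟨i, j⟩ = 0
            · rw [h3, zero_smul]
            · have := hs i j h3
              omega
          · rw [dif_neg h2, smul_zero]
        · simp
      · simp only [hb, dif_neg h, zero_smul]
        symm
        refine Finset.sum_eq_zero fun j _ => ?_
        rw [map_smul, hc.pow_apply, dif_neg (by omega), smul_zero]
    have hbi := htop b hsum i
    have hle := hs i j hij
    rw [hb] at hbi
    simp only [dif_pos (show s < n i by omega)] at hbi
    apply hij
    rw [← hbi]
    congr 2
    ext
    simp only
    omega
  have hall : ∀ s : ℕ, (∀ i (j : Fin (n i)), a ⟨i, j⟩ ≠ 0 → n i ≤ j + s) →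
      ∀ i (j : Fin (n i)), a ⟨i, j⟩ ≠ 0 → n i ≤ j + 0 := by
    intro s
    induction s with
    | zero => exact fun h => h
    | succ s ih => exact fun h => ih (step s h)
  rintro ⟨i, j⟩
  by_contra hij
  have := hall (∑ i, n i) (fun i j _ =>
    (Finset.single_le_sum (fun i _ => Nat.zero_le (n i)) (Finset.mem_univ i)).trans
      (Nat.le_add_left _ _)) i j hij
  have := j.2
  omega

lemma IsChainFamily.finrank_map_pow (hc : IsChainFamily e n c) (hli : LinearIndependent F c)
    (s : ℕ) :
    finrank F ((Submodule.span F (Set.range c)).map (e ^ s)) = ∑ i, (n i - s) := by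
  set d : (Σ i : Fin p, Fin (n i - s)) → V := fun x => c ⟨x.1, ⟨x.2 + s, by have := x.2.2; omega⟩⟩
    with hd
  have hinj : Function.Injective fun x : (Σ i : Fin p, Fin (n i - s)) =>
      (⟨x.1, ⟨x.2 + s, by have := x.2.2; omega⟩⟩ : Σ i : Fin p, Fin (n i)) := by
    rintro ⟨i, j⟩ ⟨i', j'⟩ h
    simp only [Sigma.mk.injEq] at h
    obtain ⟨rfl, h⟩ := h
    have := congrArg Fin.val (eq_of_heq h)
    simp only at this
    congr 1
    ext
    omega
  have hspan : (Submodule.span F (Set.range c)).map (e ^ s) = Submodule.span F (Set.range d) := by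
    rw [Submodule.map_span]
    apply le_antisymm
    · rw [Submodule.span_le]
      rintro _ ⟨_, ⟨⟨i, j⟩, rfl⟩, rfl⟩
      rw [hc.pow_apply]
      split_ifs with h
      · exact Submodule.subset_span ⟨⟨i, ⟨j, by omega⟩⟩, rfl⟩
      · exact zero_mem _
    · rw [Submodule.span_le]
      rintro _ ⟨⟨i, j⟩, rfl⟩
      refine Submodule.subset_span ⟨c ⟨i, ⟨j, by omega⟩⟩, ⟨_, rfl⟩, ?_⟩
      rw [hc.pow_apply, dif_pos (by simp only; omega)]
  have hdli : LinearIndependent F d := hli.comp _ hinj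
  rw [hspan, finrank_span_eq_card hdli]
  simp

lemma IsChainFamily.map_le (hc : IsChainFamily e n c) (s : ℕ) :
    (Submodule.span F (Set.range c)).map (e ^ s) ≤ Submodule.span F (Set.range c) := by
  rw [Submodule.map_span, Submodule.span_le]
  rintro _ ⟨_, ⟨⟨i, j⟩, rfl⟩, rfl⟩
  rw [hc.pow_apply]
  split_ifs with h
  · exact Submodule.subset_span ⟨_, rfl⟩
  · exact zero_mem _

/-- The kernel of `e` on the span of independent chains is spanned by the last vectors. -/
lemma IsChainFamily.mem_span_of_apply_eq_zero (hc : IsChainFamily e n c)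
    (hli : LinearIndependent F c) {y : V} (hy : y ∈ Submodule.span F (Set.range c))
    (hey : e y = 0) :
    y ∈ Submodule.span F (c '' {x | (x.2 : ℕ) + 1 = n x.1}) := by
  obtain ⟨a, rfl⟩ := (Submodule.mem_span_range_iff_exists_fun F).1 hy
  have ha : ∀ x : (Σ i : Fin p, Fin (n i)), (x.2 : ℕ) + 1 < n x.1 → a x = 0 := by
    rw [Fintype.linearIndependent_iff] at hli
    set b : (Σ i : Fin p, Fin (n i)) → F := fun x =>
      if (x.2 : ℕ) = 0 then 0 else a ⟨x.1, ⟨x.2 - 1, by have := x.2.2; omega⟩⟩ with hb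
    have hsum : ∑ x, b x • c x = 0 := by
      rw [map_sum, Fintype.sum_sigma] at hey
      rw [Fintype.sum_sigma, ← hey]
      refine Finset.sum_congr rfl fun i _ => ?_
      rcases Nat.eq_zero_or_pos (n i) with h0 | h0
      · have : IsEmpty (Fin (n i)) := by rw [h0]; infer_instance
        simp
      · obtain ⟨m, hm⟩ : ∃ m, n i = m + 1 := ⟨n i - 1, by omega⟩
        have e1 := (finCongr hm).symm.sum_comp fun j => b ⟨i, j⟩ • c ⟨i, j⟩
        have e2 := (finCongr hm).symm.sum_comp fun j => e (a ⟨i, j⟩ • c ⟨i, j⟩)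
        rw [← e1, ← e2, Fin.sum_univ_succ, Fin.sum_univ_castSucc]
        have h1 : b ⟨i, (finCongr hm).symm 0⟩ = 0 := by simp [hb]
        have h2 : e (a ⟨i, (finCongr hm).symm (Fin.last m)⟩ •
            c ⟨i, (finCongr hm).symm (Fin.last m)⟩) = 0 := by
          rw [map_smul, hc, dif_neg (by simp [hm]), smul_zero]
        rw [h1, h2, zero_smul, zero_add, add_zero]
        refine Finset.sum_congr rfl fun j _ => ?_
        rw [map_smul, hc, dif_pos (by simp [hm])]
        simp only [hb]
        rw [if_neg (by simp)]
        rfl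
    intro x hx
    have := hli b hsum ⟨x.1, ⟨x.2 + 1, hx⟩⟩
    simpa [hb] using this
  refine Submodule.sum_mem _ fun x _ => ?_
  by_cases hx : (x.2 : ℕ) + 1 < n x.1
  · rw [ha x hx, zero_smul]; exact zero_mem _
  · exact Submodule.smul_mem _ _ (Submodule.subset_span ⟨x, by have := x.2.2; simp; omega, rfl⟩)

variable [FiniteDimensional F V]

/-- The ranks of the powers of `e`, when the span of a family of chains has an `e`-stable
complement. -/
lemma IsChainFamily.finrank_range_pow (hc : IsChainFamily e n c) (hli : LinearIndependent F c)
    {Q : Submodule F V} (hQ : IsCompl (Submodule.span F (Set.range c)) Q)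
    (heQ : ∀ v ∈ Q, e v ∈ Q) (s : ℕ) :
    finrank F (LinearMap.range (e ^ s)) = ∑ i, (n i - s) + finrank F (Q.map (e ^ s)) := by
  have hpow : Q.map (e ^ s) ≤ Q := by
    rw [Submodule.map_le_iff_le_comap]
    intro v hv
    exact Module.End.pow_apply_mem_of_forall_mem s heQ v hv
  rw [← hc.finrank_map_pow hli s, LinearMap.range_eq_map, ← hQ.sup_eq_top, Submodule.map_sup,
    ← Submodule.finrank_sup_add_finrank_inf_eq]
  rw [(hQ.disjoint.mono (hc.map_le s) hpow).eq_bot, finrank_bot, add_zero]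

/-- The ranks of the powers of a nilpotent operator in terms of its Jordan type; they are the only
property of the Jordan type that is used. -/
lemma HasJordanType.finrank_range_pow {e : End F V} {s : Multiset ℕ} (hs : HasJordanType e s)
    (t : ℕ) : finrank F (LinearMap.range (e ^ t)) = (s.map fun m => m - t).sum := by
  obtain ⟨p, n, b, rfl, hb⟩ := hs
  have hc : IsChainFamily e n b := hb
  have := hc.finrank_range_pow b.linearIndependent (Q := ⊥)
    (by rw [b.span_eq]; exact isCompl_top_bot) (by simp) t
  rw [this, Submodule.map_bot, finrank_bot, add_zero, Multiset.map_map]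
  rfl

end Chains

/-! ### Linear Lie algebras and semisimple elements -/

section AdjointSemisimple

variable {F V : Type*} [Field F] [AddCommGroup V] [Module F V]

lemma aeval_apply_of_intertwines {U : Type*} [AddCommGroup U] [Module F U] {A : End F U}
    {Y : End F V} (ι : U →ₗ[F] V) (h : ∀ u, ι (A u) = Y (ι u)) (p : F[X]) (u : U) :
    ι (aeval A p u) = aeval Y p (ι u) := by
  induction p using Polynomial.induction_on' generalizing u with
  | add p q hp hq => simp [hp, hq]
  | monomial n a =>
    have hpow : ∀ (n : ℕ) (u : U), ι ((A ^ n) u) = (Y ^ n) (ι u) := by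
      intro n
      induction n with
      | zero => simp
      | succ n ih => intro u; rw [pow_succ, pow_succ, Module.End.mul_apply, ih, h]; rfl
    simp [aeval_monomial, hpow, Module.algebraMap_end_apply]


lemma eq_zero_of_isSemisimple_of_pow_apply {x : End F V} (hx : x.IsSemisimple) {v : V} {k : ℕ}
    (hk : (x ^ k) v = 0) : x v = 0 := by
  have h1 : v ∈ x.maxGenEigenspace 0 :=
    (Module.End.mem_maxGenEigenspace _ _ _).2 ⟨k, by simpa using hk⟩
  rw [hx.isFinitelySemisimple.maxGenEigenspace_eq_eigenspace, Module.End.mem_eigenspace_iff,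
    zero_smul] at h1
  exact h1

/-- A non-zero nilpotent operator has a non-zero vector in the intersection of its kernel and its
image. -/
lemma exists_apply_ne_zero_of_isNilpotent {n : End F V} (hn : IsNilpotent n) (h0 : n ≠ 0) :
    ∃ b, n b ≠ 0 ∧ n (n b) = 0 := by
  classical
  obtain ⟨m, hm⟩ := hn
  obtain ⟨c, hc⟩ : ∃ c, n c ≠ 0 := by
    by_contra! h
    exact h0 (LinearMap.ext h)
  have hex : ∃ k, (n ^ k) c = 0 := ⟨m, by rw [hm, LinearMap.zero_apply]⟩
  obtain ⟨k, hk⟩ : ∃ k, Nat.find hex = k + 2 := by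
    have h2 : 2 ≤ Nat.find hex := by
      by_contra hlt
      have hsp := Nat.find_spec hex
      interval_cases Nat.find hex
      · exact hc (by rw [show c = 0 by simpa using hsp, map_zero])
      · exact hc (by simpa using hsp)
    exact ⟨Nat.find hex - 2, by omega⟩
  refine ⟨(n ^ k) c, ?_, ?_⟩
  · rw [← Module.End.mul_apply, ← pow_succ']
    exact Nat.find_min hex (by omega)
  · have := Nat.find_spec hex
    rwa [hk, pow_succ', pow_succ'] at this

lemma mem_slSubalgebra {x : End F V} : x ∈ slSubalgebra F V ↔ LinearMap.trace F V x = 0 := Iff.rfl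

variable [FiniteDimensional F V]

lemma ad_isSemisimple_of_isSemisimple [PerfectField F] {L : LieSubalgebra F (End F V)} {x : L}
    (hx : (x : End F V).IsSemisimple) : (LieAlgebra.ad F L x).IsSemisimple := by
  have hl : Module.End.IsSemisimple (LinearMap.mulLeft F (x : End F V)) := by
    refine Module.End.isSemisimple_of_squarefree_aeval_eq_zero hx.minpoly_squarefree ?_
    have := aeval_algHom_apply (Algebra.lmul F (End F V)) (x : End F V) (minpoly F (x : End F V))
    rw [minpoly.aeval, map_zero] at this
    exact this
  have hr : Module.End.IsSemisimple (LinearMap.mulRight F (x : End F V)) := by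
    refine Module.End.isSemisimple_of_squarefree_aeval_eq_zero hx.minpoly_squarefree ?_
    have : ∀ (p : F[X]) (z : End F V),
        aeval (LinearMap.mulRight F (x : End F V)) p z = z * aeval (x : End F V) p := by
      intro p
      induction p using Polynomial.induction_on' with
      | add p q hp hq => intro z; simp [hp, hq, mul_add]
      | monomial n a =>
        intro z
        simp [aeval_monomial, LinearMap.pow_mulRight, Algebra.algebraMap_eq_smul_one]
    ext z : 1
    rw [this, minpoly.aeval, mul_zero, LinearMap.zero_apply]
  have hgl : (LieAlgebra.ad F (End F V) (x : End F V)).IsSemisimple := by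
    have : LieAlgebra.ad F (End F V) (x : End F V) =
        LinearMap.mulLeft F (x : End F V) - LinearMap.mulRight F (x : End F V) := by
      ext1 z; simp [LieAlgebra.ad_apply, Ring.lie_def]
    rw [this]
    exact hl.sub_of_commute (LinearMap.commute_mulLeft_right _ _) hr
  refine Module.End.isSemisimple_of_squarefree_aeval_eq_zero hgl.minpoly_squarefree ?_
  ext1 z
  apply Subtype.coe_injective
  have := aeval_apply_of_intertwines (A := LieAlgebra.ad F L x)
    (Y := LieAlgebra.ad F (End F V) (x : End F V)) L.toSubmodule.subtype (fun u => rfl)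
    (minpoly F (LieAlgebra.ad F (End F V) (x : End F V))) z
  rw [minpoly.aeval] at this
  exact this

/-- Two properties of a linear Lie algebra `L` under which an element of `L` is semisimple as an
operator as soon as it is `ad`-semisimple: `L` contains the nilpotent parts of its elements, and no
non-zero nilpotent operator in `L` is central. -/
structure DetectsSemisimplicity (L : LieSubalgebra F (End F V)) : Prop where
  nilpotentPart_mem : ∀ x ∈ L, ∀ p q : F[X], IsNilpotent (aeval x p) → (aeval x q).IsSemisimple →
    x = aeval x p + aeval x q → aeval x p ∈ L
  eq_zero_of_central : ∀ n ∈ L, IsNilpotent n → (∀ y ∈ L, n * y = y * n) → n = 0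

/-- If `ad x` is semisimple, then the nilpotent part `n` of `x` lies in `L`, and `ad n` is both
nilpotent and semisimple, so that `n` is central in `L`, hence zero. -/
lemma DetectsSemisimplicity.isSemisimpleElement_iff [PerfectField F] {L : LieSubalgebra F (End F V)}
    (hL : DetectsSemisimplicity L) (x : L) :
    IsSemisimpleElement F x ↔ (x : End F V).IsSemisimple := by
  refine ⟨fun hx => ?_, ad_isSemisimple_of_isSemisimple⟩
  obtain ⟨n, hn, s, hs, hnil, hss, hxns⟩ :=
    Module.End.exists_isNilpotent_isSemisimple (f := (x : End F V))
  obtain ⟨p, rfl⟩ := Algebra.adjoin_singleton_eq_range_aeval F (x : End F V) ▸ hn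
  obtain ⟨q, rfl⟩ := Algebra.adjoin_singleton_eq_range_aeval F (x : End F V) ▸ hs
  replace hnil : IsNilpotent (aeval (x : End F V) p) := hnil
  replace hss : (aeval (x : End F V) q).IsSemisimple := hss
  replace hxns : (x : End F V) = aeval (x : End F V) p + aeval (x : End F V) q := hxns
  have hmem := hL.nilpotentPart_mem x x.2 p q hnil hss hxns
  have hmem' : aeval (x : End F V) q ∈ L := by
    have : aeval (x : End F V) q = (x : End F V) - aeval (x : End F V) p := by
      rw [eq_sub_iff_add_eq, add_comm]; exact hxns.symm
    rw [this]
    exact sub_mem x.2 hmem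
  set n' : L := ⟨_, hmem⟩ with hn'
  set s' : L := ⟨_, hmem'⟩ with hs'
  have hxL : x = n' + s' := Subtype.ext hxns
  have hcomm : Commute (aeval (x : End F V) p) (aeval (x : End F V) q) :=
    (Commute.all p q).map (aeval (x : End F V))
  have hlie : ⁅x, s'⁆ = 0 := by
    apply Subtype.ext
    have hc : Commute (x : End F V) (aeval (x : End F V) q) := by
      conv_lhs => rw [← aeval_X (R := F) (x : End F V)]
      exact (Commute.all X q).map (aeval (x : End F V))
    change (x : End F V) * aeval (x : End F V) q - aeval (x : End F V) q * (x : End F V) = 0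
    rw [hc.eq, sub_self]
  have had : LieAlgebra.ad F L n' = LieAlgebra.ad F L x - LieAlgebra.ad F L s' := by
    rw [hxL, map_add, add_sub_cancel_right]
  have hadc : Commute (LieAlgebra.ad F L x) (LieAlgebra.ad F L s') := by
    rw [commute_iff_lie_eq, ← LieHom.map_lie, hlie, map_zero]
  have h1 : (LieAlgebra.ad F L n').IsSemisimple := by
    rw [had]
    exact Module.End.IsSemisimple.sub_of_commute hadc hx (ad_isSemisimple_of_isSemisimple hss)
  have h2 : IsNilpotent (LieAlgebra.ad F L n') := LieAlgebra.isNilpotent_ad_of_isNilpotent hnil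
  have h3 := Module.End.eq_zero_of_isNilpotent_isSemisimple h2 h1
  have h4 : aeval (x : End F V) p = 0 := by
    refine hL.eq_zero_of_central _ hmem hnil fun y hy => ?_
    have := congrArg (fun g => ((g ⟨y, hy⟩ : L) : End F V)) h3
    simpa [Ring.lie_def, sub_eq_zero] using this
  rw [hxns, h4, zero_add]
  exact hss

/-- If `n` is nilpotent and non-zero, then `n` does not commute with a suitable operator of rank one
and trace zero. -/
lemma slSubalgebra_detectsSemisimplicity : DetectsSemisimplicity (slSubalgebra F V) where
  nilpotentPart_mem x _ p q hn _ _ :=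
    mem_slSubalgebra.2 (LinearMap.isNilpotent_trace_of_isNilpotent hn).eq_zero
  eq_zero_of_central n hn hnil hc := by
    by_contra h0
    obtain ⟨b, hb, hbb⟩ := exists_apply_ne_zero_of_isNilpotent hnil h0
    have hspan : n b ∉ Submodule.span F {b} := by
      rw [Submodule.mem_span_singleton]
      rintro ⟨a, ha⟩
      rw [← ha, map_smul, ← ha, smul_smul] at hbb
      rcases smul_eq_zero.1 hbb with h | h
      · have ha0 : a = 0 := by simpa using h
        exact hb (by rw [← ha, ha0, zero_smul])
      · exact hb (by rw [h, map_zero])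
    obtain ⟨ψ, hψ1, hψ2⟩ := Submodule.exists_le_ker_of_notMem hspan
    have hψb : ψ b = 0 := hψ2 (Submodule.mem_span_singleton_self b)
    have hmem : ψ.smulRight b ∈ slSubalgebra F V := by
      rw [mem_slSubalgebra, LinearMap.trace_smulRight, hψb]
    have := congrArg (fun g : End F V => g (n b)) (hc _ hmem)
    simp [hbb] at this
    exact this.elim hψ1 hb

end AdjointSemisimple

section Skew

variable {F V : Type*} [Field F] [AddCommGroup V] [Module F V] {B : LinearMap.BilinForm F V} {ε : F}

lemma mem_skewAdjointLieSubalgebra {x : End F V} :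
    x ∈ skewAdjointLieSubalgebra B ↔ ∀ u v, B (x u) v = -B u (x v) := by
  change x ∈ LinearMap.skewAdjointSubmodule B ↔ _
  rw [LinearMap.mem_skewAdjointSubmodule]
  simp [LinearMap.IsSkewAdjoint, LinearMap.IsAdjointPair]

lemma skew_pow_apply {x : End F V} (hx : x ∈ skewAdjointLieSubalgebra B) (n : ℕ) (u v : V) :
    B ((x ^ n) u) v = (-1) ^ n * B u ((x ^ n) v) := by
  induction n generalizing u v with
  | zero => simp
  | succ n ih =>
    have h1 : (x ^ (n + 1)) u = (x ^ n) (x u) := by rw [pow_succ, Module.End.mul_apply]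
    have h2 : (x ^ (n + 1)) v = x ((x ^ n) v) := by rw [pow_succ', Module.End.mul_apply]
    rw [h1, h2, ih, mem_skewAdjointLieSubalgebra.1 hx]
    ring

variable (B ε) in
/-- For an `ε`-symmetric form `B`, the skew-adjoint operator of rank at most two given by the
element `u ∧ v` of the exterior square (`ε = 1`) or `u v` of the symmetric square (`ε = -1`). -/
noncomputable def wedge (u v : V) : End F V := (B u).smulRight v - ε • (B v).smulRight u

lemma wedge_apply (u v t : V) : wedge B ε u v t = B u t • v - (ε * B v t) • u := by
  simp [wedge, smul_smul]

lemma wedge_mem (hB : ∀ u v, B u v = ε * B v u) (hε : ε * ε = 1) (u v : V) :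
    wedge B ε u v ∈ skewAdjointLieSubalgebra B := by
  rw [mem_skewAdjointLieSubalgebra]
  intro s t
  simp only [wedge_apply, map_sub, map_smul, LinearMap.sub_apply, LinearMap.smul_apply, smul_eq_mul]
  rw [hB s v, hB s u]
  linear_combination (-(B u s * B v t)) * hε

lemma mul_wedge_sub {x : End F V} (hx : x ∈ skewAdjointLieSubalgebra B) (u v : V) :
    x * wedge B ε u v - wedge B ε u v * x = wedge B ε (x u) v + wedge B ε u (x v) := by
  ext t
  simp only [LinearMap.sub_apply, Module.End.mul_apply, LinearMap.add_apply, wedge_apply, map_sub,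
    map_smul, mem_skewAdjointLieSubalgebra.1 hx u t, mem_skewAdjointLieSubalgebra.1 hx v t]
  module

lemma aeval_skew {x : End F V} (hx : x ∈ skewAdjointLieSubalgebra B) (p : F[X]) (u v : V) :
    B (aeval x p u) v = B u (aeval (-x) p v) := by
  induction p using Polynomial.induction_on' with
  | add p q hp hq => simp [hp, hq]
  | monomial n a =>
    simp only [aeval_monomial, Module.End.mul_apply, Module.algebraMap_end_apply, map_smul,
      LinearMap.smul_apply, skew_pow_apply hx]
    rcases n.even_or_odd with h | h <;> simp [h.neg_one_pow, h.neg_pow]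

variable [FiniteDimensional F V] [CharZero F]

/-- The nilpotent part of a skew-adjoint operator is skew-adjoint, by uniqueness of the Jordan
decomposition. A nilpotent operator `n` that commutes with all operators `u ∧ v` satisfies `n u ∧ v
+ u ∧ n v = 0`, whence `n = 0`. -/
lemma skewAdjointLieSubalgebra_detectsSemisimplicity (hnd : B.Nondegenerate)
    (hB : ∀ u v, B u v = ε * B v u) (hε : ε * ε = 1) :
    DetectsSemisimplicity (skewAdjointLieSubalgebra B) where
  nilpotentPart_mem x hx p q hn hs hxpq := by
    have hadj : ∀ {y z : End F V}, (∀ u v, B (y u) v = B u (z v)) → y = 0 → z = 0 := by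
      intro y z h hy
      ext v
      exact hnd.2 _ fun u => by rw [← h, hy, LinearMap.zero_apply, map_zero, LinearMap.zero_apply]
    -- the adjoints of the two parts of `x` are the two parts of `-x`
    have hn' : IsNilpotent (aeval (-x) p) := by
      obtain ⟨k, hk⟩ := hn
      refine ⟨k, hadj (y := aeval x (p ^ k)) (fun u v => ?_) (by rw [map_pow, hk])⟩
      rw [aeval_skew hx, map_pow]
    have hs' : (aeval (-x) q).IsSemisimple := by
      refine Module.End.isSemisimple_of_squarefree_aeval_eq_zero hs.minpoly_squarefree ?_
      rw [← aeval_comp]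
      refine hadj (fun u v => aeval_skew hx _ u v) ?_
      rw [aeval_comp, minpoly.aeval]
    have hx' : -x = aeval (-x) p + aeval (-x) q := by
      have h1 : aeval x (X - p - q) = 0 := by
        rw [map_sub, map_sub, aeval_X, sub_sub, ← hxpq, sub_self]
      have h2 := hadj (fun u v => aeval_skew hx (X - p - q) u v) h1
      rw [map_sub, map_sub, aeval_X, sub_sub, sub_eq_zero] at h2
      exact h2
    have hneg : ∀ r : F[X], aeval (-x) r = aeval x (r.comp (-X)) := by
      intro r; rw [aeval_comp]; simp
    have hc1 : Commute (aeval x p) (aeval (-x) p) := by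
      rw [hneg]; exact (Commute.all _ _).map (aeval x)
    have hc2 : Commute (aeval x q) (aeval (-x) q) := by
      rw [hneg]; exact (Commute.all _ _).map (aeval x)
    have hsum : aeval x p + aeval (-x) p = -(aeval x q + aeval (-x) q) := by
      rw [eq_neg_iff_add_eq_zero, add_add_add_comm, ← hxpq, ← hx', add_neg_cancel]
    have hzero : aeval x p + aeval (-x) p = 0 := by
      refine Module.End.eq_zero_of_isNilpotent_isSemisimple (hc1.isNilpotent_add hn hn') ?_
      rw [hsum, Module.End.isSemisimple_neg]
      exact Module.End.IsSemisimple.add_of_commute hc2 hs hs'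
    rw [mem_skewAdjointLieSubalgebra]
    intro u v
    rw [aeval_skew hx, eq_neg_of_add_eq_zero_right hzero, LinearMap.neg_apply, map_neg]
  eq_zero_of_central n hn hnil hc := by
    by_contra h0
    obtain ⟨b, hb, hbb⟩ := exists_apply_ne_zero_of_isNilpotent hnil h0
    have hw : ∀ u t, B (n u) t • n b = (ε * B (n b) t) • n u := by
      intro u t
      have h1 := mul_wedge_sub (ε := ε) hn u (n b)
      rw [hc _ (wedge_mem hB hε u (n b)), sub_self, hbb] at h1
      have h2 := congrArg (fun g : End F V => g t) h1
      simp only [LinearMap.zero_apply, LinearMap.add_apply, wedge_apply, map_zero, mul_zero,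
        zero_smul, smul_zero, sub_zero, add_zero] at h2
      exact sub_eq_zero.1 h2.symm
    -- the vector `n b` pairs non-trivially with some `t`, so that `hw` forces `ε = 1` and rank one
    obtain ⟨t, ht⟩ : ∃ t, B (n b) t ≠ 0 := by
      by_contra! h
      exact hb (hnd.1 _ h)
    have hε1 : ε = 1 := by
      have := hw b t
      rw [← sub_eq_zero, ← sub_smul] at this
      have h2 := (smul_eq_zero.1 this).resolve_right hb
      have : (1 - ε) * B (n b) t = 0 := by linear_combination h2
      exact (sub_eq_zero.1 ((mul_eq_zero.1 this).resolve_right ht)).symm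
    subst hε1
    have hskew : ∀ u, B (n u) u = 0 := by
      intro u
      have h1 := mem_skewAdjointLieSubalgebra.1 hn u u
      rw [hB u] at h1
      have : (2 : F) * B (n u) u = 0 := by linear_combination h1
      exact (mul_eq_zero.1 this).resolve_left two_ne_zero
    have hprod : ∀ u, B (n u) t * B (n b) u = 0 := by
      intro u
      have := congrArg (fun w => B w u) (hw u t)
      simpa [hskew] using this
    have hb0 : B (n b) b = 0 := hskew b
    apply hb
    refine hnd.1 _ fun u => ?_
    have h1 := hprod (u + b)
    rw [map_add, map_add, map_add, hb0, LinearMap.add_apply, add_zero, add_mul, hprod, zero_add] at h1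
    exact (mul_eq_zero.1 h1).resolve_left ht

end Skew

section Regular

variable {F L : Type*} [Field F] [LieRing L] [LieAlgebra F L]

/-- The centralizer of a semisimple element is its own normalizer, so it is a Cartan subalgebra as
soon as it is abelian. -/
lemma isRegularSemisimpleElement_of_commute {x : L} (hx : IsSemisimpleElement F x)
    (hc : ∀ y z : L, ⁅x, y⁆ = 0 → ⁅x, z⁆ = 0 → ⁅y, z⁆ = 0) : IsRegularSemisimpleElement F x := by
  refine ⟨hx, ⟨?_, ?_⟩⟩
  · have : IsLieAbelian (elementCentralizer F x) :=
      ⟨fun y z => Subtype.ext (hc y z y.2 z.2)⟩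
    infer_instance
  · refine le_antisymm (fun y hy => ?_) (LieSubalgebra.le_normalizer _)
    rw [LieSubalgebra.mem_normalizer_iff] at hy
    have h1 : ⁅x, ⁅y, x⁆⁆ = 0 := hy x (lie_self x)
    have h2 : (LieAlgebra.ad F L x ^ 2) y = 0 := by
      rw [pow_two, Module.End.mul_apply, LieAlgebra.ad_apply, LieAlgebra.ad_apply, ← lie_skew x y,
        lie_neg, h1, neg_zero]
    exact eq_zero_of_isSemisimple_of_pow_apply hx h2

/-- A Cartan subalgebra is nilpotent, so that it cannot contain `a` and `b ≠ 0` with `[a, b] = c b`,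
`c ≠ 0`. -/
lemma not_isRegularSemisimpleElement {x a b : L} (ha : ⁅x, a⁆ = 0) (hb : ⁅x, b⁆ = 0) {c : F}
    (hc : c ≠ 0) (hb0 : b ≠ 0) (hab : ⁅a, b⁆ = c • b) : ¬ IsRegularSemisimpleElement F x := by
  rintro ⟨-, hcar⟩
  have := hcar.nilpotent
  obtain ⟨k, hk⟩ := LieModule.exists_forall_pow_toEnd_eq_zero F (elementCentralizer F x)
    (elementCentralizer F x)
  have hpow : ∀ k : ℕ, ((LieModule.toEnd F (elementCentralizer F x) (elementCentralizer F x)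
      ⟨a, ha⟩) ^ k) ⟨b, hb⟩ = c ^ k • ⟨b, hb⟩ := by
    intro k
    induction k with
    | zero => simp
    | succ k ih =>
      rw [pow_succ', Module.End.mul_apply, ih, map_smul, LieModule.toEnd_apply_apply, pow_succ,
        mul_smul]
      congr 1
      exact Subtype.ext hab
  have h1 := hpow k
  rw [hk, LinearMap.zero_apply] at h1
  have h2 := congrArg Subtype.val h1.symm
  exact hb0 ((smul_eq_zero.1 h2).resolve_left (pow_ne_zero _ hc))

end Regular

/-! ### The components of extreme weight -/

section Top

variable {F V : Type*} [Field F] [AddCommGroup V] [Module F V] {h e f : End F V} {N : ℕ}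

/-- All weights of `h` have absolute value at most `N`. -/
def WeightsLE (h : End F V) (N : ℕ) : Prop :=
  ∀ (j : ℤ) (v : V), v ∈ weightSpace h j → (N : ℤ) < |j| → v = 0

/-- The scalar by which `e ^ N f ^ N` acts on vectors of highest weight `N`. -/
noncomputable def topScalar (F : Type*) [Field F] (N : ℕ) : F :=
  (N.factorial : F) * ∏ i ∈ Finset.range N, ((N : F) - i)

lemma topScalar_ne_zero [CharZero F] (N : ℕ) : topScalar F N ≠ 0 := by
  refine mul_ne_zero (by exact_mod_cast N.factorial_ne_zero) (Finset.prod_ne_zero_iff.2 ?_)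
  intro i hi
  rw [sub_ne_zero]
  exact_mod_cast (Finset.mem_range.1 hi).ne'

lemma IsSl2Triple.e_pow_f_pow_of_e_apply_eq_zero (t : IsSl2Triple h e f) {a : V}
    (ha : a ∈ weightSpace h N) (hea : e a = 0) : (e ^ N) ((f ^ N) a) = topScalar F N • a := by
  rw [t.e_pow_f_pow_apply N hea,
    Module.End.aeval_apply_of_mem_apply_eq_smul (hx := mem_weightSpace.1 ha)]
  simp [topScalar, eval_prod]

lemma IsSl2Triple.e_pow_f_pow_of_mem_top (t : IsSl2Triple h e f) (hN : WeightsLE h N) {a : V}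
    (ha : a ∈ weightSpace h N) : (e ^ N) ((f ^ N) a) = topScalar F N • a :=
  t.e_pow_f_pow_of_e_apply_eq_zero ha (hN _ _ (t.hasDegree_e.apply_mem ha) (by
    rw [abs_of_nonneg (by positivity)]; linarith))

lemma mem_weightSpace_neg {j : ℤ} {v : V} : v ∈ weightSpace (-h) j ↔ v ∈ weightSpace h (-j) := by
  rw [mem_weightSpace, mem_weightSpace, LinearMap.neg_apply, Int.cast_neg, neg_smul, neg_eq_iff_eq_neg]

lemma WeightsLE.neg (hN : WeightsLE h N) : WeightsLE (-h) N := by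
  intro j v hv hj
  exact hN (-j) v (mem_weightSpace_neg.1 hv) (by rwa [abs_neg])

lemma IsSl2Triple.f_pow_e_pow_of_mem_bot (t : IsSl2Triple h e f) (hN : WeightsLE h N) {m : V}
    (hm : m ∈ weightSpace h (-N)) : (f ^ N) ((e ^ N) m) = topScalar F N • m :=
  t.symm.e_pow_f_pow_of_mem_top hN.neg (mem_weightSpace_neg.2 hm)

lemma IsSl2Triple.e_pow_mem (t : IsSl2Triple h e f) {i : ℤ} {v : V} (hv : v ∈ weightSpace h i)
    (n : ℕ) : (e ^ n) v ∈ weightSpace h (i + 2 * n) := by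
  have := (t.hasDegree_e.pow n).apply_mem hv
  rwa [mul_comm (n : ℤ)] at this

lemma IsSl2Triple.f_pow_mem (t : IsSl2Triple h e f) {i : ℤ} {v : V} (hv : v ∈ weightSpace h i)
    (n : ℕ) : (f ^ n) v ∈ weightSpace h (i - 2 * n) := by
  have := (t.hasDegree_f.pow n).apply_mem hv
  rwa [show i + (n : ℤ) * -2 = i - 2 * n by ring] at this

lemma WeightsLE.eq_zero_of_hasDegree (hN : WeightsLE h N) {y : End F V} {d i : ℤ}
    (hy : HasDegree h y d) {v : V} (hv : v ∈ weightSpace h i) (hi : (N : ℤ) < |i + d|) : y v = 0 :=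
  hN _ _ (hy.apply_mem hv) hi

lemma IsSl2Triple.hasDegree_f_pow (t : IsSl2Triple h e f) (n : ℕ) :
    HasDegree h (f ^ n) (-(2 * n)) := by
  have := t.hasDegree_f.pow n
  rwa [show (n : ℤ) * -2 = -(2 * n) by ring] at this

/-- The largest `e`-stable subspace of the kernel of `f ^ N`. If no weight exceeds `N`, it is the sum
of the irreducible submodules of highest weight less than `N`. -/
noncomputable def core (e f : End F V) (N : ℕ) : Submodule F V :=
  ⨅ j : ℕ, LinearMap.ker (f ^ N * e ^ j)

lemma mem_core {v : V} : v ∈ core e f N ↔ ∀ j : ℕ, (f ^ N) ((e ^ j) v) = 0 := by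
  simp [core, Submodule.mem_iInf]

lemma e_mem_core {v : V} (hv : v ∈ core e f N) : e v ∈ core e f N := by
  rw [mem_core] at hv ⊢
  intro j
  rw [← Module.End.mul_apply (e ^ j), ← pow_succ]
  exact hv (j + 1)

lemma IsSl2Triple.f_pow_eq_zero_of_mem (t : IsSl2Triple h e f) (hN : WeightsLE h N) {i : ℤ} {v : V}
    (hv : v ∈ weightSpace h i) (hi : i ≠ N) : (f ^ N) v = 0 := by
  rcases lt_or_ge (N : ℤ) |i| with h1 | h1
  · rw [hN i v hv h1, map_zero]
  · refine hN _ _ (t.f_pow_mem hv N) ?_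
    rw [abs_le] at h1
    rw [abs_of_neg (by omega)]
    omega

/-- The chains `b a, e (b a), …, e ^ N (b a)`, where `b` is a basis of the component of lowest
weight. -/
noncomputable def bottomChains [FiniteDimensional F V] (h e : End F V) (N : ℕ) :
    (Σ _ : Fin (finrank F (weightSpace h (-N))), Fin (N + 1)) → V :=
  fun x => (e ^ (x.2 : ℕ)) (finBasis F (weightSpace h (-N)) x.1)

lemma IsSl2Triple.isChainFamily_bottomChains [FiniteDimensional F V] (t : IsSl2Triple h e f) (hN : WeightsLE h N) :
    IsChainFamily e (fun _ => N + 1) (bottomChains h e N) := by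
  intro i j
  rw [bottomChains, ← Module.End.mul_apply, ← pow_succ']
  split_ifs with hj
  · rfl
  · refine hN _ _ (t.e_pow_mem (finBasis F (weightSpace h (-N)) i).2 _) ?_
    have hj' : ¬ (j : ℕ) + 1 < N + 1 := hj
    rw [abs_of_nonneg] <;> push_cast <;> omega

lemma IsSl2Triple.eq_zero_of_e_pow [CharZero F] (t : IsSl2Triple h e f) (hN : WeightsLE h N) {m : V}
    (hm : m ∈ weightSpace h (-N)) (h0 : (e ^ N) m = 0) : m = 0 := by
  have h1 := t.f_pow_e_pow_of_mem_bot hN hm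
  rw [h0, map_zero] at h1
  exact (smul_eq_zero.1 h1.symm).resolve_left (topScalar_ne_zero N)

section

variable [CharZero F] [FiniteDimensional F V] [IsAlgClosed F]

lemma IsSl2Triple.weight_induction (t : IsSl2Triple h e f) {P : V → Prop} (h0 : P 0)
    (hadd : ∀ u v, P u → P v → P (u + v)) (hwt : ∀ (j : ℤ) (v : V), v ∈ weightSpace h j → P v)
    (v : V) : P v :=
  Submodule.iSup_induction (weightSpace h) (motive := P)
    (t.iSup_weightSpace ▸ Submodule.mem_top) hwt h0 hadd

/-- An operator of degree `-2N` only sees the component of highest weight `N`. -/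
lemma IsSl2Triple.exists_top_component (t : IsSl2Triple h e f) (hN : WeightsLE h N) (v : V) :
    ∃ a ∈ weightSpace h N, ∀ E : End F V, HasDegree h E (-(2 * N)) → E v = E a := by
  induction v using t.weight_induction with
  | h0 => exact ⟨0, zero_mem _, fun E _ => rfl⟩
  | hadd u v hu hv =>
    obtain ⟨a, ha, hau⟩ := hu
    obtain ⟨b, hb, hbv⟩ := hv
    exact ⟨a + b, add_mem ha hb, fun E hE => by rw [map_add, map_add, hau E hE, hbv E hE]⟩
  | hwt j v hv =>
    by_cases hj : j = N
    · subst hj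
      exact ⟨v, hv, fun E _ => rfl⟩
    · refine ⟨0, zero_mem _, fun E hE => ?_⟩
      rw [map_zero]
      rcases lt_or_ge (N : ℤ) |j| with h1 | h1
      · rw [hN j v hv h1, map_zero]
      · refine hN.eq_zero_of_hasDegree hE hv ?_
        rw [abs_le] at h1
        rw [abs_of_neg (by omega)]
        omega

/-- An operator of degree `-2N` and `f ^ N` both only see the component of highest weight `N`, on
which `f ^ N` is injective. -/
lemma IsSl2Triple.apply_eq_zero_of_f_pow (t : IsSl2Triple h e f) (hN : WeightsLE h N)
    {E : End F V} (hE : HasDegree h E (-(2 * N))) {v : V} (hv : (f ^ N) v = 0) : E v = 0 := by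
  obtain ⟨a, ha, hav⟩ := t.exists_top_component hN v
  have h1 := t.e_pow_f_pow_of_mem_top hN ha
  rw [← hav _ (t.hasDegree_f_pow N), hv, map_zero] at h1
  rw [hav E hE, (smul_eq_zero.1 h1.symm).resolve_left (topScalar_ne_zero N), map_zero]

lemma IsSl2Triple.apply_mem_bot (t : IsSl2Triple h e f) (hN : WeightsLE h N)
    {E : End F V} (hE : HasDegree h E (-(2 * N))) (v : V) : E v ∈ weightSpace h (-N) := by
  obtain ⟨a, ha, hav⟩ := t.exists_top_component hN v
  rw [hav E hE]
  have := hE.apply_mem ha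
  rwa [show (N : ℤ) + -(2 * N) = -N by ring] at this

omit [IsAlgClosed F] in
lemma IsSl2Triple.linearIndependent_bottomChains (t : IsSl2Triple h e f) (hN : WeightsLE h N) :
    LinearIndependent F (bottomChains h e N) := by
  refine (t.isChainFamily_bottomChains hN).linearIndependent (fun _ => N.succ_pos) ?_
  have := (finBasis F (weightSpace h (-N))).linearIndependent.map' ((e ^ N) ∘ₗ
    (weightSpace h (-N)).subtype) (by
      rw [LinearMap.ker_eq_bot']
      intro m hm
      exact Subtype.ext (t.eq_zero_of_e_pow hN m.2 hm))
  exact this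

/-- `V` is the direct sum of the span of the chains of length `N + 1` and of `core e f N`, both
`e`-stable. -/
lemma IsSl2Triple.isCompl_core (t : IsSl2Triple h e f) (hN : WeightsLE h N) :
    IsCompl (Submodule.span F (Set.range (bottomChains h e N))) (core e f N) := by
  have hch := t.isChainFamily_bottomChains hN
  constructor
  · rw [Submodule.disjoint_def]
    have hker : ∀ y ∈ Submodule.span F (Set.range (bottomChains h e N)), y ∈ core e f N →
        e y = 0 → y = 0 := by
      intro y hy hyc hey
      have h1 := hch.mem_span_of_apply_eq_zero (t.linearIndependent_bottomChains hN) hy hey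
      have h2 : y ∈ (weightSpace h (-N)).map (e ^ N) := by
        refine Submodule.span_le.2 ?_ h1
        rintro _ ⟨⟨i, j⟩, hj, rfl⟩
        have hj' : (j : ℕ) = N := by simpa using hj
        exact ⟨_, (finBasis F (weightSpace h (-N)) i).2, by rw [bottomChains]; simp [hj']⟩
      obtain ⟨m, hm, rfl⟩ := h2
      have h3 := mem_core.1 hyc 0
      rw [pow_zero, Module.End.one_apply, t.f_pow_e_pow_of_mem_bot hN hm] at h3
      rw [(smul_eq_zero.1 h3).resolve_left (topScalar_ne_zero N), map_zero]
    intro y hy hyc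
    obtain ⟨n, hn⟩ := t.hasDegree_e.isNilpotent (by norm_num)
    have hall : ∀ k : ℕ, ∀ y ∈ Submodule.span F (Set.range (bottomChains h e N)),
        y ∈ core e f N → (e ^ k) y = 0 → y = 0 := by
      intro k
      induction k with
      | zero => intro y _ _ h0; simpa using h0
      | succ k ih =>
        intro y hy hyc h0
        refine hker y hy hyc (ih _ ?_ (e_mem_core hyc) ?_)
        · have := hch.map_le 1
          rw [pow_one] at this
          exact this ⟨y, hy, rfl⟩
        · rwa [← Module.End.mul_apply, ← pow_succ]
    exact hall n y hy hyc (by rw [hn, LinearMap.zero_apply])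
  · rw [codisjoint_iff, eq_top_iff]
    rintro v -
    induction v using t.weight_induction with
    | h0 => exact zero_mem _
    | hadd u v hu hv => exact add_mem hu hv
    | hwt i v hv =>
      by_cases hs : ∃ s : ℕ, i + 2 * s = N
      · obtain ⟨s, hs⟩ := hs
        rcases lt_or_ge N s with h1 | h1
        · have : v = 0 := hN i v hv (by rw [abs_of_neg (by omega)]; omega)
          rw [this]
          exact zero_mem _
        obtain ⟨j, rfl⟩ := Nat.exists_eq_add_of_le h1
        -- the component of `v` in the chains is `e ^ j m`, where `e ^ N m = e ^ s v`
        set m := (topScalar F (s + j))⁻¹ • (f ^ (s + j)) ((e ^ s) v) with hm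
        have hesv : (e ^ s) v ∈ weightSpace h (s + j : ℕ) := by
          have := t.e_pow_mem hv s
          rwa [hs] at this
        have hmem : m ∈ weightSpace h (-(s + j : ℕ)) := by
          refine Submodule.smul_mem _ _ ?_
          have := t.f_pow_mem hesv (s + j)
          rwa [show ((s + j : ℕ) : ℤ) - 2 * (s + j : ℕ) = -(s + j : ℕ) by ring] at this
        have hejm : (e ^ j) m ∈ Submodule.span F (Set.range (bottomChains h e (s + j))) := by
          have h2 : m ∈ (Submodule.span F (Set.range
              (finBasis F (weightSpace h (-(s + j : ℕ)))))).map
              (weightSpace h (-(s + j : ℕ))).subtype := by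
            rw [(finBasis F (weightSpace h (-(s + j : ℕ)))).span_eq]
            exact ⟨⟨m, hmem⟩, trivial, rfl⟩
          have h3 := Submodule.mem_map_of_mem (f := e ^ j) h2
          rw [Submodule.map_span, Submodule.map_span] at h3
          refine Submodule.span_le.2 ?_ h3
          rintro _ ⟨_, ⟨_, ⟨i, rfl⟩, rfl⟩, rfl⟩
          exact Submodule.subset_span ⟨⟨i, ⟨j, by omega⟩⟩, rfl⟩
        rw [← add_sub_cancel ((e ^ j) m) v]
        refine Submodule.add_mem_sup hejm (mem_core.2 fun l => ?_)
        by_cases hl : l = s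
        · subst hl
          rw [map_sub, map_sub, ← Module.End.mul_apply (e ^ l), ← pow_add,
            t.f_pow_e_pow_of_mem_bot hN hmem, hm, smul_smul,
            mul_inv_cancel₀ (topScalar_ne_zero _), one_smul, sub_self]
        · have hw : v - (e ^ j) m ∈ weightSpace h i := by
            refine sub_mem hv ?_
            have := t.e_pow_mem hmem j
            rwa [show -((s + j : ℕ) : ℤ) + 2 * j = i by push_cast at hs ⊢; omega] at this
          exact t.f_pow_eq_zero_of_mem hN (t.e_pow_mem hw l) (by omega)
      · refine Submodule.mem_sup_right (mem_core.2 fun l => ?_)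
        exact t.f_pow_eq_zero_of_mem hN (t.e_pow_mem hv l) fun h => hs ⟨l, h⟩

end

end Top

/-! ### Eigenvalues and minimal polynomials of cyclic elements -/

section Eigenvalues

variable {F V : Type*} [Field F] [AddCommGroup V] [Module F V]

/-- If `x ^ n u = ζ ^ n u`, then `∑ ζ ^ (n - 1 - i) x ^ i u` is an eigenvector, unless it is zero. -/
lemma hasEigenvalue_of_pow_apply {U : Type*} [AddCommGroup U] [Module F U] {x : End F V} {u : V}
    {n : ℕ} (hn : 0 < n) {ζ : F} (hζ : ζ ≠ 0) (hx : (x ^ n) u = ζ ^ n • u) (Φ : V →ₗ[F] U)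
    (hu : Φ u ≠ 0) (hΦ : ∀ i, 0 < i → i < n → Φ ((x ^ i) u) = 0) : x.HasEigenvalue ζ := by
  set z : End F V := algebraMap F (End F V) ζ with hz
  have hcomm : Commute x z := (Algebra.commutes ζ x).symm
  have hgeom := hcomm.mul_geom_sum₂ n
  set S := ∑ i ∈ Finset.range n, x ^ i * z ^ (n - 1 - i) with hS
  have hSu : Φ (S u) = ζ ^ (n - 1) • Φ u := by
    rw [hS, LinearMap.sum_apply, map_sum, Finset.sum_eq_single 0]
    · simp [hz, ← map_pow, Module.algebraMap_end_apply]
    · intro i hi hi0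
      rw [hz, ← map_pow, Module.End.mul_apply, Module.algebraMap_end_apply, map_smul, map_smul,
        hΦ i (Nat.pos_of_ne_zero hi0) (Finset.mem_range.1 hi), smul_zero]
    · intro h; exact absurd (Finset.mem_range.2 hn) h
  refine Module.End.hasEigenvalue_of_hasEigenvector (x := S u) ⟨?_, ?_⟩
  · have h1 := congrArg (fun g : End F V => g u) hgeom
    simp only [Module.End.mul_apply, LinearMap.sub_apply] at h1
    rw [hx, hz, ← map_pow, Module.algebraMap_end_apply, Module.algebraMap_end_apply, sub_self,
      sub_eq_zero] at h1
    exact Module.End.mem_eigenspace_iff.2 h1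
  · intro h0
    rw [h0, map_zero] at hSu
    exact hu ((smul_eq_zero.1 hSu.symm).resolve_left (pow_ne_zero _ hζ))

lemma exists_finset_roots [IsAlgClosed F] [CharZero F] {n : ℕ} (hn : 0 < n) (Λ : Finset F)
    (hΛ : (0 : F) ∉ Λ) :
    ∃ Z : Finset F, Z.card = Λ.card * n ∧ (∀ ζ ∈ Z, ζ ^ n ∈ Λ) ∧ (0 : F) ∉ Z := by
  classical
  have hroots : ∀ l ∈ Λ, (nthRoots n l).toFinset.card = n := by
    intro l hl
    have hl0 : l ≠ 0 := fun h => hΛ (h ▸ hl)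
    have hsep : (X ^ n - C l : F[X]).Separable :=
      separable_X_pow_sub_C l (by exact_mod_cast hn.ne') hl0
    rw [nthRoots, Multiset.toFinset_card_of_nodup (nodup_roots hsep),
      ← (IsAlgClosed.splits (X ^ n - C l)).natDegree_eq_card_roots, natDegree_X_pow_sub_C]
  refine ⟨Λ.biUnion fun l => (nthRoots n l).toFinset, ?_, ?_, ?_⟩
  · rw [Finset.card_biUnion, Finset.sum_congr rfl hroots, Finset.sum_const, smul_eq_mul]
    intro a _ b _ hab
    rw [Function.onFun, Finset.disjoint_left]
    intro ζ ha hb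
    rw [Multiset.mem_toFinset, mem_nthRoots hn] at ha hb
    exact hab (ha.symm.trans hb)
  · intro ζ hζ
    obtain ⟨l, hl, h⟩ := Finset.mem_biUnion.1 hζ
    rw [Multiset.mem_toFinset, mem_nthRoots hn] at h
    rwa [h]
  · intro h0
    obtain ⟨l, hl, h⟩ := Finset.mem_biUnion.1 h0
    rw [Multiset.mem_toFinset, mem_nthRoots hn, zero_pow hn.ne'] at h
    exact hΛ (h ▸ hl)

lemma natDegree_minpoly_le [FiniteDimensional F V] {x : End F V} {p : F[X]} (hp : p ≠ 0)
    (hx : aeval x p = 0) : (minpoly F x).natDegree ≤ p.natDegree :=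
  natDegree_le_of_dvd (minpoly.dvd F x hx) hp

end Eigenvalues

section Cyclic

variable {F V : Type*} [Field F] [AddCommGroup V] [Module F V] {h e f : End F V} {N : ℕ}

lemma IsSl2Triple.e_pow_eq_zero (t : IsSl2Triple h e f) (hN : WeightsLE h N) {i : ℤ} {v : V}
    (hv : v ∈ weightSpace h i) {j : ℕ} (hj : (N : ℤ) < i + 2 * j) : (e ^ j) v = 0 :=
  hN _ _ (t.e_pow_mem hv j) (hj.trans_le (le_abs_self _))

variable [CharZero F] [FiniteDimensional F V] [IsAlgClosed F] {E : End F V}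

lemma IsSl2Triple.cyclic_apply_of_mem_core (t : IsSl2Triple h e f) (hN : WeightsLE h N)
    (hE : HasDegree h E (-(2 * N))) {v : V} (hv : v ∈ core e f N) : (e + E) v = e v := by
  rw [LinearMap.add_apply, t.apply_eq_zero_of_f_pow hN hE (by simpa using mem_core.1 hv 0),
    add_zero]

lemma IsSl2Triple.cyclic_pow_of_mem_core (t : IsSl2Triple h e f) (hN : WeightsLE h N)
    (hE : HasDegree h E (-(2 * N))) (j : ℕ) {v : V} (hv : v ∈ core e f N) :
    ((e + E) ^ j) v = (e ^ j) v := by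
  induction j generalizing v with
  | zero => rfl
  | succ j ih =>
    rw [pow_succ, pow_succ, Module.End.mul_apply, Module.End.mul_apply,
      t.cyclic_apply_of_mem_core hN hE hv, ih (e_mem_core hv)]

/-- On `core` the cyclic element `e + E` is the nilpotent operator `e`. -/
lemma IsSl2Triple.core_le_ker_of_isSemisimple (t : IsSl2Triple h e f) (hN : WeightsLE h N)
    (hE : HasDegree h E (-(2 * N))) (hss : (e + E).IsSemisimple) :
    ∀ v ∈ core e f N, e v = 0 := by
  intro v hv
  obtain ⟨k, hk⟩ := t.hasDegree_e.isNilpotent (by norm_num)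
  have := eq_zero_of_isSemisimple_of_pow_apply hss (v := v) (k := k)
    (by rw [t.cyclic_pow_of_mem_core hN hE k hv, hk, LinearMap.zero_apply])
  rwa [t.cyclic_apply_of_mem_core hN hE hv] at this

lemma IsSl2Triple.cyclic_pow_of_mem_bot (t : IsSl2Triple h e f) (hN : WeightsLE h N)
    (hE : HasDegree h E (-(2 * N))) {m : V} (hm : m ∈ weightSpace h (-N)) {j : ℕ} (hj : j ≤ N) :
    ((e + E) ^ j) m = (e ^ j) m := by
  induction j with
  | zero => rfl
  | succ j ih =>
    rw [pow_succ', pow_succ', Module.End.mul_apply, Module.End.mul_apply, ih (by omega),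
      LinearMap.add_apply, t.apply_eq_zero_of_f_pow hN hE
        (t.f_pow_eq_zero_of_mem hN (t.e_pow_mem hm j) (by omega)), add_zero]

/-- The power `(e + E) ^ (N + 1)` acts on the component of lowest weight as `E e ^ N`. So the
spectrum of `e + E` consists of the `(N + 1)`-st roots of the eigenvalues of `E e ^ N`, and of `0`
if `core` is not zero. -/
lemma IsSl2Triple.cyclic_pow_succ_of_mem_bot (t : IsSl2Triple h e f) (hN : WeightsLE h N)
    (hE : HasDegree h E (-(2 * N))) {m : V} (hm : m ∈ weightSpace h (-N)) :
    ((e + E) ^ (N + 1)) m = (E * e ^ N) m := by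
  rw [pow_succ', Module.End.mul_apply, t.cyclic_pow_of_mem_bot hN hE hm le_rfl,
    LinearMap.add_apply, ← Module.End.mul_apply e, ← pow_succ',
    t.e_pow_eq_zero hN hm (by push_cast; omega), zero_add, Module.End.mul_apply]

/-- If `g` annihilates `E e ^ N` on the component of lowest weight, then `g (X ^ (N + 1))`
annihilates `e + E` on the chains that begin there. -/
lemma IsSl2Triple.aeval_cyclic_eq_zero (t : IsSl2Triple h e f) (hN : WeightsLE h N)
    (hE : HasDegree h E (-(2 * N))) {g : F[X]}
    (hg : ∀ m ∈ weightSpace h (-N), aeval (E * e ^ N) g m = 0) {p : F[X]}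
    (hp : expand F (N + 1) g ∣ p) (hcore : ∀ v ∈ core e f N, aeval (e + E) p v = 0) :
    aeval (e + E) p = 0 := by
  have hbot : ∀ m ∈ weightSpace h (-N), aeval (e + E) (expand F (N + 1) g) m = 0 := by
    intro m hm
    rw [expand_aeval, ← hg m hm]
    set M := weightSpace h (-N)
    have hmaps : ∀ m ∈ M, (E * e ^ N) m ∈ M := fun m _ => t.apply_mem_bot hN hE _
    have h1 := aeval_apply_of_intertwines (A := (E * e ^ N).restrict hmaps) (Y := E * e ^ N)
      M.subtype (fun _ => rfl) g ⟨m, hm⟩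
    have h2 := aeval_apply_of_intertwines (A := (E * e ^ N).restrict hmaps)
      (Y := (e + E) ^ (N + 1)) M.subtype
      (fun u => (t.cyclic_pow_succ_of_mem_bot hN hE u.2).symm) g ⟨m, hm⟩
    exact h2.symm.trans h1
  obtain ⟨q, rfl⟩ := hp
  have hspan : Submodule.span F (Set.range (bottomChains h e N)) ≤
      LinearMap.ker (aeval (e + E) (expand F (N + 1) g * q)) := by
    rw [Submodule.span_le]
    rintro _ ⟨⟨i, j⟩, rfl⟩
    set m := finBasis F (weightSpace h (-N)) i
    change aeval (e + E) (expand F (N + 1) g * q) ((e ^ (j : ℕ)) m) = 0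
    rw [← t.cyclic_pow_of_mem_bot hN hE m.2 (by omega), ← Module.End.mul_apply]
    have hswap : aeval (e + E) (expand F (N + 1) g * q) * (e + E) ^ (j : ℕ) =
        aeval (e + E) (q * X ^ (j : ℕ)) * aeval (e + E) (expand F (N + 1) g) := by
      rw [show (e + E) ^ (j : ℕ) = aeval (e + E) (X ^ (j : ℕ) : F[X]) by simp, ← map_mul, ← map_mul]
      congr 1
      ring
    rw [hswap, Module.End.mul_apply, hbot m m.2, map_zero]
  rw [← LinearMap.ker_eq_top, eq_top_iff, ← (t.isCompl_core hN).sup_eq_top]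
  exact sup_le hspan fun v hv => hcore v hv

lemma IsSl2Triple.natDegree_minpoly_cyclic_le (t : IsSl2Triple h e f) (hN : WeightsLE h N)
    (hE : HasDegree h E (-(2 * N))) {κ : ℕ} {g : F[X]} (hg0 : g ≠ 0) (hgκ : g.natDegree ≤ κ)
    (hg : ∀ m ∈ weightSpace h (-N), aeval (E * e ^ N) g m = 0)
    (hcore : ∀ v ∈ core e f N, e v = 0) {δ : ℕ} (hδ : core e f N = ⊥ ∧ δ = 0 ∨ δ = 1) :
    (minpoly F (e + E)).natDegree ≤ κ * (N + 1) + δ := by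
  have hp0 : expand F (N + 1) g * X ^ δ ≠ 0 :=
    mul_ne_zero ((expand_ne_zero N.succ_pos).2 hg0) (pow_ne_zero _ X_ne_zero)
  refine (natDegree_minpoly_le hp0 (t.aeval_cyclic_eq_zero hN hE hg (dvd_mul_right _ _)
    fun v hv => ?_)).trans ?_
  · rcases hδ with ⟨h0, -⟩ | rfl
    · rw [h0, Submodule.mem_bot] at hv
      rw [hv, map_zero]
    · rw [pow_one, map_mul, aeval_X, Module.End.mul_apply, t.cyclic_apply_of_mem_core hN hE hv,
        hcore v hv, map_zero]
  · rw [natDegree_mul ((expand_ne_zero N.succ_pos).2 hg0) (pow_ne_zero _ X_ne_zero),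
      natDegree_expand, natDegree_X_pow]
    exact Nat.add_le_add_right (Nat.mul_le_mul_right _ hgκ) _

lemma IsSl2Triple.hasEigenvalue_cyclic (t : IsSl2Triple h e f) (hN : WeightsLE h N)
    (hE : HasDegree h E (-(2 * N))) {ζ : F} (hζ : ζ ≠ 0) {m : V} (hm : m ∈ weightSpace h (-N))
    (hm0 : m ≠ 0) (hEm : E ((e ^ N) m) = ζ ^ (N + 1) • m) : (e + E).HasEigenvalue ζ := by
  refine hasEigenvalue_of_pow_apply N.succ_pos hζ (u := m) ?_ (e ^ N)
    (fun h0 => hm0 (t.eq_zero_of_e_pow hN hm h0)) fun i hi0 hi => ?_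
  · rw [t.cyclic_pow_succ_of_mem_bot hN hE hm, Module.End.mul_apply, hEm]
  · rw [t.cyclic_pow_of_mem_bot hN hE hm (by omega), ← Module.End.mul_apply, ← pow_add,
      t.e_pow_eq_zero hN hm (by push_cast; omega)]

lemma IsSl2Triple.exists_finset_eigenvalues_cyclic (t : IsSl2Triple h e f) (hN : WeightsLE h N)
    (hE : HasDegree h E (-(2 * N))) (hcore : ∀ v ∈ core e f N, e v = 0) {Λ : Finset F}
    (hΛ0 : (0 : F) ∉ Λ)
    (hΛ : ∀ l ∈ Λ, ∃ m ∈ weightSpace h (-N), m ≠ 0 ∧ E ((e ^ N) m) = l • m) :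
    ∃ Z : Finset F, Λ.card * (N + 1) + min 1 (finrank F (core e f N)) ≤ Z.card ∧
      ∀ ζ ∈ Z, (e + E).HasEigenvalue ζ := by
  classical
  obtain ⟨Z, hZcard, hZ, hZ0⟩ := exists_finset_roots N.succ_pos Λ hΛ0
  have hZev : ∀ ζ ∈ Z, (e + E).HasEigenvalue ζ := by
    intro ζ hζ
    obtain ⟨m, hm, hm0, hEm⟩ := hΛ _ (hZ ζ hζ)
    exact t.hasEigenvalue_cyclic hN hE (fun h => hZ0 (h ▸ hζ)) hm hm0 hEm
  by_cases hbot : core e f N = ⊥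
  · exact ⟨Z, by rw [hZcard, hbot, finrank_bot]; simp, hZev⟩
  · refine ⟨insert 0 Z, ?_, fun ζ hζ => ?_⟩
    · rw [Finset.card_insert_of_notMem hZ0, hZcard]
      exact Nat.add_le_add_left (min_le_left _ _) _
    rcases Finset.mem_insert.1 hζ with rfl | hζ
    · obtain ⟨v, hv, hv0⟩ := Submodule.exists_mem_ne_zero_of_ne_bot hbot
      refine Module.End.hasEigenvalue_of_hasEigenvector (x := v)
        ⟨Module.End.mem_eigenspace_iff.2 ?_, hv0⟩
      rw [t.cyclic_apply_of_mem_core hN hE hv, hcore v hv, zero_smul]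
    · exact hZev ζ hζ

end Cyclic

/-! ### Self-adjoint operators for a bilinear form -/

section SelfAdjoint

variable {F M : Type*} [Field F] [AddCommGroup M] [Module F M] [FiniteDimensional F M]

/-- Over an infinite field some vector has the same annihilating polynomials as the operator. -/
lemma exists_cyclic_annihilator [IsAlgClosed F] (A : End F M) :
    ∃ v : M, ∀ p : F[X], aeval A p v = 0 → minpoly F A ∣ p := by
  classical
  have hmon := minpoly.monic (Algebra.IsIntegral.isIntegral (R := F) A)
  have hdvd : ∀ ζ ∈ (minpoly F A).roots.toFinset, (X - C ζ) ∣ minpoly F A := fun ζ hζ =>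
    dvd_iff_isRoot.2 (isRoot_of_mem_roots (Multiset.mem_toFinset.1 hζ))
  choose! μ' hμ' using hdvd
  have hinf : Infinite F := IsAlgClosed.instInfinite
  set S : Finset (Submodule F M) :=
    (minpoly F A).roots.toFinset.image fun ζ => LinearMap.ker (aeval A (μ' ζ)) with hS
  have hnot : ⊤ ∉ S := by
    intro h
    obtain ⟨ζ, hζ, hker⟩ := Finset.mem_image.1 h
    have h0 : aeval A (μ' ζ) = 0 := LinearMap.ker_eq_top.1 hker
    have hμ0 : μ' ζ ≠ 0 := by
      intro h1
      have := hμ' ζ hζ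
      rw [h1, mul_zero] at this
      exact hmon.ne_zero this
    have h1 := natDegree_le_of_dvd (minpoly.dvd F A h0) hμ0
    have h2 := congrArg natDegree (hμ' ζ hζ)
    rw [natDegree_mul (X_sub_C_ne_zero ζ) hμ0, natDegree_X_sub_C] at h2
    omega
  obtain ⟨v, hv⟩ : ∃ v, v ∉ ⋃ p ∈ S, (p : Set M) := by
    by_contra! h
    exact Subspace.biUnion_ne_univ_of_top_notMem hnot (Set.eq_univ_of_forall h)
  refine ⟨v, fun p hp => ?_⟩
  set d := EuclideanDomain.gcd p (minpoly F A) with hd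
  have hdv : aeval A d v = 0 := by
    rw [hd, EuclideanDomain.gcd_eq_gcd_ab, map_add, mul_comm, map_mul, mul_comm (minpoly F A),
      map_mul]
    simp [hp, minpoly.aeval]
  obtain ⟨c, hc⟩ : d ∣ minpoly F A := EuclideanDomain.gcd_dvd_right _ _
  by_cases hcu : IsUnit c
  · obtain ⟨u, rfl⟩ := hcu
    have : minpoly F A ∣ d := ⟨(u⁻¹ : F[X]ˣ), by rw [hc, mul_assoc, Units.mul_inv, mul_one]⟩
    exact this.trans (EuclideanDomain.gcd_dvd_left _ _)
  · have hc0 : c ≠ 0 := by rintro rfl; rw [mul_zero] at hc; exact hmon.ne_zero hc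
    have hdeg : c.degree ≠ 0 := fun h => hcu (isUnit_iff_degree_eq_zero.2 h)
    obtain ⟨ζ, hζ⟩ := IsAlgClosed.exists_root c hdeg
    obtain ⟨c', rfl⟩ := dvd_iff_isRoot.2 hζ
    have hmem : ζ ∈ (minpoly F A).roots.toFinset := by
      rw [Multiset.mem_toFinset, mem_roots hmon.ne_zero, ← dvd_iff_isRoot, hc]
      exact ⟨d * c', by ring⟩
    have hμd : μ' ζ = c' * d := by
      have h1 := hμ' ζ hmem
      rw [hc] at h1
      exact mul_left_cancel₀ (X_sub_C_ne_zero ζ) (by rw [← h1]; ring)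
    exfalso
    apply hv
    refine Set.mem_biUnion (Finset.mem_coe.2 (Finset.mem_image_of_mem _ hmem)) ?_
    change aeval A (μ' ζ) v = 0
    rw [hμd, map_mul, Module.End.mul_apply, hdv, map_zero]

/-- An operator that is self-adjoint for a non-degenerate alternating form has a minimal polynomial
of degree at most half the dimension, because its cyclic subspaces are isotropic. -/
lemma two_mul_natDegree_minpoly_le [IsAlgClosed F] [CharZero F] {β : LinearMap.BilinForm F M}
    (hnd : β.Nondegenerate) (hβ : ∀ u v, β u v = -β v u) {A : End F M}
    (hA : ∀ u v, β (A u) v = β u (A v)) : 2 * (minpoly F A).natDegree ≤ finrank F M := by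
  obtain ⟨v, hv⟩ := exists_cyclic_annihilator A
  have hmon := minpoly.monic (Algebra.IsIntegral.isIntegral (R := F) A)
  set r := (minpoly F A).natDegree with hr
  set c : Fin r → M := fun i => (A ^ (i : ℕ)) v with hc
  have hli : LinearIndependent F c := by
    rw [Fintype.linearIndependent_iff]
    intro a ha i
    have h1 : aeval A (polyOfCoeffs a) v = 0 := by
      rw [← ha, polyOfCoeffs, map_sum, LinearMap.sum_apply]
      refine Finset.sum_congr rfl fun j _ => ?_
      simp [hc, Module.algebraMap_end_apply]
    have h2 := hv _ h1
    have h3 : polyOfCoeffs a = 0 := by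
      refine eq_zero_of_dvd_of_degree_lt h2 ?_
      rw [degree_eq_natDegree hmon.ne_zero]
      exact polyOfCoeffs_degree a
    rw [← polyOfCoeffs_coeff a i, h3, coeff_zero]
  have hpow : ∀ (n : ℕ) (u w : M), β ((A ^ n) u) w = β u ((A ^ n) w) := by
    intro n
    induction n with
    | zero => simp
    | succ n ih =>
      intro u w
      rw [pow_succ, Module.End.mul_apply, ih, hA, ← Module.End.mul_apply, ← pow_succ', ← pow_succ]
  have hiso : ∀ i j : ℕ, β ((A ^ i) v) ((A ^ j) v) = 0 := by
    intro i j
    have h1 : ∀ i j : ℕ, β ((A ^ i) v) ((A ^ j) v) = β v ((A ^ (i + j)) v) := fun i j => by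
      rw [hpow, pow_add, Module.End.mul_apply]
    have h2 := hβ ((A ^ i) v) ((A ^ j) v)
    rw [h1 j i, add_comm j i, ← h1] at h2
    have : (2 : F) * β ((A ^ i) v) ((A ^ j) v) = 0 := by linear_combination h2
    exact (mul_eq_zero.1 this).resolve_left two_ne_zero
  set S := Submodule.span F (Set.range c) with hS
  have hle : S ≤ β.orthogonal S := by
    rw [hS, Submodule.span_le]
    rintro _ ⟨j, rfl⟩
    rw [SetLike.mem_coe, LinearMap.BilinForm.mem_orthogonal_iff]
    intro w hw
    change β w (c j) = 0
    induction hw using Submodule.span_induction with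
    | mem w hw => obtain ⟨i, rfl⟩ := hw; exact hiso i j
    | zero => simp
    | add x y _ _ hx hy => rw [map_add, LinearMap.add_apply, hx, hy, add_zero]
    | smul a x _ hx => rw [map_smul, LinearMap.smul_apply, hx, smul_zero]
  have h1 := Submodule.finrank_mono hle
  have h2 := Submodule.finrank_le S
  rw [LinearMap.BilinForm.finrank_orthogonal hnd] at h1
  rw [hS, finrank_span_eq_card hli, Fintype.card_fin] at h1 h2
  omega

/-- A non-degenerate symmetric or alternating form contains as many hyperbolic pairs as its
dimension allows. -/
lemma exists_hyperbolic_pairs [IsAlgClosed F] [CharZero F] {β : LinearMap.BilinForm F M} {σ : F}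
    (hσ : σ * σ = 1) (hβ : ∀ u v, β u v = σ * β v u) (hnd : β.Nondegenerate) (κ : ℕ)
    (hκ : 2 * κ ≤ finrank F M) :
    ∃ p q : Fin κ → M, (∀ a b, β (p a) (p b) = 0) ∧ (∀ a b, β (q a) (q b) = 0) ∧
      ∀ a b, β (p a) (q b) = if a = b then 1 else 0 := by
  induction κ with
  | zero => exact ⟨Fin.elim0, Fin.elim0, fun a => a.elim0, fun a => a.elim0, fun a => a.elim0⟩
  | succ κ ih =>
    obtain ⟨p, q, hpp, hqq, hpq⟩ := ih (by omega)
    have hqp : ∀ a b, β (q a) (p b) = if a = b then σ else 0 := by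
      intro a b
      rw [hβ, hpq]
      by_cases h : a = b
      · simp [h]
      · rw [if_neg (Ne.symm h), if_neg h, mul_zero]
    -- the orthogonal complement of the pairs found so far
    set Φ : M →ₗ[F] (Fin κ → F) × (Fin κ → F) :=
      (LinearMap.pi fun a => β (p a)).prod (LinearMap.pi fun a => β (q a)) with hΦ
    have hmem : ∀ v, v ∈ LinearMap.ker Φ ↔ (∀ a, β (p a) v = 0) ∧ ∀ a, β (q a) v = 0 := by
      intro v
      simp [hΦ, LinearMap.mem_ker, funext_iff]
    have hdim : 2 ≤ finrank F (LinearMap.ker Φ) := by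
      have h1 := LinearMap.finrank_range_add_finrank_ker Φ
      have h2 := Submodule.finrank_le (LinearMap.range Φ)
      rw [Module.finrank_prod, Module.finrank_fin_fun] at h2
      omega
    obtain ⟨x, hx, hx0⟩ : ∃ x ∈ LinearMap.ker Φ, x ≠ 0 := by
      apply Submodule.exists_mem_ne_zero_of_ne_bot
      intro h
      rw [h, finrank_bot] at hdim
      omega
    obtain ⟨y, hy, hyx⟩ : ∃ y ∈ LinearMap.ker Φ, y ∉ Submodule.span F {x} := by
      by_contra! h
      have h1 := Submodule.finrank_mono (show LinearMap.ker Φ ≤ Submodule.span F {x} from h)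
      have h2 := finrank_span_le_card (R := F) ({x} : Set M)
      simp at h2
      omega
    obtain ⟨v, hv, hv0, hvv⟩ : ∃ v ∈ LinearMap.ker Φ, v ≠ 0 ∧ β v v = 0 := by
      by_cases hxx : β x x = 0
      · exact ⟨x, hx, hx0, hxx⟩
      · have hs : ∃ s : F, discrim (β x x) (β x y + β y x) (β y y) = s * s :=
          IsAlgClosed.exists_eq_mul_self _
        obtain ⟨t, ht⟩ := exists_quadratic_eq_zero hxx hs
        refine ⟨t • x + y, add_mem (Submodule.smul_mem _ _ hx) hy, ?_, ?_⟩
        · intro h0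
          apply hyx
          rw [eq_neg_of_add_eq_zero_right h0]
          exact neg_mem (Submodule.smul_mem _ _ (Submodule.mem_span_singleton_self x))
        · simp only [map_add, map_smul, LinearMap.add_apply, LinearMap.smul_apply, smul_eq_mul]
          linear_combination ht
    obtain ⟨hvp, hvq⟩ := (hmem v).1 hv
    obtain ⟨z₀, hz₀⟩ : ∃ z, β v z = 1 := by
      obtain ⟨z, hz⟩ : ∃ z, β v z ≠ 0 := by
        by_contra! h
        exact hv0 (hnd.1 v h)
      exact ⟨(β v z)⁻¹ • z, by rw [map_smul, smul_eq_mul, inv_mul_cancel₀ hz]⟩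
    set z₁ := z₀ - ∑ a, β (p a) z₀ • q a - ∑ a, (σ * β (q a) z₀) • p a with hz₁
    have hvp' : ∀ a, β v (p a) = 0 := fun a => by rw [hβ, hvp, mul_zero]
    have hvq' : ∀ a, β v (q a) = 0 := fun a => by rw [hβ, hvq, mul_zero]
    have hpz : ∀ a, β (p a) z₁ = 0 := by
      intro a
      simp [hz₁, map_sub, map_sum, hpp, hpq]
    have hqz : ∀ a, β (q a) z₁ = 0 := by
      intro a
      simp only [hz₁, map_sub, map_sum, map_smul, hqq, hqp, smul_eq_mul, mul_zero,
        Finset.sum_const_zero, sub_zero, mul_ite, Finset.sum_ite_eq, Finset.mem_univ, if_true]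
      linear_combination (-β (q a) z₀) * hσ
    have hvz : β v z₁ = 1 := by
      simp [hz₁, map_sub, map_sum, hvp', hvq', hz₀]
    set z := z₁ - (β z₁ z₁ / 2) • v with hz
    have hpz' : ∀ a, β (p a) z = 0 := fun a => by simp [hz, hpz, hvp]
    have hqz' : ∀ a, β (q a) z = 0 := fun a => by simp [hz, hqz, hvq]
    have hvz' : β v z = 1 := by simp [hz, hvz, hvv]
    have hzz : β z z = 0 := by
      have h1 : β z₁ v = σ := by rw [hβ, hvz, mul_one]
      have h2 := hβ z₁ z₁
      simp only [hz, map_sub, map_smul, LinearMap.sub_apply, LinearMap.smul_apply, hvv, hvz, h1,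
        smul_eq_mul]
      linear_combination (1 / 2 : F) * h2
    refine ⟨Fin.cons v p, Fin.cons z q, ?_, ?_, ?_⟩
    · intro a b
      refine Fin.cases ?_ (fun a => ?_) a <;> refine Fin.cases ?_ (fun b => ?_) b <;>
        simp [hvv, hvp, hvp', hpp]
    · intro a b
      refine Fin.cases ?_ (fun a => ?_) a <;> refine Fin.cases ?_ (fun b => ?_) b <;>
        simp [hzz, hqz', hqq, hβ z]
    · intro a b
      refine Fin.cases ?_ (fun a => ?_) a <;> refine Fin.cases ?_ (fun b => ?_) b <;>
        simp [hvz', hpz', hvq', hpq, Fin.succ_inj, Fin.succ_ne_zero, (Fin.succ_ne_zero _).symm]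

end SelfAdjoint

/-! ### The operators on the component of lowest weight -/

section Degree

variable {F V : Type*} [Field F] [AddCommGroup V] [Module F V] {h x y : End F V} {c : ℤ}

lemma HasDegree.zero : HasDegree h (0 : End F V) c := fun v => by simp

lemma HasDegree.add (hx : HasDegree h x c) (hy : HasDegree h y c) : HasDegree h (x + y) c := by
  intro v
  rw [LinearMap.add_apply, map_add, hx, hy, LinearMap.add_apply, smul_add]
  abel

lemma HasDegree.smul (hx : HasDegree h x c) (a : F) : HasDegree h (a • x) c := by
  intro v
  rw [LinearMap.smul_apply, map_smul, hx, LinearMap.smul_apply, smul_add, smul_comm a]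

lemma HasDegree.sum {ι : Type*} {s : Finset ι} {x : ι → End F V}
    (hx : ∀ i ∈ s, HasDegree h (x i) c) : HasDegree h (∑ i ∈ s, x i) c := by
  classical
  induction s using Finset.induction_on with
  | empty => simpa using HasDegree.zero
  | insert i s hi ih =>
    rw [Finset.sum_insert hi]
    exact (hx i (Finset.mem_insert_self _ _)).add
      (ih fun j hj => hx j (Finset.mem_insert_of_mem hj))

end Degree

section BottomOperator

variable {F V : Type*} [Field F] [AddCommGroup V] [Module F V] {h e f : End F V} {N : ℕ}
  [CharZero F] [FiniteDimensional F V] [IsAlgClosed F] {E : End F V}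

/-- The restriction of `E e ^ N` to the component of lowest weight, for `E` of degree `-2N`. -/
noncomputable def bottomOperator (t : IsSl2Triple h e f) (hN : WeightsLE h N)
    (hE : HasDegree h E (-(2 * N))) : End F (weightSpace h (-N)) :=
  (E * e ^ N).restrict fun _ _ => t.apply_mem_bot hN hE _

lemma coe_bottomOperator (t : IsSl2Triple h e f) (hN : WeightsLE h N)
    (hE : HasDegree h E (-(2 * N))) (m : weightSpace h (-N)) :
    (bottomOperator t hN hE m : V) = E ((e ^ N) m) := rfl

lemma aeval_bottomOperator (t : IsSl2Triple h e f) (hN : WeightsLE h N)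
    (hE : HasDegree h E (-(2 * N))) {g : F[X]} (hg : aeval (bottomOperator t hN hE) g = 0) :
    ∀ m ∈ weightSpace h (-N), aeval (E * e ^ N) g m = 0 := by
  intro m hm
  have := aeval_apply_of_intertwines (A := bottomOperator t hN hE) (Y := E * e ^ N)
    (weightSpace h (-N)).subtype (fun _ => rfl) g ⟨m, hm⟩
  rw [hg] at this
  exact this.symm

lemma IsSl2Triple.exists_annihilator_bot (t : IsSl2Triple h e f) (hN : WeightsLE h N)
    (hE : HasDegree h E (-(2 * N))) :
    ∃ g : F[X], g ≠ 0 ∧ g.natDegree ≤ finrank F (weightSpace h (-N)) ∧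
      ∀ m ∈ weightSpace h (-N), aeval (E * e ^ N) g m = 0 :=
  ⟨(bottomOperator t hN hE).charpoly, (LinearMap.charpoly_monic _).ne_zero,
    (LinearMap.charpoly_natDegree _).le,
    aeval_bottomOperator t hN hE (LinearMap.aeval_self_charpoly _)⟩

end BottomOperator

section Form

variable {F V : Type*} [Field F] [AddCommGroup V] [Module F V] {h e f : End F V} {N : ℕ}
  {B : LinearMap.BilinForm F V} {ε : F}

lemma apply_eq_zero_of_weights [CharZero F] (hh : h ∈ skewAdjointLieSubalgebra B) {i j : ℤ}
    (hij : i + j ≠ 0) {u v : V} (hu : u ∈ weightSpace h i) (hv : v ∈ weightSpace h j) :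
    B u v = 0 := by
  have h1 := mem_skewAdjointLieSubalgebra.1 hh u v
  rw [mem_weightSpace.1 hu, mem_weightSpace.1 hv, map_smul, map_smul, LinearMap.smul_apply,
    smul_eq_mul, smul_eq_mul] at h1
  have h2 : ((i + j : ℤ) : F) * B u v = 0 := by push_cast; linear_combination h1
  exact (mul_eq_zero.1 h2).resolve_left (by exact_mod_cast hij)

lemma hasDegree_wedge (hh : h ∈ skewAdjointLieSubalgebra B) {i j : ℤ} {u v : V}
    (hu : u ∈ weightSpace h i) (hv : v ∈ weightSpace h j) :
    HasDegree h (wedge B ε u v) (i + j) := by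
  intro t
  have h1 := congrArg (fun g : End F V => g t) (mul_wedge_sub (ε := ε) hh u v)
  simp only [LinearMap.sub_apply, Module.End.mul_apply] at h1
  rw [sub_eq_iff_eq_add] at h1
  rw [h1, mem_weightSpace.1 hu, mem_weightSpace.1 hv, add_comm]
  simp only [LinearMap.add_apply, wedge_apply, map_smul, LinearMap.smul_apply, smul_eq_mul]
  push_cast
  module

/-- The form `(m, m') ↦ B m (e ^ N m')` on the component of lowest weight. -/
noncomputable def bottomForm (B : LinearMap.BilinForm F V) (h e : End F V) (N : ℕ) :
    LinearMap.BilinForm F (weightSpace h (-N)) :=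
  B.compl₁₂ (weightSpace h (-N)).subtype ((e ^ N) ∘ₗ (weightSpace h (-N)).subtype)

lemma bottomForm_apply (m m' : weightSpace h (-N)) :
    bottomForm B h e N m m' = B m ((e ^ N) m') := rfl

lemma bottomForm_symm (hB : ∀ u v, B u v = ε * B v u) (he : e ∈ skewAdjointLieSubalgebra B)
    (m m' : weightSpace h (-N)) :
    bottomForm B h e N m m' = (ε * (-1) ^ N) * bottomForm B h e N m' m := by
  rw [bottomForm_apply, bottomForm_apply, hB, skew_pow_apply he]
  ring

variable [CharZero F] [FiniteDimensional F V] [IsAlgClosed F]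

lemma IsSl2Triple.eq_zero_of_bottomForm (t : IsSl2Triple h e f) (hN : WeightsLE h N)
    (hnd : B.Nondegenerate) (hh : h ∈ skewAdjointLieSubalgebra B)
    {m : V} (hm : m ∈ weightSpace h (-N)) (h0 : ∀ m' ∈ weightSpace h (-N), B m ((e ^ N) m') = 0) :
    m = 0 := by
  refine hnd.1 m fun v => ?_
  induction v using t.weight_induction with
  | h0 => rw [map_zero]
  | hadd u v hu hv => rw [map_add, hu, hv, add_zero]
  | hwt j v hv =>
    by_cases hj : j = N
    · subst hj
      have h1 := t.e_pow_f_pow_of_mem_top hN hv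
      have hmem : (f ^ N) v ∈ weightSpace h (-N) := by
        have := t.f_pow_mem hv N
        rwa [show (N : ℤ) - 2 * N = -N by ring] at this
      have h2 := h0 _ hmem
      rw [h1, map_smul, smul_eq_mul] at h2
      exact (mul_eq_zero.1 h2).resolve_left (topScalar_ne_zero N)
    · exact apply_eq_zero_of_weights hh (by omega) hm hv

lemma IsSl2Triple.bottomForm_nondegenerate (t : IsSl2Triple h e f) (hN : WeightsLE h N)
    (hnd : B.Nondegenerate) (hB : ∀ u v, B u v = ε * B v u) (hh : h ∈ skewAdjointLieSubalgebra B)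
    (he : e ∈ skewAdjointLieSubalgebra B) : (bottomForm B h e N).Nondegenerate := by
  have hl : ∀ m, (∀ m', bottomForm B h e N m m' = 0) → m = 0 := fun m hm =>
    Subtype.ext (t.eq_zero_of_bottomForm hN hnd hh m.2 fun m' hm' => hm ⟨m', hm'⟩)
  refine ⟨hl, fun m hm => hl m fun m' => ?_⟩
  rw [bottomForm_symm hB he, hm, mul_zero]

/-- For symmetric `B` and odd `N`, the operators `E e ^ N` are self-adjoint for an alternating
form, so that their minimal polynomials are small. -/
lemma IsSl2Triple.exists_annihilator_bot_half (t : IsSl2Triple h e f) (hN : WeightsLE h N)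
    (hnd : B.Nondegenerate) (hB : ∀ u v, B u v = B v u) (hh : h ∈ skewAdjointLieSubalgebra B)
    (he : e ∈ skewAdjointLieSubalgebra B) (hodd : Odd N) {E : End F V}
    (hE : HasDegree h E (-(2 * N))) (hEs : E ∈ skewAdjointLieSubalgebra B) {κ : ℕ}
    (hκ : finrank F (weightSpace h (-N)) ≤ 2 * κ + 1) :
    ∃ g : F[X], g ≠ 0 ∧ g.natDegree ≤ κ ∧
      ∀ m ∈ weightSpace h (-N), aeval (E * e ^ N) g m = 0 := by
  have hB' : ∀ u v, B u v = 1 * B v u := fun u v => by rw [one_mul]; exact hB u v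
  set A := bottomOperator t hN hE
  have h1 : 2 * (minpoly F A).natDegree ≤ _ :=
    two_mul_natDegree_minpoly_le (t.bottomForm_nondegenerate hN hnd hB' hh he)
      (fun u v => by rw [bottomForm_symm hB' he, hodd.neg_one_pow]; ring) fun u v => by
        rw [bottomForm_apply, bottomForm_apply, coe_bottomOperator, coe_bottomOperator,
          mem_skewAdjointLieSubalgebra.1 hEs]
        have := skew_pow_apply he N (u : V) (E ((e ^ N) v))
        rw [hodd.neg_one_pow] at this
        rw [this]
        ring
  exact ⟨minpoly F A, (minpoly.monic (Algebra.IsIntegral.isIntegral A)).ne_zero, by omega,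
    aeval_bottomOperator t hN hE (minpoly.aeval F A)⟩

/-- A skew-symmetric operator on an odd-dimensional space is singular. -/
lemma IsSl2Triple.exists_bot_apply_eq_zero (t : IsSl2Triple h e f) (hN : WeightsLE h N)
    (hnd : B.Nondegenerate) (hB : ∀ u v, B u v = B v u) (hh : h ∈ skewAdjointLieSubalgebra B)
    (hodd : Odd (finrank F (weightSpace h (-N)))) {E : End F V}
    (hE : HasDegree h E (-(2 * N))) (hEs : E ∈ skewAdjointLieSubalgebra B) :
    ∃ m ∈ weightSpace h (-N), m ≠ 0 ∧ E ((e ^ N) m) = 0 := by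
  set b := finBasis F (weightSpace h (-N)) with hb
  set J : Matrix _ _ F := Matrix.of fun i j => B (E ((e ^ N) (b i))) ((e ^ N) (b j)) with hJ
  have hskew : J.transpose = -J := by
    ext i j
    simp only [hJ, Matrix.transpose_apply, Matrix.of_apply, Matrix.neg_apply]
    rw [mem_skewAdjointLieSubalgebra.1 hEs, hB]
  have hdet : J.det = 0 := by
    have h1 := Matrix.det_transpose J
    rw [hskew, Matrix.det_neg, Fintype.card_fin, hodd.neg_one_pow] at h1
    have : (2 : F) * J.det = 0 := by linear_combination -h1
    exact (mul_eq_zero.1 this).resolve_left two_ne_zero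
  obtain ⟨c, hc, hc0⟩ := Matrix.exists_mulVec_eq_zero_iff.2 hdet
  set m : weightSpace h (-N) := ∑ j, c j • b j with hm
  have hm0 : m ≠ 0 := by
    intro h0
    apply hc
    funext j
    exact Fintype.linearIndependent_iff.1 b.linearIndependent c h0 j
  refine ⟨m, m.2, fun h0 => hm0 (Subtype.ext h0), ?_⟩
  refine t.eq_zero_of_bottomForm hN hnd hh (t.apply_mem_bot hN hE _) fun m' hm' => ?_
  have hbasis : ∀ i, B (E ((e ^ N) m)) ((e ^ N) (b i)) = 0 := by
    intro i
    have h1 := congrFun hc0 i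
    simp only [Matrix.mulVec, dotProduct, hJ, Matrix.of_apply, Pi.zero_apply] at h1
    rw [mem_skewAdjointLieSubalgebra.1 hEs, hB, neg_eq_zero, ← h1, hm]
    simp [map_sum, mul_comm]
  have hspan : (⟨m', hm'⟩ : weightSpace h (-N)) = ∑ i, b.repr ⟨m', hm'⟩ i • b i :=
    (b.sum_repr _).symm
  have h2 : m' = ∑ i, b.repr ⟨m', hm'⟩ i • (b i : V) := by
    have := congrArg (weightSpace h (-N)).subtype hspan
    rw [map_sum] at this
    exact this
  rw [h2]
  simp [map_sum, hbasis]

/-- In terms of hyperbolic pairs `p a, q a` for the form on the component of lowest weight, the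
operator `∑ (a + 1) p a ∧ q a` yields an operator `E e ^ N` diagonal on these vectors. -/
lemma IsSl2Triple.exists_hyperbolic_operator (t : IsSl2Triple h e f) (hN : WeightsLE h N)
    (hnd : B.Nondegenerate) (hB : ∀ u v, B u v = ε * B v u) (hε : ε * ε = 1)
    (hh : h ∈ skewAdjointLieSubalgebra B) (he : e ∈ skewAdjointLieSubalgebra B) {κ : ℕ}
    (hκ : 2 * κ ≤ finrank F (weightSpace h (-N))) :
    ∃ E ∈ skewAdjointLieSubalgebra B, HasDegree h E (-(2 * N)) ∧ ∀ a : Fin κ,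
      (∃ m ∈ weightSpace h (-N), m ≠ 0 ∧ E ((e ^ N) m) = ((a : ℕ) + 1 : F) • m) ∧
      (∃ m ∈ weightSpace h (-N), m ≠ 0 ∧ E ((e ^ N) m) = (-(-1) ^ N * ((a : ℕ) + 1 : F)) • m) := by
  have hσ : (ε * (-1) ^ N) * (ε * (-1) ^ N) = 1 := by
    rw [mul_mul_mul_comm, hε, ← mul_pow]; simp
  obtain ⟨p, q, hpp, hqq, hpq⟩ := exists_hyperbolic_pairs hσ (bottomForm_symm hB he)
    (t.bottomForm_nondegenerate hN hnd hB hh he) κ hκ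
  have hqp : ∀ a b, bottomForm B h e N (q a) (p b) = if a = b then ε * (-1) ^ N else 0 := by
    intro a b
    rw [bottomForm_symm hB he, hpq]
    by_cases h : a = b
    · simp [h]
    · rw [if_neg (Ne.symm h), if_neg h, mul_zero]
  simp only [bottomForm_apply] at hpp hqq hpq hqp
  have hpne : ∀ a, (p a : V) ≠ 0 := fun a h0 => by
    have := hpq a a
    rw [h0] at this
    simp at this
  have hqne : ∀ a, (q a : V) ≠ 0 := fun a h0 => by
    have := hpq a a
    rw [h0] at this
    simp at this
  refine ⟨∑ a : Fin κ, ((a : ℕ) + 1 : F) • wedge B ε (p a : V) (q a : V), ?_, ?_, fun b => ⟨?_, ?_⟩⟩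
  · exact Submodule.sum_mem (skewAdjointLieSubalgebra B).toSubmodule fun a _ =>
      Submodule.smul_mem (skewAdjointLieSubalgebra B).toSubmodule _ (wedge_mem hB hε _ _)
  · refine HasDegree.sum fun a _ => HasDegree.smul ?_ _
    have := hasDegree_wedge (ε := ε) hh (p a).2 (q a).2
    rwa [show -(N : ℤ) + -N = -(2 * N) by ring] at this
  · refine ⟨q b, (q b).2, hqne b, ?_⟩
    simp [LinearMap.sum_apply, wedge_apply, hpq, hqq]
  · refine ⟨p b, (p b).2, hpne b, ?_⟩
    simp only [LinearMap.sum_apply, LinearMap.smul_apply, wedge_apply, hpp, hqp, zero_smul,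
      zero_sub]
    rw [Finset.sum_eq_single b]
    · rw [if_pos rfl, ← mul_assoc, hε, one_mul, smul_neg, smul_smul, ← neg_smul]
      congr 1
      ring
    · intro a _ hab
      rw [if_neg hab]
      simp
    · simp

end Form

/-! ### Highest weight and Jordan type -/

section TopWeight

variable {F V : Type*} [Field F] [AddCommGroup V] [Module F V] {h e f : End F V} {N : ℕ}
  [CharZero F] [FiniteDimensional F V] [IsAlgClosed F]

/-- There is a highest weight `N`; it is positive, since otherwise `h = 0`. -/
lemma IsSl2Triple.exists_weightsLE (t : IsSl2Triple h e f) :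
    ∃ N : ℕ, 1 ≤ N ∧ WeightsLE h N ∧ weightSpace h (-N) ≠ ⊥ := by
  have hfin : {j : ℤ | weightSpace h j ≠ ⊥}.Finite :=
    (Module.End.finite_hasEigenvalue h).preimage (f := fun j : ℤ => (j : F))
      Int.cast_injective.injOn
  have hne : {j : ℤ | weightSpace h j ≠ ⊥}.Nonempty := by
    by_contra hcon
    refine t.h_ne_zero (LinearMap.ext fun v => ?_)
    induction v using t.weight_induction with
    | h0 => simp
    | hadd u v hu hv => rw [map_add, hu, hv]; simp
    | hwt j v hv =>
      have : weightSpace h j = ⊥ := by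
        by_contra h1
        exact hcon ⟨j, h1⟩
      rw [this, Submodule.mem_bot] at hv
      rw [hv, map_zero, map_zero]
  obtain ⟨j, hj, hmax⟩ := Set.exists_max_image _ (fun j : ℤ => |j|) hfin hne
  have hle : WeightsLE h j.natAbs := by
    intro i v hv hi
    by_contra hv0
    have := hmax i (Submodule.ne_bot_iff _ |>.2 ⟨v, hv, hv0⟩)
    rw [Int.natCast_natAbs] at hi
    exact absurd this (not_le.2 hi)
  refine ⟨j.natAbs, ?_, hle, ?_⟩
  · by_contra h0
    refine t.h_ne_zero (LinearMap.ext fun v => ?_)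
    induction v using t.weight_induction with
    | h0 => simp
    | hadd u v hu hv => rw [map_add, hu, hv]; simp
    | hwt i v hv =>
      by_cases hi : i = 0
      · rw [mem_weightSpace.1 hv, hi]; simp
      · rw [hle i v hv (by have := abs_pos.2 hi; omega), map_zero, map_zero]
  · rcases le_or_gt j 0 with hj0 | hj0
    · rwa [show -(j.natAbs : ℤ) = j by omega]
    · obtain ⟨v, hv, hv0⟩ := (Submodule.ne_bot_iff _).1 hj
      have hjn : j = j.natAbs := by omega
      rw [hjn] at hv
      have hmem := t.f_pow_mem hv j.natAbs
      rw [show (j.natAbs : ℤ) - 2 * j.natAbs = -j.natAbs by ring] at hmem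
      refine (Submodule.ne_bot_iff _).2 ⟨_, hmem, fun h0 => hv0 ?_⟩
      have h1 := t.e_pow_f_pow_of_mem_top hle hv
      rw [h0, map_zero] at h1
      exact (smul_eq_zero.1 h1.symm).resolve_left (topScalar_ne_zero _)

lemma IsSl2Triple.e_pow_eq_zero_of_mem_core (t : IsSl2Triple h e f) (hN : WeightsLE h N) {v : V}
    (hv : v ∈ core e f N) : (e ^ N) v = 0 := by
  obtain ⟨a, ha, hEa⟩ := t.symm.exists_top_component hN.neg v
  have h1 := hEa (e ^ N) (t.symm.hasDegree_f_pow N)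
  have h2 := mem_core.1 hv N
  rw [h1, t.f_pow_e_pow_of_mem_bot hN (mem_weightSpace_neg.1 ha)] at h2
  rw [h1, (smul_eq_zero.1 h2).resolve_left (topScalar_ne_zero _), map_zero]

lemma IsSl2Triple.finrank_range_e_pow (t : IsSl2Triple h e f) (hN : WeightsLE h N) (s : ℕ) :
    finrank F (LinearMap.range (e ^ s)) =
      finrank F (weightSpace h (-N)) * (N + 1 - s) + finrank F ((core e f N).map (e ^ s)) := by
  rw [(t.isChainFamily_bottomChains hN).finrank_range_pow (t.linearIndependent_bottomChains hN)
    (t.isCompl_core hN) (fun _ => e_mem_core) s]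
  simp

lemma IsSl2Triple.finrank_eq (t : IsSl2Triple h e f) (hN : WeightsLE h N) :
    finrank F V = finrank F (weightSpace h (-N)) * (N + 1) + finrank F (core e f N) := by
  have := t.finrank_range_e_pow hN 0
  rw [pow_zero, Module.End.one_eq_id, LinearMap.range_id, finrank_top, Submodule.map_id] at this
  simpa using this

/-- The Jordan blocks of `e` are those of order `N + 1`, one for every dimension of the component of
lowest weight `-N`, and those of the restriction of `e` to `core e f N`. -/
lemma IsSl2Triple.exists_parts_eq (t : IsSl2Triple h e f) (hN : WeightsLE h N) {s : Multiset ℕ}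
    (hs : HasJordanType e s) (hpos : ∀ m ∈ s, 0 < m) :
    ∃ s' : Multiset ℕ, s = Multiset.replicate (finrank F (weightSpace h (-N))) (N + 1) + s' ∧
      (∀ m ∈ s', 1 ≤ m ∧ m ≤ N) ∧
      ∀ r, (s'.map fun m => m - r).sum = finrank F ((core e f N).map (e ^ r)) := by
  set k := finrank F (weightSpace h (-N))
  have hrange := fun r => (hs.finrank_range_pow r).symm.trans (t.finrank_range_e_pow hN r)
  have hcoreN : (core e f N).map (e ^ N) = ⊥ := by
    rw [eq_bot_iff, Submodule.map_le_iff_le_comap]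
    intro v hv
    simpa using t.e_pow_eq_zero_of_mem_core hN hv
  have hle : ∀ m ∈ s, m ≤ N + 1 := by
    intro m hm
    have h1 := hrange (N + 1)
    have h2 : (core e f N).map (e ^ (N + 1)) = ⊥ := by
      rw [pow_succ', Module.End.mul_eq_comp, Submodule.map_comp, hcoreN, Submodule.map_bot]
    rw [h2, Nat.sub_self, mul_zero, finrank_bot, add_zero, Multiset.sum_eq_zero_iff] at h1
    have := h1 _ (Multiset.mem_map_of_mem _ hm)
    omega
  have hcount : s.count (N + 1) = k := by
    have h1 := hrange N
    rw [hcoreN, finrank_bot, add_zero, show N + 1 - N = 1 by omega, mul_one] at h1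
    refine Eq.trans ?_ h1
    clear h1 hrange hcoreN hs hpos
    induction s using Multiset.induction_on with
    | empty => simp
    | cons a s ih =>
      rw [Multiset.map_cons, Multiset.sum_cons, Multiset.count_cons,
        ih fun m hm => hle m (Multiset.mem_cons_of_mem hm)]
      have := hle a (Multiset.mem_cons_self _ _)
      split_ifs <;> omega
  have hdec : s = Multiset.replicate k (N + 1) + s.filter (N + 1 ≠ ·) := by
    conv_lhs => rw [← Multiset.filter_add_not (N + 1 = ·) s]
    rw [Multiset.filter_eq s (N + 1), hcount]
  refine ⟨s.filter (N + 1 ≠ ·), hdec, fun m hm => ?_, fun r => ?_⟩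
  · obtain ⟨hm, hne⟩ := Multiset.mem_filter.1 hm
    have := hle m hm
    have := hpos m hm
    omega
  · have h1 := hrange r
    rw [hdec] at h1
    rw [Multiset.map_add, Multiset.sum_add, Multiset.map_replicate, Multiset.sum_replicate,
      smul_eq_mul] at h1
    exact Nat.add_left_cancel h1

/-- The operator `E₀` of the case of `sl`: the component of lowest weight has a basis of vectors `m`
with `E₀ (e ^ N m)` a non-zero multiple of `m`, with different coefficients. -/
lemma IsSl2Triple.exists_diagonal_operator (t : IsSl2Triple h e f) (hN : WeightsLE h N)
    (hN0 : 1 ≤ N) : ∃ E ∈ slSubalgebra F V, HasDegree h E (-(2 * N)) ∧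
      ∀ a : Fin (finrank F (weightSpace h (-N))),
        ∃ m ∈ weightSpace h (-N), m ≠ 0 ∧ E ((e ^ N) m) = ((a : ℕ) + 1 : F) • m := by
  set b := finBasis F (weightSpace h (-N))
  set D : weightSpace h (-N) →ₗ[F] V := b.constr F fun a =>
    ((topScalar F N)⁻¹ * ((a : ℕ) + 1 : F)) • (b a : V) with hD
  obtain ⟨D', hD'⟩ := D.exists_extend
  have hD'b : ∀ a, D' (b a) = ((topScalar F N)⁻¹ * ((a : ℕ) + 1 : F)) • (b a : V) := by
    intro a
    have := congrArg (fun g : weightSpace h (-N) →ₗ[F] V => g (b a)) hD'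
    simpa [hD] using this
  have hD'mem : ∀ m ∈ weightSpace h (-N), D' m ∈ weightSpace h (-N) := by
    intro m hm
    have hm' : D' m = D ⟨m, hm⟩ := by rw [← hD']; rfl
    rw [hm', hD, Basis.constr_apply_fintype]
    exact Submodule.sum_mem _ fun a _ => Submodule.smul_mem _ _ (Submodule.smul_mem _ _ (b a).2)
  have hdeg : HasDegree h (D' * f ^ N) (-(2 * N)) := by
    intro v
    simp only [Module.End.mul_apply]
    induction v using t.weight_induction with
    | h0 => simp
    | hadd u v hu hv => simp only [map_add, hu, hv, smul_add]; abel
    | hwt i v hv =>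
      rw [mem_weightSpace.1 hv, map_smul, map_smul]
      by_cases hi : i = N
      · have hmem := t.f_pow_mem hv N
        rw [hi, show (N : ℤ) - 2 * N = -N by ring] at hmem
        rw [mem_weightSpace.1 (hD'mem _ hmem), hi, ← add_smul]
        congr 1
        push_cast
        ring
      · rw [t.f_pow_eq_zero_of_mem hN hv hi]
        simp
  refine ⟨D' * f ^ N, ?_, hdeg, fun a => ⟨b a, (b a).2, fun h0 => ?_, ?_⟩⟩
  · exact mem_slSubalgebra.2 (LinearMap.isNilpotent_trace_of_isNilpotent
      (hdeg.isNilpotent (by omega))).eq_zero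
  · exact b.ne_zero a (Subtype.ext h0)
  · rw [Module.End.mul_apply, t.f_pow_e_pow_of_mem_bot hN (b a).2, map_smul, hD'b, smul_smul,
      ← mul_assoc, mul_inv_cancel₀ (topScalar_ne_zero N), one_mul]

/-- When the form on the component of lowest weight is symmetric and `B` is alternating, an
orthogonal basis `m a` yields the operator `∑ c a • m a ∧ m a`. -/
lemma IsSl2Triple.exists_orthogonal_operator {B : LinearMap.BilinForm F V} (t : IsSl2Triple h e f)
    (hN : WeightsLE h N) (hnd : B.Nondegenerate) (hB : ∀ u v, B u v = -1 * B v u)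
    (hh : h ∈ skewAdjointLieSubalgebra B) (he : e ∈ skewAdjointLieSubalgebra B) (hodd : Odd N) :
    ∃ E ∈ skewAdjointLieSubalgebra B, HasDegree h E (-(2 * N)) ∧
      ∀ a : Fin (finrank F (weightSpace h (-N))),
        ∃ m ∈ weightSpace h (-N), m ≠ 0 ∧ E ((e ^ N) m) = ((a : ℕ) + 1 : F) • m := by
  have hnd' := t.bottomForm_nondegenerate hN hnd hB hh he
  have hsymm : ∀ m m', bottomForm B h e N m m' = bottomForm B h e N m' m := by
    intro m m'
    rw [bottomForm_symm hB he, hodd.neg_one_pow]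
    ring
  have : Invertible (2 : F) := invertibleOfNonzero two_ne_zero
  obtain ⟨b, hb⟩ := LinearMap.BilinForm.exists_orthogonal_basis (B := bottomForm B h e N)
    ⟨fun x y => hsymm x y⟩
  have hself : ∀ a, bottomForm B h e N (b a) (b a) ≠ 0 :=
    hb.not_isOrtho_basis_self_of_separatingRight hnd'.2
  refine ⟨∑ a, ((2 * bottomForm B h e N (b a) (b a))⁻¹ * ((a : ℕ) + 1 : F)) •
    wedge B (-1) (b a : V) (b a : V), ?_, ?_, fun a => ⟨b a, (b a).2, fun h0 => ?_, ?_⟩⟩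
  · exact Submodule.sum_mem (skewAdjointLieSubalgebra B).toSubmodule fun a _ =>
      Submodule.smul_mem (skewAdjointLieSubalgebra B).toSubmodule _ (wedge_mem hB (by norm_num) _ _)
  · refine HasDegree.sum fun a _ => HasDegree.smul ?_ _
    have := hasDegree_wedge (ε := -1) hh (b a).2 (b a).2
    rwa [show -(N : ℤ) + -N = -(2 * N) by ring] at this
  · exact b.ne_zero a (Subtype.ext h0)
  · simp only [LinearMap.sum_apply, LinearMap.smul_apply, wedge_apply, ← bottomForm_apply]
    rw [Finset.sum_eq_single a]
    · have := hself a
      rw [← sub_smul, smul_smul]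
      congr 1
      field_simp
      ring
    · intro c _ hca
      have : bottomForm B h e N (b c) (b a) = 0 := hb hca
      rw [this]
      simp
    · simp

end TopWeight

/-! ### Regular semisimple elements -/

section Eigenspaces

variable {F V : Type*} [Field F] [AddCommGroup V] [Module F V] [FiniteDimensional F V]

lemma sum_finrank_eigenspace_le (x : End F V) (T : Finset F) :
    ∑ μ ∈ T, finrank F (x.eigenspace μ) ≤ finrank F V := by
  classical
  have key : ∑ μ ∈ T, finrank F (x.eigenspace μ) =
      finrank F (⨆ μ ∈ T, x.eigenspace μ : Submodule F V) := by
    induction T using Finset.induction_on with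
    | empty =>
      rw [Finset.sum_empty, show (⨆ μ ∈ (∅ : Finset F), x.eigenspace μ) = ⊥ by simp, finrank_bot]
    | insert a T ha ih =>
      have hdisj : Disjoint (x.eigenspace a) (⨆ μ ∈ T, x.eigenspace μ) :=
        x.eigenspaces_iSupIndep.disjoint_biSup ha
      have := Submodule.finrank_sup_add_finrank_inf_eq (x.eigenspace a) (⨆ μ ∈ T, x.eigenspace μ)
      rw [hdisj.eq_bot, finrank_bot, add_zero] at this
      rw [Finset.sum_insert ha, ih, Finset.iSup_insert, this]
  rw [key]
  exact Submodule.finrank_le _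

variable [IsAlgClosed F]

/-- A semisimple operator has as many eigenvalues as the degree of its minimal polynomial, which
bounds the dimensions of its eigenspaces. -/
lemma sum_finrank_eigenspace_add_natDegree_le {x : End F V} (hx : x.IsSemisimple) (T : Finset F) :
    ∑ μ ∈ T, finrank F (x.eigenspace μ) + (minpoly F x).natDegree ≤ finrank F V + T.card := by
  classical
  set S := (minpoly F x).roots.toFinset with hS
  have hcard : S.card = (minpoly F x).natDegree := by
    rw [hS, Multiset.toFinset_card_of_nodup (nodup_roots
      (PerfectField.separable_iff_squarefree.2 hx.minpoly_squarefree))]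
    exact (IsAlgClosed.splits _).natDegree_eq_card_roots.symm
  have hone : ∀ μ ∈ S, 1 ≤ finrank F (x.eigenspace μ) := by
    intro μ hμ
    have : x.HasEigenvalue μ :=
      Module.End.hasEigenvalue_of_isRoot (isRoot_of_mem_roots (Multiset.mem_toFinset.1 hμ))
    exact Submodule.one_le_finrank_iff.2 this
  have h1 := sum_finrank_eigenspace_le x (T ∪ S)
  rw [← Finset.sum_sdiff (Finset.subset_union_left : T ⊆ T ∪ S)] at h1
  have h2 : ((T ∪ S) \ T).card ≤ ∑ μ ∈ (T ∪ S) \ T, finrank F (x.eigenspace μ) := by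
    rw [Finset.card_eq_sum_ones]
    refine Finset.sum_le_sum fun μ hμ => hone μ ?_
    obtain ⟨h3, h4⟩ := Finset.mem_sdiff.1 hμ
    exact (Finset.mem_union.1 h3).resolve_left h4
  have h3 : S.card ≤ ((T ∪ S) \ T).card + T.card := by
    rw [Finset.card_sdiff_add_card_eq_card Finset.subset_union_left]
    exact Finset.card_le_card Finset.subset_union_right
  omega

lemma finrank_eigenspace_add_natDegree_le {x : End F V} (hx : x.IsSemisimple) (μ : F) :
    finrank F (x.eigenspace μ) + (minpoly F x).natDegree ≤ finrank F V + 1 := by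
  simpa using sum_finrank_eigenspace_add_natDegree_le hx {μ}

lemma finrank_eigenspace_add_finrank_ker_le {x : End F V} (hx : x.IsSemisimple) {μ : F}
    (hμ : μ ≠ 0) : finrank F (x.eigenspace μ) + finrank F (x.eigenspace 0) +
      (minpoly F x).natDegree ≤ finrank F V + 2 := by
  classical
  have := sum_finrank_eigenspace_add_natDegree_le hx {μ, 0}
  rwa [Finset.sum_pair hμ, Finset.card_pair hμ] at this

lemma eq_of_eq_on_eigenspaces {x y z : End F V} (hx : x.IsSemisimple)
    (h : ∀ μ, ∀ v ∈ x.eigenspace μ, y v = z v) : y = z := by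
  have htop : ⨆ μ, x.eigenspace μ = ⊤ := by
    simp_rw [← hx.isFinitelySemisimple.maxGenEigenspace_eq_eigenspace]
    exact Module.End.iSup_maxGenEigenspace_eq_top x
  ext v
  refine Submodule.iSup_induction x.eigenspace (motive := fun v => y v = z v)
    (htop ▸ Submodule.mem_top) h (by simp) fun u v hu hv => by rw [map_add, map_add, hu, hv]

omit [IsAlgClosed F] in
lemma apply_comm_of_finrank_le_one {K : Submodule F V} (hK : finrank F K ≤ 1) {y z : End F V}
    (hy : ∀ v ∈ K, y v ∈ K) (hz : ∀ v ∈ K, z v ∈ K) {v : V} (hv : v ∈ K) :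
    y (z v) = z (y v) := by
  obtain ⟨⟨b, hb⟩, hspan⟩ := finrank_le_one_iff.1 hK
  have hscalar : ∀ w ∈ K, ∃ c : F, c • b = w := fun w hw => by
    obtain ⟨c, hc⟩ := hspan ⟨w, hw⟩
    exact ⟨c, congrArg Subtype.val hc⟩
  obtain ⟨c, rfl⟩ := hscalar v hv
  obtain ⟨c1, h1⟩ := hscalar _ (hy b hb)
  obtain ⟨c2, h2⟩ := hscalar _ (hz b hb)
  simp only [map_smul, ← h1, ← h2]
  rw [smul_comm c1 c2]

omit [FiniteDimensional F V] [IsAlgClosed F] in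
lemma apply_mem_eigenspace_of_commute {x y : End F V} (hxy : Commute x y) (μ : F) :
    ∀ v ∈ x.eigenspace μ, y v ∈ x.eigenspace μ := by
  intro v hv
  rw [Module.End.mem_eigenspace_iff] at hv ⊢
  rw [← Module.End.mul_apply, hxy.eq, Module.End.mul_apply, hv, map_smul]

section Form

variable {B : LinearMap.BilinForm F V} {ε : F}

/-- For a semisimple skew-symmetric operator, the eigenspaces for `μ` and `-μ` are in duality. -/
lemma exists_mem_eigenspace_neg {x : End F V} (hx : x.IsSemisimple)
    (hxB : x ∈ skewAdjointLieSubalgebra B) (hnd : B.Nondegenerate) {μ : F} {v : V}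
    (hv : v ∈ x.eigenspace μ) (hv0 : v ≠ 0) : ∃ u ∈ x.eigenspace (-μ), B v u ≠ 0 := by
  by_contra! hcon
  refine hv0 (hnd.1 v fun w => ?_)
  have htop : ⨆ μ, x.eigenspace μ = ⊤ := by
    simp_rw [← hx.isFinitelySemisimple.maxGenEigenspace_eq_eigenspace]
    exact Module.End.iSup_maxGenEigenspace_eq_top x
  refine Submodule.iSup_induction x.eigenspace (motive := fun w => B v w = 0)
    (htop ▸ Submodule.mem_top) (fun ν u hu => ?_) (by simp) fun u v hu hv => by
      rw [map_add, hu, hv, add_zero]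
  by_cases hν : ν = -μ
  · exact hcon u (hν ▸ hu)
  · have h1 := mem_skewAdjointLieSubalgebra.1 hxB v u
    rw [Module.End.mem_eigenspace_iff.1 hv, Module.End.mem_eigenspace_iff.1 hu, map_smul, map_smul,
      LinearMap.smul_apply, smul_eq_mul, smul_eq_mul] at h1
    have h2 : (ν + μ) * B v u = 0 := by linear_combination h1
    exact (mul_eq_zero.1 h2).resolve_left fun h3 => hν (eq_neg_of_add_eq_zero_left h3)

/-- The skew-symmetric operators of a quadratic space of dimension at most two commute. -/
lemma apply_comm_of_finrank_le_two [CharZero F] {K : Submodule F V} (hK : finrank F K ≤ 2)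
    (hB : ∀ u v, B u v = B v u) (hKnd : ∀ v ∈ K, v ≠ 0 → ∃ u ∈ K, B v u ≠ 0) {y z : End F V}
    (hyB : y ∈ skewAdjointLieSubalgebra B) (hzB : z ∈ skewAdjointLieSubalgebra B)
    (hy : ∀ v ∈ K, y v ∈ K) (hz : ∀ v ∈ K, z v ∈ K) {v : V} (hv : v ∈ K) :
    y (z v) = z (y v) := by
  have halt : ∀ {w : End F V}, w ∈ skewAdjointLieSubalgebra B → ∀ u, B (w u) u = 0 := by
    intro w hw u
    have h1 := mem_skewAdjointLieSubalgebra.1 hw u u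
    rw [hB u] at h1
    have h2 : (2 : F) * B (w u) u = 0 := by linear_combination h1
    exact (mul_eq_zero.1 h2).resolve_left two_ne_zero
  by_cases hy0 : ∀ u ∈ K, y u = 0
  · rw [hy0 _ (hz v hv), hy0 v hv, map_zero]
  push Not at hy0
  obtain ⟨a, ha, hya⟩ := hy0
  obtain ⟨b, hb, hab⟩ := hKnd _ (hy a ha) hya
  -- `a` and `b` span `K`, and `z - c y` vanishes on `K` for a suitable scalar `c`
  have hli : LinearIndependent F ![(⟨a, ha⟩ : K), ⟨b, hb⟩] := by
    rw [LinearIndependent.pair_iff]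
    intro s t hst
    have hst' : s • a + t • b = 0 := congrArg Subtype.val hst
    have ht : t = 0 := by
      have h1 := congrArg (B (y a)) hst'
      rw [map_add, map_smul, map_smul, halt hyB, map_zero, smul_zero, zero_add] at h1
      exact (smul_eq_zero.1 h1).resolve_right hab
    subst ht
    rw [zero_smul, add_zero] at hst'
    refine ⟨(smul_eq_zero.1 hst').resolve_right ?_, rfl⟩
    rintro rfl
    exact hya (map_zero y)
  have hfr : finrank F K = 2 := le_antisymm hK (by simpa using hli.fintype_card_le_finrank)
  have hspan := hli.span_eq_top_of_card_eq_finrank (by simp [hfr])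
  have hdec : ∀ u ∈ K, ∃ s t : F, s • a + t • b = u := by
    intro u hu
    have h1 : (⟨u, hu⟩ : K) ∈ Submodule.span F (Set.range ![(⟨a, ha⟩ : K), ⟨b, hb⟩]) := by
      rw [hspan]; trivial
    rw [Matrix.range_cons, Matrix.range_cons, Matrix.range_empty, Set.union_empty,
      Set.singleton_union, Submodule.mem_span_pair] at h1
    obtain ⟨s, t, hst⟩ := h1
    exact ⟨s, t, congrArg Subtype.val hst⟩
  set c := B (z a) b / B (y a) b with hc
  have hzero : ∀ u ∈ K, z u = c • y u := by
    intro u hu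
    by_contra hne
    obtain ⟨w, hw, hw0⟩ := hKnd (z u - c • y u)
      (sub_mem (hz u hu) (K.smul_mem c (hy u hu))) (sub_ne_zero.2 hne)
    apply hw0
    have hba : ∀ {x : End F V}, x ∈ skewAdjointLieSubalgebra B → B (x b) a = -B (x a) b := by
      intro x hx
      rw [mem_skewAdjointLieSubalgebra.1 hx, hB]
    obtain ⟨s, t, rfl⟩ := hdec u hu
    obtain ⟨s', t', rfl⟩ := hdec w hw
    have hcab : B (z a) b = c * B (y a) b := by rw [hc, div_mul_cancel₀ _ hab]
    simp only [map_add, map_smul, map_sub, LinearMap.add_apply, LinearMap.smul_apply,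
      LinearMap.sub_apply, smul_eq_mul, halt hyB, halt hzB, hba hyB, hba hzB, hcab]
    ring
  rw [hzero v hv, hzero _ (hy v hv), map_smul]

end Form

end Eigenspaces

section Regular

variable {F V : Type*} [Field F] [AddCommGroup V] [Module F V] [FiniteDimensional F V]
  {L : LieSubalgebra F (End F V)}

omit [FiniteDimensional F V] in
lemma lie_eq_zero_iff_commute {x y : L} : ⁅x, y⁆ = 0 ↔ Commute (x : End F V) y := by
  rw [← Subtype.coe_inj, LieSubalgebra.coe_bracket, Ring.lie_def]
  exact sub_eq_zero

/-- If the eigenvalues of `x` are simple, then the centralizer of `x` is abelian. -/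
lemma isRegularSemisimpleElement_of_finrank_le [IsAlgClosed F] (hL : DetectsSemisimplicity L)
    {x : L} (hx : (x : End F V).IsSemisimple)
    (hr : finrank F V ≤ (minpoly F (x : End F V)).natDegree) : IsRegularSemisimpleElement F x := by
  refine isRegularSemisimpleElement_of_commute ((hL.isSemisimpleElement_iff x).2 hx)
    fun y z hy hz => ?_
  rw [lie_eq_zero_iff_commute] at hy hz ⊢
  refine eq_of_eq_on_eigenspaces hx fun μ v hv => ?_
  have := finrank_eigenspace_add_natDegree_le hx μ
  exact apply_comm_of_finrank_le_one (K := (x : End F V).eigenspace μ) (by omega)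
    (apply_mem_eigenspace_of_commute hy μ) (apply_mem_eigenspace_of_commute hz μ) hv

variable {B : LinearMap.BilinForm F V}

/-- In the orthogonal case a two-dimensional kernel is allowed as well, because `so` of a plane is
abelian. -/
lemma isRegularSemisimpleElement_skew_of_finrank_le [IsAlgClosed F] [CharZero F]
    (hnd : B.Nondegenerate) (hB : ∀ u v, B u v = B v u) {x : skewAdjointLieSubalgebra B}
    (hx : (x : End F V).IsSemisimple)
    (hr : finrank F V ≤ (minpoly F (x : End F V)).natDegree ∨
      finrank F V ≤ (minpoly F (x : End F V)).natDegree + 1 ∧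
        2 ≤ finrank F ((x : End F V).eigenspace 0)) : IsRegularSemisimpleElement F x := by
  have hL := skewAdjointLieSubalgebra_detectsSemisimplicity hnd (ε := 1) (by simpa using hB)
    (one_mul 1)
  rcases hr with hr | ⟨hr, hker⟩
  · exact isRegularSemisimpleElement_of_finrank_le hL hx hr
  refine isRegularSemisimpleElement_of_commute ((hL.isSemisimpleElement_iff x).2 hx)
    fun y z hy hz => ?_
  rw [lie_eq_zero_iff_commute] at hy hz ⊢
  refine eq_of_eq_on_eigenspaces hx fun μ v hv => ?_
  by_cases hμ : μ = 0
  · subst hμ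
    have := finrank_eigenspace_add_natDegree_le hx 0
    refine apply_comm_of_finrank_le_two (K := (x : End F V).eigenspace 0) (by omega) hB ?_ y.2 z.2
      (apply_mem_eigenspace_of_commute hy 0) (apply_mem_eigenspace_of_commute hz 0) hv
    intro v hv hv0
    have := exists_mem_eigenspace_neg hx x.2 hnd hv hv0
    rwa [neg_zero] at this
  · have := finrank_eigenspace_add_finrank_ker_le hx hμ
    exact apply_comm_of_finrank_le_one (K := (x : End F V).eigenspace μ) (by omega)
      (apply_mem_eigenspace_of_commute hy μ) (apply_mem_eigenspace_of_commute hz μ) hv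

/-- If the kernel of a semisimple operator has dimension at least two, then its centralizer in `sl(V)`
contains a copy of `sl₂`. -/
lemma not_isRegularSemisimpleElement_sl [CharZero F] {x : slSubalgebra F V}
    (hx : (x : End F V).IsSemisimple) {v w : V} (hli : LinearIndependent F ![v, w])
    (hv : (x : End F V) v = 0) (hw : (x : End F V) w = 0) : ¬ IsRegularSemisimpleElement F x := by
  rw [LinearIndependent.pair_iff] at hli
  -- a linear form which vanishes on `w` and on the image of `x`, but not on `v`
  have key : ∀ {v w : V}, (∀ s t : F, s • v + t • w = 0 → s = 0 ∧ t = 0) →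
      (x : End F V) v = 0 → (x : End F V) w = 0 →
      ∃ φ : V →ₗ[F] F, φ v = 1 ∧ φ w = 0 ∧ ∀ u, φ ((x : End F V) u) = 0 := by
    intro v w hli hv hw
    have hnot : v ∉ Submodule.span F {w} ⊔ LinearMap.range (x : End F V) := by
      intro hmem
      obtain ⟨u, hu, y, ⟨y', rfl⟩, huy⟩ := Submodule.mem_sup.1 hmem
      obtain ⟨c, rfl⟩ := Submodule.mem_span_singleton.1 hu
      have h1 : (x : End F V) ((x : End F V) y') = 0 := by
        have := congrArg (x : End F V) huy
        rwa [map_add, map_smul, hw, smul_zero, zero_add, hv] at this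
      have h2 := eq_zero_of_isSemisimple_of_pow_apply hx (k := 2) (v := y')
        (by rwa [pow_two, Module.End.mul_apply])
      rw [h2, add_zero] at huy
      have h3 := (hli 1 (-c) (by rw [← huy]; module)).1
      exact one_ne_zero h3
    obtain ⟨φ, hφv, hφ⟩ := Submodule.exists_le_ker_of_notMem hnot
    refine ⟨(φ v)⁻¹ • φ, by simp [hφv], ?_, fun u => ?_⟩
    · have : φ w = 0 := hφ (Submodule.mem_sup_left (Submodule.mem_span_singleton_self w))
      simp [this]
    · have : φ ((x : End F V) u) = 0 := hφ (Submodule.mem_sup_right ⟨u, rfl⟩)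
      simp [this]
  obtain ⟨φ, hφv, hφw, hφx⟩ := key hli hv hw
  obtain ⟨ψ, hψw, hψv, hψx⟩ := key (v := w) (w := v)
    (fun s t hst => (hli t s (by rw [add_comm]; exact hst)).symm) hw hv
  have ha : φ.smulRight v - ψ.smulRight w ∈ slSubalgebra F V := by
    rw [mem_slSubalgebra, map_sub, LinearMap.trace_smulRight, LinearMap.trace_smulRight, hφv, hψw,
      sub_self]
  have hb : ψ.smulRight v ∈ slSubalgebra F V := by
    rw [mem_slSubalgebra, LinearMap.trace_smulRight, hψv]
  refine not_isRegularSemisimpleElement (a := ⟨_, ha⟩) (b := ⟨_, hb⟩) (c := 2) ?_ ?_ two_ne_zero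
    ?_ ?_
  · rw [lie_eq_zero_iff_commute]
    ext u
    simp [hv, hw, hφx, hψx]
  · rw [lie_eq_zero_iff_commute]
    ext u
    simp [hv, hψx]
  · intro h0
    have := congrArg (fun g : slSubalgebra F V => (g : End F V) w) h0
    simp only [LinearMap.smulRight_apply, hψw, one_smul] at this
    have h1 := (hli 1 0 (by rw [this]; simp)).1
    exact one_ne_zero h1
  · apply Subtype.ext
    rw [LieSubalgebra.coe_bracket, Ring.lie_def]
    ext u
    simp [hφv, hψv, hψw]
    module

omit [FiniteDimensional F V] in
lemma commute_wedge {ε μ : F} {x : End F V} (hx : x ∈ skewAdjointLieSubalgebra B) {u v : V}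
    (hu : x u = μ • u) (hv : x v = -μ • v) : Commute x (wedge B ε u v) := by
  have h1 := mul_wedge_sub (ε := ε) hx u v
  refine sub_eq_zero.1 (h1.trans ?_)
  rw [hu, hv]
  ext t
  simp only [LinearMap.add_apply, wedge_apply, map_smul, LinearMap.smul_apply, smul_eq_mul,
    LinearMap.zero_apply]
  module

omit [FiniteDimensional F V] in
/-- If the kernel of `x` is not zero, then the centralizer of `x` in `sp(V)` contains `sp` of a
plane. -/
lemma not_isRegularSemisimpleElement_sp [CharZero F] (hB : ∀ u v, B u v = -1 * B v u)
    {x : skewAdjointLieSubalgebra B} {u v : V} (hu : (x : End F V) u = 0)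
    (hv : (x : End F V) v = 0) (huv : B u v ≠ 0) : ¬ IsRegularSemisimpleElement F x := by
  have hself : ∀ w, B w w = 0 := by
    intro w
    have h1 := hB w w
    have h2 : (2 : F) * B w w = 0 := by linear_combination h1
    exact (mul_eq_zero.1 h2).resolve_left two_ne_zero
  have ha := wedge_mem hB (by norm_num) u v
  have hb := wedge_mem hB (by norm_num) v v
  have hb' : wedge B (-1) v v u = (2 * B v u) • v := by
    rw [wedge_apply]; module
  have hv0 : v ≠ 0 := by
    rintro rfl
    exact huv (map_zero _)
  have hvu : B v u ≠ 0 := by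
    rw [hB]
    exact mul_ne_zero (by norm_num) huv
  refine not_isRegularSemisimpleElement (a := ⟨_, ha⟩) (b := ⟨_, hb⟩) (c := 2 * B u v) ?_ ?_
    (mul_ne_zero two_ne_zero huv) ?_ ?_
  · exact lie_eq_zero_iff_commute.2 (commute_wedge (μ := 0) x.2 (by simp [hu]) (by simp [hv]))
  · exact lie_eq_zero_iff_commute.2 (commute_wedge (μ := 0) x.2 (by simp [hv]) (by simp [hv]))
  · intro h0
    have := congrArg (fun g : skewAdjointLieSubalgebra B => (g : End F V) u) h0
    simp only [hb'] at this
    exact smul_ne_zero (mul_ne_zero two_ne_zero hvu) hv0 this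
  · apply Subtype.ext
    rw [LieSubalgebra.coe_bracket, Ring.lie_def]
    refine (mul_wedge_sub ha v v).trans ?_
    ext t
    simp only [LinearMap.add_apply, wedge_apply, map_smul, map_sub, LinearMap.sub_apply,
      LinearMap.smul_apply, smul_eq_mul, hself, SetLike.val_smul]
    module

omit [FiniteDimensional F V] in
/-- In the orthogonal case, the centralizer of an element with an eigenvector `p` for `μ` and
eigenvectors `q`, `q'` for `-μ` as below contains a two-dimensional non-abelian subalgebra. -/
lemma not_isRegularSemisimpleElement_so (hB : ∀ u v, B u v = B v u)
    {x : skewAdjointLieSubalgebra B} {μ : F} {p q q' : V} (hp : (x : End F V) p = μ • p)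
    (hq : (x : End F V) q = -μ • q) (hq' : (x : End F V) q' = -μ • q') (hpp : B p p = 0)
    (hpq : B p q = 0) (hqq' : B q' q = 0) (hpq' : B p q' = 1) (hq0 : q ≠ 0) :
    ¬ IsRegularSemisimpleElement F x := by
  have hB' : ∀ u v, B u v = 1 * B v u := by simpa using hB
  have ha := wedge_mem hB' (one_mul 1) p q'
  have hb := wedge_mem hB' (one_mul 1) p q
  refine not_isRegularSemisimpleElement (a := ⟨_, ha⟩) (b := ⟨_, hb⟩) (c := -1) ?_ ?_
    (neg_ne_zero.2 one_ne_zero) ?_ ?_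
  · exact lie_eq_zero_iff_commute.2 (commute_wedge x.2 hp hq')
  · exact lie_eq_zero_iff_commute.2 (commute_wedge x.2 hp hq)
  · intro h0
    have := congrArg (fun g : skewAdjointLieSubalgebra B => (g : End F V) q') h0
    simp only [wedge_apply, hpq', hB q q', hqq', one_smul, mul_zero, zero_smul, sub_zero] at this
    exact hq0 this
  · apply Subtype.ext
    rw [LieSubalgebra.coe_bracket, Ring.lie_def]
    refine (mul_wedge_sub ha p q).trans ?_
    ext t
    simp only [LinearMap.add_apply, wedge_apply, map_smul, map_sub, LinearMap.sub_apply,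
      LinearMap.smul_apply, smul_eq_mul, hpp, hpq, hqq', hB q' p, hpq', SetLike.val_smul]
    module

/-- A semisimple element of `so(V)` whose kernel has dimension at least three is not regular. -/
lemma not_isRegularSemisimpleElement_so_of_finrank_ker [IsAlgClosed F] [CharZero F]
    (hnd : B.Nondegenerate) (hB : ∀ u v, B u v = B v u) {x : skewAdjointLieSubalgebra B}
    (hx : (x : End F V).IsSemisimple) (hker : 3 ≤ finrank F ((x : End F V).eigenspace 0)) :
    ¬ IsRegularSemisimpleElement F x := by
  set K := (x : End F V).eigenspace 0 with hK
  have hKnd : ∀ v ∈ K, v ≠ 0 → ∃ u ∈ K, B v u ≠ 0 := by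
    intro v hv hv0
    have := exists_mem_eigenspace_neg hx x.2 hnd hv hv0
    rwa [neg_zero] at this
  set β : LinearMap.BilinForm F K := B.compl₁₂ K.subtype K.subtype with hβ
  have hβapply : ∀ u v : K, β u v = B u v := fun _ _ => rfl
  have hl : ∀ v, (∀ u, β v u = 0) → v = 0 := by
    intro v hv
    by_contra hv0
    obtain ⟨u, hu, huv⟩ := hKnd v v.2 (fun h => hv0 (Subtype.ext h))
    exact huv (hv ⟨u, hu⟩)
  have hβnd : β.Nondegenerate := ⟨hl, fun v hv => hl v fun u => by rw [← hv u]; exact hB _ _⟩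
  obtain ⟨p, q, hpp, hqq, hpq⟩ := exists_hyperbolic_pairs (β := β) (σ := 1) (one_mul 1)
    (fun u v => by rw [one_mul]; exact hB _ _) hβnd 1 (by omega)
  -- the orthogonal complement in `K` of a hyperbolic pair is non-zero
  obtain ⟨w, hw, hw0⟩ : ∃ w, ((β (p 0)).prod (β (q 0))) w = 0 ∧ w ≠ 0 := by
    have hinj : ¬ Function.Injective ((β (p 0)).prod (β (q 0))) := by
      intro hinj
      have := LinearMap.finrank_le_finrank_of_injective hinj
      rw [finrank_prod, finrank_self] at this
      omega
    rw [← LinearMap.ker_eq_bot, ← ne_eq, Submodule.ne_bot_iff] at hinj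
    exact hinj
  have hmem : ∀ v : K, (x : End F V) v = (0 : F) • (v : V) := fun v =>
    Module.End.mem_eigenspace_iff.1 v.2
  rw [LinearMap.prod_apply, Prod.ext_iff] at hw
  refine not_isRegularSemisimpleElement_so hB (μ := 0) (p := p 0) (q := w) (q' := q 0) (hmem _)
    (by rw [neg_zero]; exact hmem _) (by rw [neg_zero]; exact hmem _) (hpp 0 0) hw.1 hw.2
    (by rw [← hβapply, hpq, if_pos rfl]) fun h => hw0 (Subtype.ext h)

end Regular

/-! ### The criterion for semisimple type, and the special linear Lie algebra -/

section Depth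

variable {F V : Type*} [Field F] [AddCommGroup V] [Module F V]
  {L : LieSubalgebra F (End F V)} {h e f : L}

lemma mem_gradedPiece {y : L} {j : ℤ} :
    y ∈ gradedPiece F h j ↔ HasDegree (h : End F V) (y : End F V) j := by
  rw [gradedPiece, Module.End.mem_eigenspace_iff, ← Subtype.coe_inj, LinearMap.ext_iff]
  refine forall_congr' fun v => ?_
  rw [LieAlgebra.ad_apply, LieSubalgebra.coe_bracket, Ring.lie_def, LinearMap.sub_apply,
    sub_eq_iff_eq_add, add_comm]
  rfl

lemma isSl2Triple_coe (t : IsSl2Triple h e f) :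
    IsSl2Triple (h : End F V) (e : End F V) (f : End F V) where
  h_ne_zero := fun h0 => t.h_ne_zero (Subtype.ext h0)
  lie_e_f := by rw [← LieSubalgebra.coe_bracket, t.lie_e_f]
  lie_h_e_nsmul := by rw [← LieSubalgebra.coe_bracket, t.lie_h_e_nsmul]; rfl
  lie_h_f_nsmul := by rw [← LieSubalgebra.coe_bracket, t.lie_h_f_nsmul]; rfl

lemma gradingDepth_eq {d : ℕ} (hne : ∃ y : L, y ≠ 0 ∧ HasDegree (h : End F V) (y : End F V) d)
    (hmax : ∀ j : ℕ, d < j → ∀ y : L, HasDegree (h : End F V) (y : End F V) j → y = 0) :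
    gradingDepth F h = d := by
  have hmem : d ∈ {d : ℕ | gradedPiece F h (d : ℤ) ≠ ⊥} := by
    obtain ⟨y, hy0, hy⟩ := hne
    exact (Submodule.ne_bot_iff _).2 ⟨y, mem_gradedPiece.2 hy, hy0⟩
  have hub : ∀ j ∈ {d : ℕ | gradedPiece F h (d : ℤ) ≠ ⊥}, j ≤ d := by
    intro j hj
    by_contra! hlt
    obtain ⟨y, hy, hy0⟩ := (Submodule.ne_bot_iff _).1 hj
    exact hy0 (hmax j hlt y (mem_gradedPiece.1 hy))
  exact le_antisymm (csSup_le ⟨d, hmem⟩ hub) (le_csSup ⟨d, hub⟩ hmem)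

lemma hasDegree_of_lowestPiece {d : ℕ} (hd : gradingDepth F h = d)
    (E : gradedPiece F h (-(gradingDepth F h : ℤ))) :
    HasDegree (h : End F V) ((E : L) : End F V) (-d) := by
  subst hd
  exact mem_gradedPiece.1 E.2

lemma exists_of_holdsGenerically [Infinite F] {d : ℕ} (hd : gradingDepth F h = d)
    (hne : ∃ y : L, y ≠ 0 ∧ HasDegree (h : End F V) (y : End F V) (-d)) {P : L → Prop}
    (hP : HoldsGenerically F fun E : gradedPiece F h (-(gradingDepth F h : ℤ)) =>
      E ≠ 0 → P (E : L)) :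
    ∃ E : L, HasDegree (h : End F V) (E : End F V) (-d) ∧ P E := by
  obtain ⟨y, hy0, hy⟩ := hne
  rw [← hd] at hy
  obtain ⟨E, hE0, hE⟩ := hP.exists_ne_zero
    (w₀ := ⟨y, mem_gradedPiece.2 hy⟩) (fun h0 => hy0 (congrArg Subtype.val h0))
  exact ⟨E, hasDegree_of_lowestPiece hd E, hE hE0⟩

lemma IsOfRegularSemisimpleType.isOfSemisimpleType (hr : IsOfRegularSemisimpleType F h e) :
    IsOfSemisimpleType F h e := HoldsGenerically.mono hr fun _ hw h0 => (hw h0).1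

variable (h) in
/-- The component of lowest degree of `L`, as a space of operators. -/
noncomputable def lowestPieceEmbedding :
    gradedPiece F h (-(gradingDepth F h : ℤ)) →ₗ[F] End F V :=
  L.toSubmodule.subtype ∘ₗ (gradedPiece F h (-(gradingDepth F h : ℤ))).subtype

variable [CharZero F] [FiniteDimensional F V] [IsAlgClosed F]

lemma IsSl2Triple.eq_zero_of_hasDegree {h e f : End F V} {N : ℕ} (t : IsSl2Triple h e f)
    (hN : WeightsLE h N) {y : End F V} {d : ℤ} (hd : 2 * N < d) (hy : HasDegree h y d) : y = 0 := by
  ext v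
  induction v using t.weight_induction with
  | h0 => simp
  | hadd u v hu hv => rw [map_add, map_add, hu, hv]
  | hwt i v hv =>
    by_cases hi : (N : ℤ) < |i|
    · rw [hN i v hv hi]; simp
    · rw [LinearMap.zero_apply]
      refine hN.eq_zero_of_hasDegree hy hv ?_
      rw [not_lt, abs_le] at hi
      rw [abs_of_nonneg (by omega)]
      omega

/-- The criterion behind all cases: `C` is the condition for semisimple type, `r` the degree of the
minimal polynomial of a generic cyclic element, and `E₀` a lowest component for which there are
`r` eigenvalues. -/
theorem semisimpleType_criterion (hL : DetectsSemisimplicity L) {d : ℕ}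
    (hd : gradingDepth F h = d)
    (hne : ∃ y : L, y ≠ 0 ∧ HasDegree (h : End F V) (y : End F V) (-d)) {Good : L → Prop}
    {C R : Prop} {r : ℕ}
    (hgood : HoldsGenerically F fun E : gradedPiece F h (-(gradingDepth F h : ℤ)) => Good E)
    (honly : ∀ E : L, HasDegree (h : End F V) (E : End F V) (-d) → Good E →
      ((e : End F V) + E).IsSemisimple → C)
    (hdeg : C → ∀ E : L, HasDegree (h : End F V) (E : End F V) (-d) → Good E →
      (minpoly F ((e : End F V) + E)).natDegree ≤ r)
    {E₀ : L} (hE₀ : HasDegree (h : End F V) (E₀ : End F V) (-d)) (hE₀good : Good E₀)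
    (hZ : C → ∃ Z : Finset F, r ≤ Z.card ∧ ∀ ζ ∈ Z, ((e : End F V) + E₀).HasEigenvalue ζ)
    (hR : C → ∀ E : L, HasDegree (h : End F V) (E : End F V) (-d) → Good E →
      ((e + E : L) : End F V).IsSemisimple → (minpoly F ((e + E : L) : End F V)).natDegree = r →
      (IsRegularSemisimpleElement F (e + E) ↔ R)) :
    (IsOfSemisimpleType F h e ↔ C) ∧ (IsOfRegularSemisimpleType F h e ↔ C ∧ R) := by
  have hι := hasDegree_of_lowestPiece hd
  have hw₀mem : E₀ ∈ gradedPiece F h (-(gradingDepth F h : ℤ)) := by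
    rwa [mem_gradedPiece, hd]
  have hgen : C → HoldsGenerically F
      fun w : gradedPiece F h (-(gradingDepth F h : ℤ)) => Good w ∧
      ((e : End F V) + lowestPieceEmbedding h w).IsSemisimple ∧
        (minpoly F ((e : End F V) + lowestPieceEmbedding h w)).natDegree = r := by
    intro hC
    obtain ⟨Z, hZcard, hZ⟩ := hZ hC
    exact hgood.and (generically_isSemisimple (w₀ := ⟨E₀, hw₀mem⟩) _ (lowestPieceEmbedding h)
      (hgood.mono fun w hw => hdeg hC _ (hι w) hw) (hdeg hC E₀ hE₀ hE₀good) hZcard hZ)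
  have hC : IsOfSemisimpleType F h e → C := by
    intro hss
    obtain ⟨E, hE, hP, hP'⟩ := exists_of_holdsGenerically hd hne
      (P := fun E => Good E ∧ IsSemisimpleElement F (e + E))
      ((hgood.and hss).mono fun w hw hw0 => ⟨hw.1, hw.2 hw0⟩)
    exact honly E hE hP ((hL.isSemisimpleElement_iff _).1 hP')
  refine ⟨⟨hC, fun hC => ?_⟩, ⟨fun hreg => ?_, fun ⟨hC, hr⟩ => ?_⟩⟩
  · exact (hgen hC).mono fun w hw _ => (hL.isSemisimpleElement_iff _).2 hw.2.1
  · have hC' := hC hreg.isOfSemisimpleType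
    refine ⟨hC', ?_⟩
    obtain ⟨E, hE, hP, hP', hP''⟩ := exists_of_holdsGenerically hd hne
      (P := fun E => IsRegularSemisimpleElement F (e + E) ∧ Good E ∧
        (minpoly F ((e + E : L) : End F V)).natDegree = r)
      ((hreg.and (hgen hC')).mono fun w hw hw0 => ⟨hw.1 hw0, hw.2.1, hw.2.2.2⟩)
    exact (hR hC' E hE hP' ((hL.isSemisimpleElement_iff _).1 hP.1) hP'').1 hP
  · exact (hgen hC).mono fun w hw _ => (hR hC w (hι w) hw.1 hw.2.1 hw.2.2).2 hr

/-- When the depth is `2N`, the element `e` is of semisimple type if and only if `e` vanishes on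
`core`, provided that the operators `E e ^ N` on the component of lowest weight have annihilating
polynomials of degree at most `κ`, and that one of them has `κ` non-zero eigenvalues. -/
theorem IsSl2Triple.semisimpleType_iff {N : ℕ} (t : IsSl2Triple h e f)
    (hN : WeightsLE (h : End F V) N) (hL : DetectsSemisimplicity L)
    (hd : gradingDepth F h = (2 * N : ℕ))
    (hne : ∃ y : L, y ≠ 0 ∧ HasDegree (h : End F V) (y : End F V) (-(2 * N))) {κ : ℕ}
    (hA : ∀ E ∈ L, HasDegree (h : End F V) E (-(2 * N)) → ∃ g : F[X], g ≠ 0 ∧ g.natDegree ≤ κ ∧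
      ∀ m ∈ weightSpace (h : End F V) (-N), aeval (E * (e : End F V) ^ N) g m = 0)
    {E₀ : End F V} (hE₀ : E₀ ∈ L) (hE₀h : HasDegree (h : End F V) E₀ (-(2 * N)))
    {Λ : Finset F} (hΛ0 : (0 : F) ∉ Λ) (hΛ : κ ≤ Λ.card)
    (hE₀Λ : ∀ l ∈ Λ, ∃ m ∈ weightSpace (h : End F V) (-N), m ≠ 0 ∧
      E₀ (((e : End F V) ^ N) m) = l • m)
    {R : Prop} (hR : ∀ E : L, HasDegree (h : End F V) (E : End F V) (-(2 * N)) →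
      (∀ v ∈ core (e : End F V) (f : End F V) N, (e : End F V) v = 0) →
      ((e + E : L) : End F V).IsSemisimple →
      (minpoly F ((e + E : L) : End F V)).natDegree =
        κ * (N + 1) + min 1 (finrank F (core (e : End F V) (f : End F V) N)) →
      (IsRegularSemisimpleElement F (e + E) ↔ R)) :
    (IsOfSemisimpleType F h e ↔
      ∀ v ∈ core (e : End F V) (f : End F V) N, (e : End F V) v = 0) ∧
    (IsOfRegularSemisimpleType F h e ↔
      (∀ v ∈ core (e : End F V) (f : End F V) N, (e : End F V) v = 0) ∧ R) := by
  have t' := isSl2Triple_coe t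
  have hcast : (-((2 * N : ℕ) : ℤ)) = -(2 * N) := by push_cast; rfl
  refine semisimpleType_criterion (Good := fun _ => True) (E₀ := ⟨E₀, hE₀⟩)
    (r := κ * (N + 1) + min 1 (finrank F (core (e : End F V) (f : End F V) N))) hL hd
    (by rwa [hcast]) (HoldsGenerically.of_forall fun _ => trivial) ?_ ?_ (by rwa [hcast]) trivial
    ?_ ?_
  · rw [hcast]
    exact fun E hE _ hss => t'.core_le_ker_of_isSemisimple hN hE hss
  · rw [hcast]
    intro hcore E hE _
    obtain ⟨g, hg0, hgκ, hg⟩ := hA E E.2 hE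
    refine t'.natDegree_minpoly_cyclic_le hN hE hg0 hgκ hg hcore ?_
    by_cases hbot : core (e : End F V) (f : End F V) N = ⊥
    · exact Or.inl ⟨hbot, by rw [hbot, finrank_bot]; rfl⟩
    · exact Or.inr (min_eq_left (Submodule.one_le_finrank_iff.2 hbot))
  · intro hcore
    obtain ⟨Z, hZ, hZ'⟩ := t'.exists_finset_eigenvalues_cyclic hN hE₀h hcore hΛ0 hE₀Λ
    exact ⟨Z, le_trans (by gcongr) hZ, hZ'⟩
  · rw [hcast]
    exact fun hcore E hE _ => hR E hE hcore

end Depth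

section SpecialLinear

variable {F V : Type*} [Field F] [AddCommGroup V] [Module F V]
  [CharZero F] [FiniteDimensional F V] [IsAlgClosed F] {N : ℕ}

omit [CharZero F] [IsAlgClosed F] in
lemma exists_pair_of_two_le_finrank {K : Submodule F V} (hK : 2 ≤ finrank F K) :
    ∃ v ∈ K, ∃ w ∈ K, LinearIndependent F ![v, w] := by
  set b := finBasis F K
  refine ⟨b ⟨0, by omega⟩, (b _).2, b ⟨1, by omega⟩, (b _).2, ?_⟩
  have h1 := (b.linearIndependent.comp ![⟨0, by omega⟩, ⟨1, by omega⟩]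
    (by intro i j hij; fin_cases i <;> fin_cases j <;> simp at hij ⊢)).map' K.subtype
      (Submodule.ker_subtype K)
  have h2 : ∀ i, K.subtype ((b ∘ ![⟨0, by omega⟩, ⟨1, by omega⟩]) i) =
      ![(b ⟨0, by omega⟩ : V), (b ⟨1, by omega⟩ : V)] i := by
    intro i
    fin_cases i <;> rfl
  rw [← funext h2]
  exact h1

/-- The finite set `{1, …, k}` in a field of characteristic zero. -/
noncomputable def natFinset (F : Type*) [Field F] [CharZero F] (k : ℕ) : Finset F :=
  (Finset.range k).map ⟨fun a : ℕ => (a : F) + 1, fun a b hab => by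
    simpa using hab⟩

omit [IsAlgClosed F] in
lemma card_natFinset (k : ℕ) : (natFinset F k).card = k := by simp [natFinset]

omit [IsAlgClosed F] in
lemma exists_of_mem_natFinset {k : ℕ} {l : F} (hl : l ∈ natFinset F k) :
    ∃ a : Fin k, l = ((a : ℕ) : F) + 1 := by
  obtain ⟨a, ha, rfl⟩ := Finset.mem_map.1 hl
  exact ⟨⟨a, Finset.mem_range.1 ha⟩, rfl⟩

omit [IsAlgClosed F] in
lemma zero_notMem_natFinset (k : ℕ) : (0 : F) ∉ natFinset F k := by
  intro h0
  obtain ⟨a, ha⟩ := exists_of_mem_natFinset h0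
  exact Nat.cast_add_one_ne_zero _ ha.symm

/-- In `sl(V)` the operators `E e ^ N` are all the operators on the component of lowest weight. -/
theorem sl_semisimpleType_iff {h e f : slSubalgebra F V} (t : IsSl2Triple h e f)
    (hN : WeightsLE (h : End F V) N) (hN0 : 1 ≤ N)
    (hbot : weightSpace (h : End F V) (-N) ≠ ⊥) :
    (IsOfSemisimpleType F h e ↔
      ∀ v ∈ core (e : End F V) (f : End F V) N, (e : End F V) v = 0) ∧
    (IsOfRegularSemisimpleType F h e ↔
      (∀ v ∈ core (e : End F V) (f : End F V) N, (e : End F V) v = 0) ∧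
        finrank F (core (e : End F V) (f : End F V) N) ≤ 1) := by
  have t' := isSl2Triple_coe t
  obtain ⟨m, hm, hm0⟩ := (Submodule.ne_bot_iff _).1 hbot
  have hmem : ∀ {y : End F V} {c : ℤ}, c ≠ 0 → HasDegree (h : End F V) y c →
      y ∈ slSubalgebra F V := fun hc hy =>
    mem_slSubalgebra.2 (LinearMap.isNilpotent_trace_of_isNilpotent (hy.isNilpotent hc)).eq_zero
  have hetop : ((e : End F V) ^ N) m ≠ 0 := fun h0 => hm0 (t'.eq_zero_of_e_pow hN hm h0)
  have heN := t'.symm.hasDegree_f_pow N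
  have hedeg : HasDegree (h : End F V) ((e : End F V) ^ N) (2 * N) := by
    have := t'.hasDegree_e.pow N
    rwa [mul_comm] at this
  have hd : gradingDepth F h = (2 * N : ℕ) := by
    refine gradingDepth_eq ⟨⟨(e : End F V) ^ N, hmem (by omega) hedeg⟩, fun h0 => hetop ?_, ?_⟩
      fun j hj y hy => Subtype.ext (t'.eq_zero_of_hasDegree hN (by omega) hy)
    · rw [show (e : End F V) ^ N = 0 from congrArg Subtype.val h0, LinearMap.zero_apply]
    · simpa using hedeg
  have hne : ∃ y : slSubalgebra F V, y ≠ 0 ∧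
      HasDegree (h : End F V) (y : End F V) (-(2 * N)) := by
    refine ⟨⟨(f : End F V) ^ N, hmem (by omega) (t'.hasDegree_f_pow N)⟩, fun h0 => hm0 ?_,
      t'.hasDegree_f_pow N⟩
    have h1 := t'.f_pow_e_pow_of_mem_bot hN hm
    rw [show (f : End F V) ^ N = 0 from congrArg Subtype.val h0, LinearMap.zero_apply] at h1
    exact (smul_eq_zero.1 h1.symm).resolve_left (topScalar_ne_zero N)
  obtain ⟨E₀, hE₀, hE₀h, hE₀Λ⟩ := t'.exists_diagonal_operator hN hN0
  refine t.semisimpleType_iff hN slSubalgebra_detectsSemisimplicity hd hne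
    (fun E _ hE => t'.exists_annihilator_bot hN hE) hE₀ hE₀h
    (zero_notMem_natFinset (finrank F (weightSpace (h : End F V) (-N)))) (card_natFinset _).ge
    (fun l hl => ?_) fun E hE hcore hss hdeg => ⟨fun hreg => ?_, fun hle => ?_⟩
  · obtain ⟨a, rfl⟩ := exists_of_mem_natFinset hl
    exact hE₀Λ a
  · by_contra! hlt
    obtain ⟨v, hv, w, hw, hli⟩ := exists_pair_of_two_le_finrank
      (K := core (e : End F V) (f : End F V) N) (by omega)
    have hzero : ∀ u ∈ core (e : End F V) (f : End F V) N, ((e + E : slSubalgebra F V) :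
        End F V) u = 0 := fun u hu =>
      (t'.cyclic_apply_of_mem_core hN hE hu).trans (hcore u hu)
    exact not_isRegularSemisimpleElement_sl hss hli (hzero v hv) (hzero w hw) hreg
  · refine isRegularSemisimpleElement_of_finrank_le slSubalgebra_detectsSemisimplicity hss ?_
    rw [hdeg, t'.finrank_eq hN]
    omega

end SpecialLinear

/-! ### Symplectic Lie algebras, and orthogonal Lie algebras with a multiple top block -/

section SkewDepth

variable {F V : Type*} [Field F] [AddCommGroup V] [Module F V] [CharZero F] {N : ℕ}
  {B : LinearMap.BilinForm F V} {ε : F}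

lemma wedge_self_ne_zero (hnd : B.Nondegenerate) {u : V} (hu : u ≠ 0) : wedge B (-1) u u ≠ 0 := by
  obtain ⟨s, hs⟩ : ∃ s, B u s ≠ 0 := by
    by_contra! h
    exact hu (hnd.1 u h)
  intro h0
  have h1 := congrArg (fun g : End F V => g s) h0
  simp only [wedge_apply, LinearMap.zero_apply] at h1
  have h2 : (2 * B u s) • u = 0 := by rw [← h1]; module
  exact smul_ne_zero (mul_ne_zero two_ne_zero hs) hu h2

omit [CharZero F] in
lemma wedge_ne_zero (hnd : B.Nondegenerate) {u v : V} (huv : LinearIndependent F ![u, v]) :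
    wedge B ε u v ≠ 0 := by
  obtain ⟨s, hs⟩ : ∃ s, B u s ≠ 0 := by
    by_contra! h
    exact huv.ne_zero 0 (hnd.1 u h)
  intro h0
  have h1 := congrArg (fun g : End F V => g s) h0
  simp only [wedge_apply, LinearMap.zero_apply] at h1
  rw [LinearIndependent.pair_iff] at huv
  exact hs (huv (-(ε * B v s)) (B u s) (by rw [← h1]; module)).2

/-- A non-singular square matrix of odd size is not antisymmetric. -/
lemma even_finrank_of_antisymm {M : Type*} [AddCommGroup M] [Module F M] [FiniteDimensional F M]
    {β : LinearMap.BilinForm F M} (hnd : β.Nondegenerate) (hβ : ∀ u v, β u v = -β v u) :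
    Even (finrank F M) := by
  by_contra hodd
  rw [Nat.not_even_iff_odd] at hodd
  set b := finBasis F M
  set J := LinearMap.BilinForm.toMatrix b β with hJ
  have hdet : J.det ≠ 0 :=
    Matrix.nondegenerate_iff_det_ne_zero.1 ((LinearMap.BilinForm.nondegenerate_toMatrix_iff b).2 hnd)
  have hskew : J.transpose = -J := by
    ext i j
    rw [Matrix.transpose_apply, Matrix.neg_apply, hJ, LinearMap.BilinForm.toMatrix_apply,
      LinearMap.BilinForm.toMatrix_apply, hβ]
  have h1 := Matrix.det_transpose J
  rw [hskew, Matrix.det_neg, Fintype.card_fin, hodd.neg_one_pow] at h1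
  have h2 : (2 : F) * J.det = 0 := by linear_combination -h1
  exact hdet ((mul_eq_zero.1 h2).resolve_left two_ne_zero)

/-- The finite set `{±1, …, ±k}` in a field of characteristic zero. -/
noncomputable def signedFinset (F : Type*) [Field F] [CharZero F] (k : ℕ) : Finset F :=
  (natFinset F k).disjUnion ((natFinset F k).map (Equiv.neg F).toEmbedding) (by
    rw [Finset.disjoint_left]
    intro l hl hl'
    obtain ⟨l', hl'', hll'⟩ := Finset.mem_map.1 hl'
    obtain ⟨a, rfl⟩ := exists_of_mem_natFinset hl
    obtain ⟨b, rfl⟩ := exists_of_mem_natFinset hl''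
    replace hll' : -(((b : ℕ) : F) + 1) = ((a : ℕ) : F) + 1 := hll'
    have h1 : (((a : ℕ) + 1 + ((b : ℕ) + 1) : ℕ) : F) = 0 := by
      push_cast
      linear_combination -hll'
    exact absurd (Nat.cast_eq_zero.1 h1) (by omega))

lemma card_signedFinset (k : ℕ) : (signedFinset F k).card = 2 * k := by
  rw [signedFinset, Finset.card_disjUnion, Finset.card_map, card_natFinset, two_mul]

lemma exists_of_mem_signedFinset {k : ℕ} {l : F} (hl : l ∈ signedFinset F k) :
    ∃ a : Fin k, l = ((a : ℕ) : F) + 1 ∨ l = -(((a : ℕ) : F) + 1) := by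
  rcases Finset.mem_disjUnion.1 hl with hl | hl
  · obtain ⟨a, ha⟩ := exists_of_mem_natFinset hl
    exact ⟨a, Or.inl ha⟩
  · obtain ⟨l', hl', rfl⟩ := Finset.mem_map.1 hl
    obtain ⟨a, rfl⟩ := exists_of_mem_natFinset hl'
    exact ⟨a, Or.inr rfl⟩

lemma zero_notMem_signedFinset (k : ℕ) : (0 : F) ∉ signedFinset F k := by
  intro h0
  obtain ⟨a, ha | ha⟩ := exists_of_mem_signedFinset h0
  · exact Nat.cast_add_one_ne_zero _ ha.symm
  · exact Nat.cast_add_one_ne_zero _ (neg_eq_zero.1 ha.symm)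

variable [FiniteDimensional F V] [IsAlgClosed F] {h e f : skewAdjointLieSubalgebra B}

/-- If the components of weight `±N` contain non-zero elements `u ∧ v`, then the depth is `2N`. -/
lemma gradingDepth_skew (t : IsSl2Triple h e f) (hN : WeightsLE (h : End F V) N)
    (hB : ∀ u v, B u v = ε * B v u) (hε : ε * ε = 1) {u v : V}
    (hu : u ∈ weightSpace (h : End F V) (-N)) (hv : v ∈ weightSpace (h : End F V) (-N))
    (huv : wedge B ε u v ≠ 0)
    (huv' : wedge B ε (((e : End F V) ^ N) u) (((e : End F V) ^ N) v) ≠ 0) :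
    gradingDepth F h = (2 * N : ℕ) ∧
      ∃ y : skewAdjointLieSubalgebra B, y ≠ 0 ∧
        HasDegree (h : End F V) (y : End F V) (-(2 * N)) := by
  have t' := isSl2Triple_coe t
  constructor
  · refine gradingDepth_eq ⟨⟨_, wedge_mem hB hε (((e : End F V) ^ N) u) (((e : End F V) ^ N) v)⟩,
      fun h0 => huv' (congrArg Subtype.val h0), ?_⟩
      fun j hj y hy => Subtype.ext (t'.eq_zero_of_hasDegree hN (by omega) hy)
    have := hasDegree_wedge (ε := ε) h.2 (t'.e_pow_mem hu N) (t'.e_pow_mem hv N)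
    rwa [show -(N : ℤ) + 2 * N + (-(N : ℤ) + 2 * N) = (2 * N : ℕ) by push_cast; ring] at this
  · refine ⟨⟨_, wedge_mem hB hε u v⟩, fun h0 => huv (congrArg Subtype.val h0), ?_⟩
    have := hasDegree_wedge (ε := ε) h.2 hu hv
    rwa [show -(N : ℤ) + -(N : ℤ) = -(2 * N) by ring] at this

end SkewDepth

section Symplectic

variable {F V : Type*} [Field F] [AddCommGroup V] [Module F V] [CharZero F] {N : ℕ}
  {B : LinearMap.BilinForm F V} [FiniteDimensional F V] [IsAlgClosed F]
  {h e f : skewAdjointLieSubalgebra B}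

/-- The form on the component of lowest weight is alternating for even `N`, where hyperbolic pairs,
and symmetric for odd `N`, where an orthogonal basis, yield an operator `E e ^ N` with simple
non-zero spectrum. -/
theorem sp_semisimpleType_iff (hnd : B.Nondegenerate) (hB : ∀ u v, B u v = -1 * B v u)
    (t : IsSl2Triple h e f) (hN : WeightsLE (h : End F V) N)
    (hbot : weightSpace (h : End F V) (-N) ≠ ⊥) :
    (IsOfSemisimpleType F h e ↔
      ∀ v ∈ core (e : End F V) (f : End F V) N, (e : End F V) v = 0) ∧
    (IsOfRegularSemisimpleType F h e ↔
      (∀ v ∈ core (e : End F V) (f : End F V) N, (e : End F V) v = 0) ∧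
        finrank F (core (e : End F V) (f : End F V) N) ≤ 1) := by
  have t' := isSl2Triple_coe t
  obtain ⟨m, hm, hm0⟩ := (Submodule.ne_bot_iff _).1 hbot
  obtain ⟨hd, hne⟩ := gradingDepth_skew t hN hB (by norm_num) hm hm (wedge_self_ne_zero hnd hm0)
    (wedge_self_ne_zero hnd fun h0 => hm0 (t'.eq_zero_of_e_pow hN hm h0))
  have hL := skewAdjointLieSubalgebra_detectsSemisimplicity hnd hB (by norm_num)
  have hreg : ∀ E : skewAdjointLieSubalgebra B,
      HasDegree (h : End F V) (E : End F V) (-(2 * N)) →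
      (∀ v ∈ core (e : End F V) (f : End F V) N, (e : End F V) v = 0) →
      ((e + E : skewAdjointLieSubalgebra B) : End F V).IsSemisimple →
      (minpoly F ((e + E : skewAdjointLieSubalgebra B) : End F V)).natDegree =
        finrank F (weightSpace (h : End F V) (-N)) * (N + 1) +
          min 1 (finrank F (core (e : End F V) (f : End F V) N)) →
      (IsRegularSemisimpleElement F (e + E) ↔
        finrank F (core (e : End F V) (f : End F V) N) ≤ 1) := by
    intro E hE hcore hss hdeg
    refine ⟨fun hreg => ?_, fun hle => ?_⟩
    · by_contra! hlt
      have hne : core (e : End F V) (f : End F V) N ≠ ⊥ := by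
        intro h0
        rw [h0, finrank_bot] at hlt
        omega
      obtain ⟨v, hv, hv0⟩ := (Submodule.ne_bot_iff _).1 hne
      have hXv : ((e + E : skewAdjointLieSubalgebra B) : End F V) v = 0 :=
        (t'.cyclic_apply_of_mem_core hN hE hv).trans (hcore v hv)
      obtain ⟨u, hu, huv⟩ := exists_mem_eigenspace_neg (μ := 0) hss (Subtype.prop _) hnd
        (Module.End.mem_eigenspace_iff.2 (by rw [hXv, zero_smul])) hv0
      rw [neg_zero, Module.End.mem_eigenspace_iff, zero_smul] at hu
      exact not_isRegularSemisimpleElement_sp hB hXv hu huv hreg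
    · refine isRegularSemisimpleElement_of_finrank_le hL hss ?_
      rw [hdeg, t'.finrank_eq hN]
      omega
  rcases N.even_or_odd with hev | hodd
  · have hk : Even (finrank F (weightSpace (h : End F V) (-N))) :=
      even_finrank_of_antisymm (t'.bottomForm_nondegenerate hN hnd hB h.2 e.2)
        fun u v => by rw [bottomForm_symm hB e.2, hev.neg_one_pow]; ring
    obtain ⟨κ, hκ⟩ := hk
    obtain ⟨E₀, hE₀, hE₀h, hE₀Λ⟩ := t'.exists_hyperbolic_operator hN hnd hB (by norm_num) h.2 e.2
      (κ := κ) (by omega)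
    refine t.semisimpleType_iff hN hL hd hne (fun E _ hE => t'.exists_annihilator_bot hN hE) hE₀
      hE₀h (zero_notMem_signedFinset κ) (by rw [card_signedFinset]; omega) (fun l hl => ?_) hreg
    obtain ⟨a, rfl | rfl⟩ := exists_of_mem_signedFinset hl
    · exact (hE₀Λ a).1
    · simpa [hev.neg_one_pow] using (hE₀Λ a).2
  · obtain ⟨E₀, hE₀, hE₀h, hE₀Λ⟩ := t'.exists_orthogonal_operator hN hnd hB h.2 e.2 hodd
    refine t.semisimpleType_iff hN hL hd hne (fun E _ hE => t'.exists_annihilator_bot hN hE) hE₀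
      hE₀h (zero_notMem_natFinset (finrank F (weightSpace (h : End F V) (-N))))
      (card_natFinset _).ge (fun l hl => ?_) hreg
    obtain ⟨a, rfl⟩ := exists_of_mem_natFinset hl
    exact hE₀Λ a

end Symplectic

section Orthogonal

variable {F V : Type*} [Field F] [AddCommGroup V] [Module F V] [CharZero F] {N : ℕ}
  {B : LinearMap.BilinForm F V}

omit [CharZero F] in
lemma apply_eq_zero_of_eigenvectors {x : End F V} (hx : x ∈ skewAdjointLieSubalgebra B) {μ ν : F}
    (hμν : μ + ν ≠ 0) {u v : V} (hu : x u = μ • u) (hv : x v = ν • v) : B u v = 0 := by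
  have h1 := mem_skewAdjointLieSubalgebra.1 hx u v
  rw [hu, hv, map_smul, map_smul, LinearMap.smul_apply, smul_eq_mul, smul_eq_mul] at h1
  have h2 : (μ + ν) * B u v = 0 := by linear_combination h1
  exact (mul_eq_zero.1 h2).resolve_left hμν

variable [FiniteDimensional F V] [IsAlgClosed F]

section

variable {h e f E : End F V}

/-- The eigenvector `∑ ζ ^ (N - i) e ^ i m` of the cyclic element. -/
lemma IsSl2Triple.exists_cyclic_eigenvector (t : IsSl2Triple h e f) (hN : WeightsLE h N)
    (hE : HasDegree h E (-(2 * N))) {ζ : F} (hζ : ζ ≠ 0) {m : V} (hm : m ∈ weightSpace h (-N))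
    (hm0 : m ≠ 0) (hEm : E ((e ^ N) m) = ζ ^ (N + 1) • m) :
    ∃ p, p ≠ 0 ∧ (e + E) p = ζ • p ∧
      p ∈ Submodule.span F (Set.range fun j : ℕ => (e ^ j) m) := by
  set p := ∑ i ∈ Finset.range (N + 1), ζ ^ (N - i) • (e ^ i) m with hp
  refine ⟨p, fun h0 => ?_, ?_, Submodule.sum_mem _ fun i _ => Submodule.smul_mem _ _
    (Submodule.subset_span ⟨i, rfl⟩)⟩
  · have h1 : (e ^ N) p = ζ ^ N • (e ^ N) m := by
      rw [hp, map_sum, Finset.sum_eq_single 0]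
      · simp
      · intro i _ hi
        rw [map_smul, ← Module.End.mul_apply, ← pow_add,
          t.e_pow_eq_zero hN hm (by push_cast; omega), smul_zero]
      · simp
    rw [h0, map_zero] at h1
    exact hm0 (t.eq_zero_of_e_pow hN hm
      ((smul_eq_zero.1 h1.symm).resolve_left (pow_ne_zero _ hζ)))
  · have hcomm : Commute (e + E) (algebraMap F (End F V) ζ) := (Algebra.commutes ζ (e + E)).symm
    have h1 := congrArg (fun g : End F V => g m) (hcomm.mul_geom_sum₂ (N + 1))
    simp only [Module.End.mul_apply, LinearMap.sub_apply, LinearMap.sum_apply, ← map_pow,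
      Module.algebraMap_end_apply, map_smul] at h1
    rw [t.cyclic_pow_succ_of_mem_bot hN hE hm, Module.End.mul_apply, hEm, sub_self,
      sub_eq_zero] at h1
    have h2 : p = ∑ i ∈ Finset.range (N + 1), ζ ^ (N + 1 - 1 - i) • ((e + E) ^ i) m :=
      Finset.sum_congr rfl fun i hi => by
        rw [t.cyclic_pow_of_mem_bot hN hE hm (by have := Finset.mem_range.1 hi; omega),
          Nat.add_sub_cancel]
    rw [h2]
    exact h1

/-- For symmetric `B` and odd `N`, a vector of weight `-N` generates an isotropic `e`-stable
subspace, which contains eigenvectors of a semisimple cyclic element for opposite eigenvalues. -/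
lemma IsSl2Triple.exists_isotropic_eigenvectors (t : IsSl2Triple h e f) (hN : WeightsLE h N)
    (hB : ∀ u v, B u v = B v u) (hh : h ∈ skewAdjointLieSubalgebra B)
    (he : e ∈ skewAdjointLieSubalgebra B) (hodd : Odd N) (hbot : weightSpace h (-N) ≠ ⊥)
    (hE : HasDegree h E (-(2 * N))) (hss : (e + E).IsSemisimple) :
    ∃ (μ : F) (p q : V), μ ≠ 0 ∧ p ≠ 0 ∧ q ≠ 0 ∧ (e + E) p = μ • p ∧ (e + E) q = -μ • q ∧ B p q = 0 := by
  have : Nontrivial (weightSpace h (-N)) := Submodule.nontrivial_iff_ne_bot.2 hbot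
  obtain ⟨l, hl⟩ := Module.End.exists_eigenvalue (bottomOperator t hN hE)
  obtain ⟨m, hm⟩ := hl.exists_hasEigenvector
  have hEm : E ((e ^ N) m) = l • (m : V) := congrArg Subtype.val hm.apply_eq_smul
  have hm0 : (m : V) ≠ 0 := fun h0 => hm.2 (Subtype.ext h0)
  have hN1 : 1 ≤ N := hodd.pos
  -- `m` would lie in the kernel of a power of the cyclic element, but `(e + E) m = e m ≠ 0`
  have hl0 : l ≠ 0 := by
    rintro rfl
    have h1 : ((e + E) ^ (N + 1)) m = 0 := by
      rw [t.cyclic_pow_succ_of_mem_bot hN hE m.2, Module.End.mul_apply, hEm, zero_smul]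
    have h2 := eq_zero_of_isSemisimple_of_pow_apply hss h1
    have h3 := t.cyclic_pow_of_mem_bot hN hE m.2 hN1
    rw [pow_one, h2, pow_one] at h3
    refine hm0 (t.eq_zero_of_e_pow hN m.2 ?_)
    obtain ⟨n, rfl⟩ := Nat.exists_eq_add_of_le' hN1
    rw [pow_succ, Module.End.mul_apply, ← h3, map_zero]
  obtain ⟨ζ, hζ⟩ := IsAlgClosed.exists_pow_nat_eq l (Nat.add_one_pos N)
  have hζ0 : ζ ≠ 0 := by
    rintro rfl
    rw [zero_pow N.succ_ne_zero] at hζ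
    exact hl0 hζ.symm
  have hiso : ∀ u ∈ Submodule.span F (Set.range fun j : ℕ => (e ^ j) (m : V)),
      ∀ v ∈ Submodule.span F (Set.range fun j : ℕ => (e ^ j) (m : V)), B u v = 0 := by
    intro u hu v hv
    refine Submodule.span_induction₂ (p := fun u v _ _ => B u v = 0) ?_ (by simp) (by simp)
      (fun u u' v _ _ _ h1 h2 => by rw [map_add, LinearMap.add_apply, h1, h2, add_zero])
      (fun u v v' _ _ _ h1 h2 => by rw [map_add, h1, h2, add_zero])
      (fun c u v _ _ h1 => by rw [map_smul, LinearMap.smul_apply, h1, smul_zero])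
      (fun c u v _ _ h1 => by rw [map_smul, h1, smul_zero]) hu hv
    rintro _ _ ⟨i, rfl⟩ ⟨j, rfl⟩
    rw [skew_pow_apply he, ← Module.End.mul_apply, ← pow_add]
    -- the form `B m (e ^ N m')` is alternating, and the other pairings vanish by weight
    by_cases hij : i + j = N
    · have h1 := skew_pow_apply he N (m : V) m
      rw [hB, hodd.neg_one_pow] at h1
      have h2 : (2 : F) * B m ((e ^ N) m) = 0 := by linear_combination h1
      rw [hij, (mul_eq_zero.1 h2).resolve_left two_ne_zero, mul_zero]
    · rw [apply_eq_zero_of_weights hh (by push_cast; omega) m.2 (t.e_pow_mem m.2 (i + j)),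
        mul_zero]
  obtain ⟨p, hp0, hp, hpm⟩ := t.exists_cyclic_eigenvector hN hE hζ0 m.2 hm0 (hζ ▸ hEm)
  obtain ⟨q, hq0, hq, hqm⟩ := t.exists_cyclic_eigenvector hN hE (neg_ne_zero.2 hζ0) m.2 hm0
    (by rw [hodd.add_one.neg_pow, hζ]; exact hEm)
  exact ⟨ζ, p, q, hζ0, hp0, hq0, hp, hq, hiso p hpm q hqm⟩

end

variable {h e f : skewAdjointLieSubalgebra B}

lemma exists_pair_bot (t : IsSl2Triple h e f) (hN : WeightsLE (h : End F V) N)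
    (hnd : B.Nondegenerate) (hB : ∀ u v, B u v = B v u)
    (hk : 2 ≤ finrank F (weightSpace (h : End F V) (-N))) :
    gradingDepth F h = (2 * N : ℕ) ∧
      ∃ y : skewAdjointLieSubalgebra B, y ≠ 0 ∧
        HasDegree (h : End F V) (y : End F V) (-(2 * N)) := by
  have t' := isSl2Triple_coe t
  obtain ⟨u, hu, v, hv, huv⟩ := exists_pair_of_two_le_finrank hk
  refine gradingDepth_skew (ε := 1) t hN (by simpa using hB) (one_mul 1) hu hv
    (wedge_ne_zero hnd huv) (wedge_ne_zero hnd ?_)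
  rw [LinearIndependent.pair_iff] at huv ⊢
  intro a b hab
  refine huv a b (t'.eq_zero_of_e_pow hN (add_mem (Submodule.smul_mem _ a hu)
    (Submodule.smul_mem _ b hv)) ?_)
  rw [map_add, map_smul, map_smul, hab]

/-- For even `N` the operators `E e ^ N` are skew-adjoint for a symmetric form on a space of even
dimension `2κ`, and have `2κ` distinct non-zero eigenvalues in general. For odd `N` they are
self-adjoint for an alternating form: they have `κ` eigenvalues, each of them with multiplicity two,
so that semisimple cyclic elements are not regular. -/
theorem so_semisimpleType_iff_of_even (hnd : B.Nondegenerate) (hB : ∀ u v, B u v = B v u)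
    (t : IsSl2Triple h e f) (hN : WeightsLE (h : End F V) N)
    (hbot : weightSpace (h : End F V) (-N) ≠ ⊥)
    (hk : Even (finrank F (weightSpace (h : End F V) (-N)))) :
    (IsOfSemisimpleType F h e ↔
      ∀ v ∈ core (e : End F V) (f : End F V) N, (e : End F V) v = 0) ∧
    (IsOfRegularSemisimpleType F h e ↔
      (∀ v ∈ core (e : End F V) (f : End F V) N, (e : End F V) v = 0) ∧
        Even N ∧ finrank F (core (e : End F V) (f : End F V) N) ≤ 2) := by
  have t' := isSl2Triple_coe t
  have hB' : ∀ u v, B u v = 1 * B v u := by simpa using hB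
  have hL := skewAdjointLieSubalgebra_detectsSemisimplicity hnd hB' (one_mul 1)
  have hpos := Submodule.one_le_finrank_iff.2 hbot
  obtain ⟨κ, hκ⟩ := hk
  obtain ⟨hd, hne⟩ := exists_pair_bot t hN hnd hB (by omega)
  obtain ⟨E₀, hE₀, hE₀h, hE₀Λ⟩ := t'.exists_hyperbolic_operator hN hnd hB' (one_mul 1) h.2 e.2
    (κ := κ) (by omega)
  rcases N.even_or_odd with hev | hodd
  · refine t.semisimpleType_iff hN hL hd hne (fun E _ hE => t'.exists_annihilator_bot hN hE) hE₀
      hE₀h (zero_notMem_signedFinset κ) (by rw [card_signedFinset]; omega) (fun l hl => ?_) ?_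
    · obtain ⟨a, rfl | rfl⟩ := exists_of_mem_signedFinset hl
      · exact (hE₀Λ a).1
      · simpa [hev.neg_one_pow] using (hE₀Λ a).2
    · intro E hE hcore hss hdeg
      have hker : core (e : End F V) (f : End F V) N ≤
          ((e + E : skewAdjointLieSubalgebra B) : End F V).eigenspace 0 := by
        intro v hv
        rw [Module.End.mem_eigenspace_iff, zero_smul]
        exact (t'.cyclic_apply_of_mem_core hN hE hv).trans (hcore v hv)
      have hle := Submodule.finrank_mono hker
      have hdim := t'.finrank_eq hN
      refine ⟨fun hreg => ⟨hev, ?_⟩, fun hle => ?_⟩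
      · by_contra! hlt
        exact not_isRegularSemisimpleElement_so_of_finrank_ker hnd hB hss (by omega) hreg
      · refine isRegularSemisimpleElement_skew_of_finrank_le hnd hB hss ?_
        rw [hdeg]
        omega
  · refine t.semisimpleType_iff hN hL hd hne
      (fun E hEs hE => t'.exists_annihilator_bot_half hN hnd hB h.2 e.2 hodd hE hEs (by omega))
      hE₀ hE₀h (zero_notMem_natFinset κ) (card_natFinset κ).ge (fun l hl => ?_) ?_
    · obtain ⟨a, rfl⟩ := exists_of_mem_natFinset hl
      exact (hE₀Λ a).1
    · intro E hE hcore hss _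
      refine iff_of_false (fun hreg => ?_) fun h0 => (Nat.not_even_iff_odd.2 hodd) h0.1
      obtain ⟨μ, p, q, hμ, hp0, hq0, hp, hq, hpq⟩ :=
        t'.exists_isotropic_eigenvectors hN hB h.2 e.2 hodd hbot hE hss
      -- `p` pairs non-trivially with the eigenspace for `-μ`, but not with `q`
      obtain ⟨q', hq', hpq'⟩ := exists_mem_eigenspace_neg hss (Subtype.prop _) hnd
        (Module.End.mem_eigenspace_iff.2 hp) hp0
      have h2μ : ∀ {a : F}, a ≠ 0 → a + a ≠ 0 := fun ha => by
        rw [← two_mul]; exact mul_ne_zero two_ne_zero ha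
      have hmem : ((e : End F V) + E) ∈ skewAdjointLieSubalgebra B :=
        (e + E : skewAdjointLieSubalgebra B).2
      have hq'' := Module.End.mem_eigenspace_iff.1 (Submodule.smul_mem _ (B p q')⁻¹ hq')
      exact not_isRegularSemisimpleElement_so hB hp hq hq''
        (apply_eq_zero_of_eigenvectors hmem (h2μ hμ) hp hp) hpq
        (apply_eq_zero_of_eigenvectors hmem (h2μ (neg_ne_zero.2 hμ)) hq'' hq)
        (by rw [map_smul, smul_eq_mul, inv_mul_cancel₀ hpq']) hq0 hreg

/-- If the component of lowest weight has odd dimension, at least `3`, then `E e ^ N m = 0` for some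
`m ≠ 0`, and `m` lies in the kernel of `(e + E) ^ (N + 1)`, but not in that of `e + E`. -/
theorem so_not_semisimpleType_of_odd (hnd : B.Nondegenerate) (hB : ∀ u v, B u v = B v u)
    (t : IsSl2Triple h e f) (hN : WeightsLE (h : End F V) N) (hN1 : 1 ≤ N)
    (hk : Odd (finrank F (weightSpace (h : End F V) (-N))))
    (hk1 : finrank F (weightSpace (h : End F V) (-N)) ≠ 1) : ¬ IsOfSemisimpleType F h e := by
  have t' := isSl2Triple_coe t
  obtain ⟨hd, hne⟩ := exists_pair_bot t hN hnd hB (by obtain ⟨r, hr⟩ := hk; omega)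
  have hL := skewAdjointLieSubalgebra_detectsSemisimplicity (ε := 1) hnd (by simpa using hB)
    (one_mul 1)
  intro hss
  obtain ⟨E, hE, hP⟩ := exists_of_holdsGenerically hd (by simpa using hne)
    (P := fun E => IsSemisimpleElement F (e + E)) hss
  replace hE : HasDegree (h : End F V) (E : End F V) (-(2 * N)) := by simpa using hE
  obtain ⟨m, hm, hm0, hEm⟩ := t'.exists_bot_apply_eq_zero hN hnd hB h.2 hk hE E.2
  have h1 : (((e : End F V) + E) ^ (N + 1)) m = 0 := by
    rw [t'.cyclic_pow_succ_of_mem_bot hN hE hm, Module.End.mul_apply, hEm]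
  have h2 : ((e : End F V) + E) m = 0 :=
    eq_zero_of_isSemisimple_of_pow_apply ((hL.isSemisimpleElement_iff _).1 hP) h1
  have h3 := t'.cyclic_pow_of_mem_bot hN hE hm hN1
  rw [pow_one, h2, pow_one] at h3
  refine hm0 (t'.eq_zero_of_e_pow hN hm ?_)
  obtain ⟨n, rfl⟩ := Nat.exists_eq_add_of_le' hN1
  rw [pow_succ, Module.End.mul_apply, ← h3, map_zero]

end Orthogonal

/-! ### Orthogonal Lie algebras with a simple top block -/

section SimpleTop

variable {F V : Type*} [Field F] [AddCommGroup V] [Module F V]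

/-- The situation of an orthogonal Lie algebra in which the component of highest weight `n + 2` is a
line and `n + 1` is not a weight: `u` spans the component of lowest weight. -/
structure HasSimpleTop (B : LinearMap.BilinForm F V) (h e f : End F V) (n : ℕ) (u : V) : Prop where
  triple : IsSl2Triple h e f
  nondegenerate : B.Nondegenerate
  symm : ∀ v w, B v w = B w v
  h_mem : h ∈ skewAdjointLieSubalgebra B
  e_mem : e ∈ skewAdjointLieSubalgebra B
  f_mem : f ∈ skewAdjointLieSubalgebra B
  even : Even n
  weightsLE : WeightsLE h (n + 2)
  eq_zero_of_mem : ∀ v ∈ weightSpace h (n + 1), v = 0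
  mem : u ∈ weightSpace h (-(n + 2))
  exists_smul : ∀ v ∈ weightSpace h (-(n + 2)), ∃ c : F, v = c • u
  pairing_ne_zero : B u ((e ^ (n + 2)) u) ≠ 0

variable {B : LinearMap.BilinForm F V} {h e f : End F V} {n : ℕ} {u v w : V} {α : F}

lemma IsSl2Triple.eq_zero_of_pairing [CharZero F] [FiniteDimensional F V] [IsAlgClosed F]
    (t : IsSl2Triple h e f) (hnd : B.Nondegenerate) (hh : h ∈ skewAdjointLieSubalgebra B) {i : ℤ}
    (hv : v ∈ weightSpace h i) (h0 : ∀ w ∈ weightSpace h (-i), B v w = 0) : v = 0 := by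
  refine hnd.1 v fun w => ?_
  induction w using t.weight_induction with
  | h0 => rw [map_zero]
  | hadd u v hu hv => rw [map_add, hu, hv, add_zero]
  | hwt j w hw =>
    by_cases hj : j = -i
    · exact h0 w (hj ▸ hw)
    · exact apply_eq_zero_of_weights hh (by omega) hv hw

variable (B e n u v α) in
/-- The cyclic element attached to `α` and to a vector `v` of weight `-n` orthogonal to the chain of
`u`: its lowest component is `u ∧ (α e u + v)` up to a scalar. -/
noncomputable def simpleCyclic : End F V :=
  e + (B u ((e ^ (n + 2)) u))⁻¹ • wedge B 1 u (α • e u + v)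

variable (B e n u v) in
/-- The value at `v` of the normalized quadratic form `-B(v, e ^ n v)`. -/
noncomputable def simpleForm : F := -((B u ((e ^ (n + 2)) u))⁻¹ * B v ((e ^ n) v))

namespace HasSimpleTop

lemma e_pow_mem (S : HasSimpleTop B h e f n u) (j : ℕ) :
    (e ^ j) u ∈ weightSpace h (-(n + 2) + 2 * j) := S.triple.e_pow_mem S.mem j

lemma e_apply_mem (S : HasSimpleTop B h e f n u) : e u ∈ weightSpace h (-n) := by
  have := S.e_pow_mem 1
  rwa [pow_one, show -((n : ℤ) + 2) + 2 * ((1 : ℕ) : ℤ) = -n by push_cast; ring] at this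

lemma e_pow_eq_zero (S : HasSimpleTop B h e f n u) {i : ℤ} (hv : v ∈ weightSpace h i) {j : ℕ}
    (hij : n + 2 < i + 2 * j) : (e ^ j) v = 0 :=
  S.triple.e_pow_eq_zero S.weightsLE hv (by push_cast; exact hij)

variable [CharZero F]

lemma pairing_e_pow (S : HasSimpleTop B h e f n u) {i : ℤ} (hv : v ∈ weightSpace h i) {j : ℕ}
    (hij : i + 2 * j ≠ n + 2) : B u ((e ^ j) v) = 0 :=
  apply_eq_zero_of_weights S.h_mem (by omega) S.mem (S.triple.e_pow_mem hv j)

lemma pairing_e_pow_self (S : HasSimpleTop B h e f n u) {j : ℕ} (hj : j ≠ n + 2) :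
    B u ((e ^ j) u) = 0 := S.pairing_e_pow S.mem (by omega)

omit [CharZero F] in
lemma pairing_e_apply (S : HasSimpleTop B h e f n u) :
    B (e u) ((e ^ (n + 1)) u) = -B u ((e ^ (n + 2)) u) := by
  rw [mem_skewAdjointLieSubalgebra.1 S.e_mem, ← Module.End.mul_apply, ← pow_succ']

lemma pairing_add (S : HasSimpleTop B h e f n u) (hv : v ∈ weightSpace h (-n))
    (hvu : B v ((e ^ (n + 1)) u) = 0) (j : ℕ) :
    B (α • e u + v) ((e ^ j) u) =
      if j = n + 1 then -(α * B u ((e ^ (n + 2)) u)) else 0 := by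
  rw [map_add, map_smul, LinearMap.add_apply, LinearMap.smul_apply, smul_eq_mul]
  split_ifs with hj
  · rw [hj, S.pairing_e_apply, hvu]
    ring
  · rw [apply_eq_zero_of_weights S.h_mem (by omega) S.e_apply_mem (S.e_pow_mem j),
      apply_eq_zero_of_weights S.h_mem (by omega) hv (S.e_pow_mem j)]
    ring

omit [CharZero F] in
lemma simpleCyclic_apply (y : V) : simpleCyclic B e n u v α y =
    e y + (B u ((e ^ (n + 2)) u))⁻¹ • (B u y • (α • e u + v) - B (α • e u + v) y • u) := by
  rw [simpleCyclic, LinearMap.add_apply, LinearMap.smul_apply, wedge_apply, one_mul]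

lemma simpleCyclic_e_pow (S : HasSimpleTop B h e f n u) (hv : v ∈ weightSpace h (-n))
    (hvu : B v ((e ^ (n + 1)) u) = 0) {j : ℕ} (hj : j ≤ n) :
    simpleCyclic B e n u v α ((e ^ j) u) = (e ^ (j + 1)) u := by
  rw [simpleCyclic_apply, S.pairing_e_pow_self (j := j) (by omega), S.pairing_add hv hvu,
    if_neg (by omega), ← Module.End.mul_apply e, ← pow_succ']
  simp

lemma simpleCyclic_pow (S : HasSimpleTop B h e f n u) (hv : v ∈ weightSpace h (-n))
    (hvu : B v ((e ^ (n + 1)) u) = 0) {j : ℕ} (hj : j ≤ n + 1) :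
    (simpleCyclic B e n u v α ^ j) u = (e ^ j) u := by
  induction j with
  | zero => simp
  | succ j ih =>
    rw [pow_succ', Module.End.mul_apply, ih (by omega), S.simpleCyclic_e_pow hv hvu (by omega)]

lemma simpleCyclic_pow_top (S : HasSimpleTop B h e f n u) (hv : v ∈ weightSpace h (-n))
    (hvu : B v ((e ^ (n + 1)) u) = 0) :
    (simpleCyclic B e n u v α ^ (n + 2)) u = (e ^ (n + 2)) u + α • u := by
  rw [pow_succ', Module.End.mul_apply, S.simpleCyclic_pow hv hvu le_rfl, simpleCyclic_apply,
    S.pairing_e_pow_self (j := n + 1) (by omega), S.pairing_add hv hvu, if_pos rfl,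
    ← Module.End.mul_apply e, ← pow_succ', zero_smul, zero_sub, neg_smul, neg_neg, smul_smul,
    mul_comm α, ← mul_assoc, inv_mul_cancel₀ S.pairing_ne_zero, one_mul]

lemma simpleCyclic_pow_succ_top (S : HasSimpleTop B h e f n u) (hv : v ∈ weightSpace h (-n))
    (hvu : B v ((e ^ (n + 1)) u) = 0) :
    (simpleCyclic B e n u v α ^ (n + 3)) u = (2 * α) • e u + v := by
  have h0 := S.simpleCyclic_pow (α := α) hv hvu (j := 1) (by omega)
  rw [pow_one, pow_one] at h0
  have h1 : e ((e ^ (n + 2)) u) = 0 := by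
    have := S.e_pow_eq_zero S.mem (j := n + 3) (by push_cast; omega)
    rwa [pow_succ', Module.End.mul_apply] at this
  rw [pow_succ', Module.End.mul_apply, S.simpleCyclic_pow_top hv hvu, map_add, map_smul, h0,
    simpleCyclic_apply, h1, S.pairing_add hv hvu, if_neg (by omega), zero_smul, sub_zero, smul_smul,
    inv_mul_cancel₀ S.pairing_ne_zero]
  module

lemma e_pow_succ_eq_zero [FiniteDimensional F V] [IsAlgClosed F] (S : HasSimpleTop B h e f n u)
    (hv : v ∈ weightSpace h (-n)) (hvu : B v ((e ^ (n + 1)) u) = 0) : (e ^ (n + 1)) v = 0 := by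
  refine S.triple.eq_zero_of_pairing S.nondegenerate S.h_mem (S.triple.e_pow_mem hv (n + 1))
    fun w hw => ?_
  obtain ⟨c, rfl⟩ := S.exists_smul w (by
    rwa [show -(-(n : ℤ) + 2 * ((n + 1 : ℕ) : ℤ)) = -(n + 2) by push_cast; ring] at hw)
  rw [map_smul, skew_pow_apply S.e_mem, hvu, mul_zero, smul_zero]

variable [FiniteDimensional F V] [IsAlgClosed F]

lemma pairing_e_pow_eq_zero (S : HasSimpleTop B h e f n u) (hv : v ∈ weightSpace h (-n))
    (hvu : B v ((e ^ (n + 1)) u) = 0) (j : ℕ) : B u ((e ^ j) v) = 0 := by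
  by_cases hj : j = n + 1
  · rw [hj, S.e_pow_succ_eq_zero hv hvu, map_zero]
  · exact S.pairing_e_pow hv (by omega)

lemma pairing_add_e_pow (S : HasSimpleTop B h e f n u) (hv : v ∈ weightSpace h (-n))
    (hvu : B v ((e ^ (n + 1)) u) = 0) (j : ℕ) :
    B (α • e u + v) ((e ^ j) v) = if j = n then B v ((e ^ n) v) else 0 := by
  have h1 : B (e u) ((e ^ j) v) = 0 := by
    rw [mem_skewAdjointLieSubalgebra.1 S.e_mem, ← Module.End.mul_apply, ← pow_succ',
      S.pairing_e_pow_eq_zero hv hvu, neg_zero]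
  rw [map_add, map_smul, LinearMap.add_apply, LinearMap.smul_apply, h1, smul_zero, zero_add]
  split_ifs with hj
  · rw [hj]
  · exact apply_eq_zero_of_weights S.h_mem (by omega) hv (S.triple.e_pow_mem hv j)

lemma simpleCyclic_pow_orthogonal (S : HasSimpleTop B h e f n u) (hv : v ∈ weightSpace h (-n))
    (hvu : B v ((e ^ (n + 1)) u) = 0) {j : ℕ} (hj : j ≤ n) :
    (simpleCyclic B e n u v α ^ j) v = (e ^ j) v := by
  induction j with
  | zero => simp
  | succ j ih =>
    rw [pow_succ', Module.End.mul_apply, ih (by omega), simpleCyclic_apply,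
      S.pairing_e_pow_eq_zero hv hvu, S.pairing_add_e_pow hv hvu, if_neg (by omega),
      ← Module.End.mul_apply e, ← pow_succ']
    simp

lemma simpleCyclic_pow_succ_orthogonal (S : HasSimpleTop B h e f n u)
    (hv : v ∈ weightSpace h (-n)) (hvu : B v ((e ^ (n + 1)) u) = 0) :
    (simpleCyclic B e n u v α ^ (n + 1)) v = simpleForm B e n u v • u := by
  have h1 := S.e_pow_succ_eq_zero hv hvu
  rw [pow_succ', Module.End.mul_apply] at h1
  rw [pow_succ', Module.End.mul_apply, S.simpleCyclic_pow_orthogonal hv hvu le_rfl,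
    simpleCyclic_apply, S.pairing_e_pow_eq_zero hv hvu, S.pairing_add_e_pow hv hvu, if_pos rfl, h1,
    simpleForm]
  module

/-- The relation satisfied by a cyclic element on the subspace generated by `u`. -/
lemma simpleCyclic_pow_two_mul (S : HasSimpleTop B h e f n u) (hv : v ∈ weightSpace h (-n))
    (hvu : B v ((e ^ (n + 1)) u) = 0) :
    (simpleCyclic B e n u v α ^ (2 * (n + 2))) u =
      (2 * α) • (simpleCyclic B e n u v α ^ (n + 2)) u + simpleForm B e n u v • u := by
  have h0 := S.simpleCyclic_pow (α := α) hv hvu (j := 1) (by omega)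
  rw [pow_one, pow_one] at h0
  rw [show 2 * (n + 2) = (n + 1) + (n + 3) by ring, pow_add, Module.End.mul_apply,
    S.simpleCyclic_pow_succ_top hv hvu, map_add, map_smul, S.simpleCyclic_pow_succ_orthogonal hv hvu,
    ← h0, ← Module.End.mul_apply, ← pow_succ]

omit [CharZero F] [FiniteDimensional F V] [IsAlgClosed F] in
/-- Every vector of weight `-n` decomposes along the chain of `u` and its orthogonal complement. -/
lemma exists_decomposition (S : HasSimpleTop B h e f n u) (hw : w ∈ weightSpace h (-n)) :
    w + ((B u ((e ^ (n + 2)) u))⁻¹ * B w ((e ^ (n + 1)) u)) • e u ∈ weightSpace h (-n) ∧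
      B (w + ((B u ((e ^ (n + 2)) u))⁻¹ * B w ((e ^ (n + 1)) u)) • e u) ((e ^ (n + 1)) u) = 0 := by
  refine ⟨add_mem hw (Submodule.smul_mem _ _ S.e_apply_mem), ?_⟩
  rw [map_add, map_smul, LinearMap.add_apply, LinearMap.smul_apply, S.pairing_e_apply, smul_eq_mul]
  have := S.pairing_ne_zero
  field_simp
  ring

/-- The elements of degree `-(2n + 2)` are the operators `u ∧ w` with `w` of weight `-n`. -/
lemma eq_wedge (S : HasSimpleTop B h e f n u) {E : End F V} (hE : HasDegree h E (-(2 * n + 2)))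
    (hEB : E ∈ skewAdjointLieSubalgebra B) :
    E = (B u ((e ^ (n + 2)) u))⁻¹ • wedge B 1 u (E ((e ^ (n + 2)) u)) := by
  have hT : (e ^ (n + 2)) u ∈ weightSpace h (n + 2) := by
    have := S.e_pow_mem (n + 2)
    rwa [show -((n : ℤ) + 2) + 2 * ((n + 2 : ℕ) : ℤ) = n + 2 by push_cast; ring] at this
  have hw : E ((e ^ (n + 2)) u) ∈ weightSpace h (-n) := by
    have := hE.apply_mem hT
    rwa [show (n : ℤ) + 2 + -(2 * n + 2) = -n by ring] at this
  ext y
  rw [LinearMap.smul_apply, wedge_apply, one_mul]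
  induction y using S.triple.weight_induction with
  | h0 => simp
  | hadd y z hy hz => rw [map_add, hy, hz, map_add, map_add]; module
  | hwt i y hy =>
    by_cases hi : (n + 2 : ℤ) < |i|
    · rw [S.weightsLE i y hy (by push_cast; exact hi)]
      simp
    rw [not_lt, abs_le] at hi
    by_cases hi1 : i = n + 2
    · subst hi1
      have h1 := S.triple.e_pow_f_pow_of_mem_top S.weightsLE (a := y) (by push_cast; exact hy)
      have h2 : (f ^ (n + 2)) y ∈ weightSpace h (-(n + 2)) := by
        have := S.triple.f_pow_mem hy (n + 2)
        rwa [show (n : ℤ) + 2 - 2 * ((n + 2 : ℕ) : ℤ) = -(n + 2) by push_cast; ring] at this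
      obtain ⟨c, hc⟩ := S.exists_smul _ h2
      have h3 : y = ((topScalar F (n + 2))⁻¹ * c) • (e ^ (n + 2)) u := by
        rw [← smul_smul, ← map_smul, ← hc, h1, smul_smul, inv_mul_cancel₀ (topScalar_ne_zero _),
          one_smul]
      rw [apply_eq_zero_of_weights S.h_mem (by omega) hw hy, h3]
      simp only [map_smul, smul_eq_mul]
      rw [zero_smul, sub_zero, smul_smul, mul_comm _ (B u _), ← mul_assoc,
        inv_mul_cancel₀ S.pairing_ne_zero, one_mul]
    rw [apply_eq_zero_of_weights S.h_mem (by omega) S.mem hy, zero_smul, zero_sub]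
    by_cases hi2 : i = n
    · subst hi2
      have h1 := hE.apply_mem hy
      rw [show (n : ℤ) + -(2 * n + 2) = -(n + 2) by ring] at h1
      obtain ⟨c, hc⟩ := S.exists_smul _ h1
      have h2 := mem_skewAdjointLieSubalgebra.1 hEB y ((e ^ (n + 2)) u)
      rw [hc, map_smul, LinearMap.smul_apply, smul_eq_mul, S.symm y] at h2
      rw [hc, ← neg_smul, smul_smul, ← h2]
      have := S.pairing_ne_zero
      congr 1
      field_simp
    · rw [apply_eq_zero_of_weights S.h_mem (by omega) hw hy, zero_smul, neg_zero, smul_zero]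
      by_cases hi3 : i = n + 1
      · subst hi3
        rw [S.eq_zero_of_mem y hy, map_zero]
      · refine S.weightsLE.eq_zero_of_hasDegree hE hy ?_
        rw [abs_of_neg (by omega)]
        push_cast
        omega

/-- All cyclic elements are of the form `simpleCyclic`. -/
lemma add_eq_simpleCyclic (S : HasSimpleTop B h e f n u) {E : End F V}
    (hE : HasDegree h E (-(2 * n + 2))) (hEB : E ∈ skewAdjointLieSubalgebra B) :
    ∃ (α : F) (v : V), v ∈ weightSpace h (-n) ∧ B v ((e ^ (n + 1)) u) = 0 ∧
      E ((e ^ (n + 2)) u) = α • e u + v ∧ e + E = simpleCyclic B e n u v α := by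
  have hw : E ((e ^ (n + 2)) u) ∈ weightSpace h (-n) := by
    have := hE.apply_mem (S.e_pow_mem (n + 2))
    rwa [show -((n : ℤ) + 2) + 2 * ((n + 2 : ℕ) : ℤ) + -(2 * n + 2) = -n by
      push_cast; ring] at this
  obtain ⟨h1, h2⟩ := S.exists_decomposition hw
  have h3 : E ((e ^ (n + 2)) u) =
      (-((B u ((e ^ (n + 2)) u))⁻¹ * B (E ((e ^ (n + 2)) u)) ((e ^ (n + 1)) u))) • e u +
      (E ((e ^ (n + 2)) u) +
        ((B u ((e ^ (n + 2)) u))⁻¹ * B (E ((e ^ (n + 2)) u)) ((e ^ (n + 1)) u)) • e u) := by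
    module
  refine ⟨_, _, h1, h2, h3, ?_⟩
  rw [simpleCyclic, ← h3, ← S.eq_wedge hE hEB]

end HasSimpleTop

end SimpleTop

/-! ### Simple top block: the spectrum on one chain -/

section SimpleTopSpectrum

variable {F V : Type*} [Field F] [AddCommGroup V] [Module F V]
  {B : LinearMap.BilinForm F V} {h e f : End F V} {n : ℕ} {u v w : V} {α : F}

lemma aeval_apply_of_mem_span_pow {x : End F V} {p : F[X]} {u : V} (hp : aeval x p u = 0) {y : V}
    (hy : y ∈ Submodule.span F (Set.range fun i : ℕ => (x ^ i) u)) : aeval x p y = 0 := by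
  have : Submodule.span F (Set.range fun i : ℕ => (x ^ i) u) ≤ LinearMap.ker (aeval x p) := by
    rw [Submodule.span_le]
    rintro _ ⟨i, rfl⟩
    have hcomm : Commute (aeval x p) (x ^ i) := by
      have := Commute.all p (X ^ i)
      simpa using this.map (aeval x)
    rw [SetLike.mem_coe, LinearMap.mem_ker, ← Module.End.mul_apply, hcomm.eq, Module.End.mul_apply,
      hp, map_zero]
  exact this hy

lemma apply_eq_zero_of_isSemisimple_of_eqOn [FiniteDimensional F V] {x : End F V}
    (hx : x.IsSemisimple) (he : IsNilpotent e) {K : Submodule F V} (heK : ∀ v ∈ K, e v ∈ K)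
    (hxK : ∀ v ∈ K, x v = e v) {v : V} (hv : v ∈ K) : e v = 0 := by
  obtain ⟨k, hk⟩ := he
  have hpow : ∀ j : ℕ, ∀ v ∈ K, (x ^ j) v = (e ^ j) v := by
    intro j
    induction j with
    | zero => simp
    | succ j ih =>
      intro v hv
      rw [pow_succ, pow_succ, Module.End.mul_apply, Module.End.mul_apply, hxK v hv,
        ih _ (heK v hv)]
  rw [← hxK v hv]
  exact eq_zero_of_isSemisimple_of_pow_apply hx (k := k) (by rw [hpow k v hv, hk]; simp)

variable [CharZero F] [FiniteDimensional F V] [IsAlgClosed F]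

namespace HasSimpleTop

section Span

variable (S : HasSimpleTop B h e f n u) (hv : v ∈ weightSpace h (-n))
  (hvu : B v ((e ^ (n + 1)) u) = 0)
include S hv hvu

omit [FiniteDimensional F V] [IsAlgClosed F] in
lemma e_pow_mem_span (j : ℕ) : (e ^ j) u ∈
    Submodule.span F (Set.range fun i : ℕ => (simpleCyclic B e n u v α ^ i) u) := by
  have hmem : ∀ i : ℕ, (simpleCyclic B e n u v α ^ i) u ∈
      Submodule.span F (Set.range fun i : ℕ => (simpleCyclic B e n u v α ^ i) u) :=
    fun i => Submodule.subset_span ⟨i, rfl⟩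
  rcases lt_trichotomy j (n + 2) with hj | rfl | hj
  · rw [← S.simpleCyclic_pow (α := α) hv hvu (by omega : j ≤ n + 1)]
    exact hmem j
  · rw [← add_sub_cancel_right ((e ^ (n + 2)) u) (α • u), ← S.simpleCyclic_pow_top hv hvu]
    exact sub_mem (hmem _) (Submodule.smul_mem _ _ (hmem 0))
  · rw [S.e_pow_eq_zero S.mem (by omega)]
    exact zero_mem _

lemma e_pow_mem_span_orthogonal (j : ℕ) : (e ^ j) v ∈
    Submodule.span F (Set.range fun i : ℕ => (simpleCyclic B e n u v α ^ i) u) := by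
  have hmem : ∀ i : ℕ, (simpleCyclic B e n u v α ^ i) u ∈
      Submodule.span F (Set.range fun i : ℕ => (simpleCyclic B e n u v α ^ i) u) :=
    fun i => Submodule.subset_span ⟨i, rfl⟩
  rcases le_or_gt j n with hj | hj
  · have h1 := S.simpleCyclic_pow_succ_top (α := α) hv hvu
    have h2 := S.simpleCyclic_pow (α := α) hv hvu (j := 1) (by omega)
    rw [pow_one, pow_one] at h2
    have h3 : (e ^ j) v = (simpleCyclic B e n u v α ^ (j + (n + 3))) u -
        (2 * α) • (simpleCyclic B e n u v α ^ (j + 1)) u := by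
      rw [pow_add, Module.End.mul_apply, h1, map_add, map_smul, pow_succ, Module.End.mul_apply, h2,
        S.simpleCyclic_pow_orthogonal hv hvu hj, add_sub_cancel_left]
    rw [h3]
    exact sub_mem (hmem _) (Submodule.smul_mem _ _ (hmem _))
  · obtain ⟨i, rfl⟩ := Nat.exists_eq_add_of_lt hj
    rw [show n + i + 1 = i + (n + 1) by ring, pow_add, Module.End.mul_apply,
      S.e_pow_succ_eq_zero hv hvu, map_zero]
    exact zero_mem _

end Span

section NoOrthogonal

/-- `core` is orthogonal to the line of lowest weight: the operator `u · u` of degree `-2(n + 2)`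
vanishes on it. It is not skew-adjoint for `B`, which does not matter here. -/
lemma pairing_core (S : HasSimpleTop B h e f n u) (hv : v ∈ core e f (n + 2)) : B u v = 0 := by
  have hdeg : HasDegree h (wedge B (-1) u u) (-(2 * (n + 2 : ℕ))) := by
    have := hasDegree_wedge (ε := -1) S.h_mem S.mem S.mem
    rwa [show -((n : ℤ) + 2) + -((n : ℤ) + 2) = -(2 * ((n + 2 : ℕ) : ℤ)) by push_cast; ring] at this
  have hfv : (f ^ (n + 2)) v = 0 := by simpa using mem_core.1 hv 0
  have h1 := S.triple.apply_eq_zero_of_f_pow S.weightsLE hdeg hfv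
  have hu : u ≠ 0 := by
    rintro rfl
    exact S.pairing_ne_zero (by simp)
  rw [wedge_apply] at h1
  have h2 : (2 * B u v) • u = 0 := by rw [← h1]; module
  exact (mul_eq_zero.1 ((smul_eq_zero.1 h2).resolve_right hu)).resolve_left two_ne_zero

lemma simpleCyclic_apply_of_mem_core (S : HasSimpleTop B h e f n u) (hv : v ∈ core e f (n + 2)) :
    simpleCyclic B e n u 0 α v = e v := by
  rw [simpleCyclic_apply, S.pairing_core hv, add_zero, map_smul, LinearMap.smul_apply,
    mem_skewAdjointLieSubalgebra.1 S.e_mem, S.pairing_core (e_mem_core hv)]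
  simp

/-- The case `v = 0`, in which a cyclic element is the nilpotent operator `e` on `core`. -/
lemma core_le_ker (S : HasSimpleTop B h e f n u)
    (hss : (simpleCyclic B e n u 0 α).IsSemisimple) : ∀ v ∈ core e f (n + 2), e v = 0 :=
  fun _ hv => apply_eq_zero_of_isSemisimple_of_eqOn hss
    (S.triple.hasDegree_e.isNilpotent (by norm_num)) (fun _ => e_mem_core)
    (fun _ => S.simpleCyclic_apply_of_mem_core) hv

/-- The polynomial `X (X ^ (n + 2) - 2α)` annihilates the cyclic element. -/
lemma natDegree_minpoly_le_of_core (S : HasSimpleTop B h e f n u)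
    (hcore : ∀ v ∈ core e f (n + 2), e v = 0) :
    (minpoly F (simpleCyclic B e n u 0 α)).natDegree ≤ n + 3 := by
  set x := simpleCyclic B e n u 0 α with hx
  set p : F[X] := X * expand F (n + 2) (X - C (2 * α)) with hp
  have hexp : expand F (n + 2) (X - C (2 * α)) ≠ 0 :=
    (expand_ne_zero (by omega)).2 (X_sub_C_ne_zero _)
  have hp0 : p ≠ 0 := mul_ne_zero X_ne_zero hexp
  have h0v : (0 : V) ∈ weightSpace h (-n) := zero_mem _
  have h0u : B (0 : V) ((e ^ (n + 1)) u) = 0 := by simp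
  have hpapply : ∀ y, aeval x p y = (x ^ (n + 2)) (x y) - (2 * α) • x y := by
    intro y
    rw [hp, mul_comm, map_mul, aeval_X, Module.End.mul_apply, expand_aeval, map_sub, aeval_X,
      aeval_C, LinearMap.sub_apply, Module.algebraMap_end_apply]
  have hpu : aeval x p u = 0 := by
    have h1 := S.simpleCyclic_pow (α := α) h0v h0u (j := 1) (by omega)
    rw [pow_one, pow_one] at h1
    rw [hpapply, ← Module.End.mul_apply, ← pow_succ, S.simpleCyclic_pow_succ_top h0v h0u, h1,
      add_zero, sub_self]
  refine (natDegree_minpoly_le hp0 ?_).trans ?_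
  · rw [← LinearMap.ker_eq_top, eq_top_iff,
      ← (S.triple.isCompl_core S.weightsLE).sup_eq_top]
    refine sup_le ?_ fun y hy => ?_
    · rw [Submodule.span_le]
      rintro _ ⟨i, rfl⟩
      obtain ⟨c, hc⟩ := S.exists_smul (finBasis F (weightSpace h (-(n + 2 : ℕ))) i.1) (by
        rw [show -((n : ℤ) + 2) = -((n + 2 : ℕ) : ℤ) by push_cast; ring]
        exact (finBasis F (weightSpace h (-(n + 2 : ℕ))) i.1).2)
      rw [SetLike.mem_coe, LinearMap.mem_ker, bottomChains, hc, map_smul, map_smul,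
        aeval_apply_of_mem_span_pow hpu (S.e_pow_mem_span h0v h0u _), smul_zero]
    · rw [LinearMap.mem_ker, hpapply, hx, S.simpleCyclic_apply_of_mem_core hy, hcore y hy,
        map_zero, smul_zero, sub_zero]
  · rw [hp, natDegree_mul X_ne_zero hexp, natDegree_expand, natDegree_X_sub_C, natDegree_X]
    omega

/-- A vector in the kernel of the cyclic element that does not belong to `core`. -/
lemma simpleCyclic_kernel (S : HasSimpleTop B h e f n u) :
    simpleCyclic B e n u 0 α ((e ^ (n + 2)) u - α • u) = 0 ∧
      (e ^ (n + 2)) u - α • u ∉ core e f (n + 2) := by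
  have h0v : (0 : V) ∈ weightSpace h (-n) := zero_mem _
  have h0u : B (0 : V) ((e ^ (n + 1)) u) = 0 := by simp
  constructor
  · have h1 := S.simpleCyclic_pow (α := α) h0v h0u (j := 1) (by omega)
    rw [pow_one, pow_one] at h1
    have h2 := S.simpleCyclic_pow_succ_top (α := α) h0v h0u
    rw [pow_succ', Module.End.mul_apply, S.simpleCyclic_pow_top h0v h0u, map_add, map_smul, h1,
      add_zero] at h2
    rw [map_sub, map_smul, h1, eq_sub_of_add_eq h2]
    module
  · intro hmem
    have h1 := S.pairing_core hmem
    have h2 := S.pairing_e_pow_self (j := 0) (by omega)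
    rw [pow_zero, Module.End.one_apply] at h2
    rw [map_sub, map_smul, h2, smul_zero, sub_zero] at h1
    exact S.pairing_ne_zero h1

/-- For `α = 1` the eigenvalues are `0` and the roots of `X ^ (n + 2) = 2`. -/
lemma exists_finset_eigenvalues_simple (S : HasSimpleTop B h e f n u) :
    ∃ Z : Finset F, n + 3 ≤ Z.card ∧
      ∀ ζ ∈ Z, (simpleCyclic B e n u 0 1).HasEigenvalue ζ := by
  classical
  have h0v : (0 : V) ∈ weightSpace h (-n) := zero_mem _
  have h0u : B (0 : V) ((e ^ (n + 1)) u) = 0 := by simp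
  obtain ⟨Z, hZcard, hZ, hZ0⟩ := exists_finset_roots (n := n + 2) (by omega) {(2 : F)}
    (by simp)
  refine ⟨insert 0 Z, by rw [Finset.card_insert_of_notMem hZ0, hZcard]; simp, ?_⟩
  intro ζ hζ
  rcases Finset.mem_insert.1 hζ with rfl | hζ
  · obtain ⟨h1, h2⟩ := S.simpleCyclic_kernel (α := 1)
    refine Module.End.hasEigenvalue_of_hasEigenvector (x := (e ^ (n + 2)) u - (1 : F) • u)
      ⟨Module.End.mem_eigenspace_iff.2 (by rw [h1, zero_smul]), ?_⟩
    intro h3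
    rw [h3] at h2
    exact h2 (zero_mem _)
  · have h1 := S.simpleCyclic_pow (α := 1) h0v h0u (j := 1) (by omega)
    rw [pow_one, pow_one] at h1
    -- the linear form `B (e ^ (n + 1) u)` separates `e u` from the other powers, by weight
    refine hasEigenvalue_of_pow_apply (n := n + 2) (by omega) (fun h => hZ0 (h ▸ hζ)) (u := e u) ?_
      (B ((e ^ (n + 1)) u)) ?_ fun i hi0 hi => ?_
    · rw [Finset.mem_singleton.1 (hZ ζ hζ), ← h1, ← Module.End.mul_apply, ← pow_succ,
        S.simpleCyclic_pow_succ_top h0v h0u, h1]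
      module
    · rw [S.symm, S.pairing_e_apply]
      exact neg_ne_zero.2 S.pairing_ne_zero
    · have h2 : ∀ j, j ≠ 1 → B ((e ^ (n + 1)) u) ((e ^ j) u) = 0 := fun j hj =>
        apply_eq_zero_of_weights S.h_mem (by push_cast; omega) (S.e_pow_mem _) (S.e_pow_mem j)
      rw [← h1, ← Module.End.mul_apply, ← pow_succ]
      rcases Nat.lt_or_ge i (n + 1) with h3 | h3
      · rw [S.simpleCyclic_pow h0v h0u (by omega), h2 _ (by omega)]
      · obtain rfl : i = n + 1 := by omega
        have h4 := h2 0 (by omega)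
        rw [pow_zero, Module.End.one_apply] at h4
        rw [S.simpleCyclic_pow_top h0v h0u, map_add, map_smul, h2 _ (by omega), h4]
        simp

end NoOrthogonal

end HasSimpleTop

end SimpleTopSpectrum

/-! ### Simple top block: the spectrum on two chains -/

section DoubleChain

variable {F V : Type*} [Field F] [AddCommGroup V] [Module F V]
  {B : LinearMap.BilinForm F V} {h e f : End F V} {n : ℕ} {u v w : V} {α : F}

variable (e n u v) in
/-- The two chains, of lengths `n + 3` and `n + 1`, generated by `u` and `v`. -/
noncomputable def doubleChain : (Σ i : Fin 2, Fin ((![n + 3, n + 1] : Fin 2 → ℕ) i)) → V :=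
  fun x => (e ^ (x.2 : ℕ)) ((![u, v] : Fin 2 → V) x.1)

variable (e n u v) in
/-- The subspace spanned by the chains of `u` and `v`. -/
noncomputable def doubleSpan : Submodule F V := Submodule.span F (Set.range (doubleChain e n u v))

namespace HasSimpleTop

variable [CharZero F] [FiniteDimensional F V] [IsAlgClosed F]

lemma isChainFamily_doubleChain (S : HasSimpleTop B h e f n u) (hv : v ∈ weightSpace h (-n))
    (hvu : B v ((e ^ (n + 1)) u) = 0) :
    IsChainFamily e ![n + 3, n + 1] (doubleChain e n u v) := by
  intro i j
  have hpow : e (doubleChain e n u v ⟨i, j⟩) = (e ^ ((j : ℕ) + 1)) ((![u, v] : Fin 2 → V) i) := by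
    rw [doubleChain, pow_succ', Module.End.mul_apply]
  rw [hpow]
  split_ifs with hj
  · rfl
  · have hj' := j.2
    fin_cases i
    · have hj0 : (j : ℕ) + 1 = n + 3 := by simp at hj hj'; omega
      rw [hj0]
      exact S.e_pow_eq_zero S.mem (by push_cast; omega)
    · have hj0 : (j : ℕ) + 1 = n + 1 := by simp at hj hj'; omega
      rw [hj0]
      exact S.e_pow_succ_eq_zero hv hvu

omit [CharZero F] [FiniteDimensional F V] [IsAlgClosed F] in
lemma mem_weight_top (S : HasSimpleTop B h e f n u) : (e ^ (n + 2)) u ∈ weightSpace h (n + 2) := by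
  have := S.e_pow_mem (n + 2)
  rwa [show -((n : ℤ) + 2) + 2 * ((n + 2 : ℕ) : ℤ) = n + 2 by push_cast; ring] at this

section

variable (S : HasSimpleTop B h e f n u) (hv : v ∈ weightSpace h (-n))
  (hvu : B v ((e ^ (n + 1)) u) = 0) (hform : B v ((e ^ n) v) ≠ 0)
include S hv hvu hform

lemma eq_zero_of_pairings {a b : F}
    (h1 : B u (a • (e ^ (n + 2)) u + b • (e ^ n) v) = 0)
    (h2 : B v (a • (e ^ (n + 2)) u + b • (e ^ n) v) = 0) : a = 0 ∧ b = 0 := by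
  rw [map_add, map_smul, map_smul, S.pairing_e_pow_eq_zero hv hvu, smul_zero, add_zero] at h1
  have ha := (smul_eq_zero.1 h1).resolve_right S.pairing_ne_zero
  rw [ha, zero_smul, zero_add, map_smul] at h2
  exact ⟨ha, (smul_eq_zero.1 h2).resolve_right hform⟩

lemma linearIndependent_doubleChain : LinearIndependent F (doubleChain e n u v) := by
  refine (S.isChainFamily_doubleChain hv hvu).linearIndependent
    (fun i => by fin_cases i <;> simp) ?_
  have htop : LinearIndependent F ![(e ^ (n + 2)) u, (e ^ n) v] := by
    rw [LinearIndependent.pair_iff]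
    intro a b hab
    exact S.eq_zero_of_pairings hv hvu hform (by rw [hab, map_zero]) (by rw [hab, map_zero])
  convert htop using 1
  funext i
  fin_cases i <;> simp [doubleChain]

/-- The form `B` is non-degenerate on the span of the two chains: a vector of the radical would
yield one that is killed by `e`, i.e. a combination of the last vectors `e ^ (n + 2) u` and `e ^ n
v`, and these are paired with `u` and `v`. -/
lemma isCompl_doubleSpan : IsCompl (doubleSpan e n u v) (B.orthogonal (doubleSpan e n u v)) := by
  rw [LinearMap.BilinForm.isCompl_orthogonal_iff_disjoint
    (fun x y hxy => (S.symm y x).trans hxy), Submodule.disjoint_def]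
  have hch := S.isChainFamily_doubleChain hv hvu
  have hu : u ∈ doubleSpan e n u v :=
    Submodule.subset_span ⟨⟨0, ⟨0, by simp⟩⟩, by simp [doubleChain]⟩
  have hvm : v ∈ doubleSpan e n u v :=
    Submodule.subset_span ⟨⟨1, ⟨0, by simp⟩⟩, by simp [doubleChain]⟩
  have hstep : ∀ z ∈ doubleSpan e n u v, e z ∈ doubleSpan e n u v := fun z hz => by
    have := hch.map_le 1
    rw [pow_one] at this
    exact this ⟨z, hz, rfl⟩
  have hker : ∀ y ∈ doubleSpan e n u v, (∀ z ∈ doubleSpan e n u v, B z y = 0) →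
      e y = 0 → y = 0 := by
    intro y hy hy' hey
    have h1 := hch.mem_span_of_apply_eq_zero (S.linearIndependent_doubleChain hv hvu hform) hy hey
    have h2 : y ∈ Submodule.span F {(e ^ (n + 2)) u, (e ^ n) v} := by
      refine Submodule.span_mono ?_ h1
      rintro _ ⟨⟨i, j⟩, hj, rfl⟩
      fin_cases i
      · have hj0 : (j : ℕ) = n + 2 := by simpa using hj
        left
        simp [doubleChain, hj0]
      · have hj0 : (j : ℕ) = n := by simpa using hj
        right
        simp [doubleChain, hj0]
    obtain ⟨a, b, rfl⟩ := Submodule.mem_span_pair.1 h2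
    obtain ⟨rfl, rfl⟩ := S.eq_zero_of_pairings hv hvu hform (hy' u hu) (hy' v hvm)
    simp
  obtain ⟨k, hk⟩ := S.triple.hasDegree_e.isNilpotent (by norm_num)
  have hall : ∀ k : ℕ, ∀ y ∈ doubleSpan e n u v, (∀ z ∈ doubleSpan e n u v, B z y = 0) →
      (e ^ k) y = 0 → y = 0 := by
    intro k
    induction k with
    | zero => intro y _ _ h0; simpa using h0
    | succ k ih =>
      intro y hy hy' h0
      refine hker y hy hy' (ih _ (hstep y hy) (fun z hz => ?_) ?_)
      · have h3 := mem_skewAdjointLieSubalgebra.1 S.e_mem z y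
        rw [hy' _ (hstep z hz)] at h3
        exact neg_eq_zero.1 h3.symm
      · rwa [← Module.End.mul_apply, ← pow_succ]
  intro y hy hy'
  exact hall k y hy (fun z hz => hy' z hz) (by rw [hk, LinearMap.zero_apply])

omit hform in
lemma e_mem_orthogonal {y : V} (hy : y ∈ B.orthogonal (doubleSpan e n u v)) :
    e y ∈ B.orthogonal (doubleSpan e n u v) := by
  intro z hz
  have hstep := (S.isChainFamily_doubleChain hv hvu).map_le 1
  rw [pow_one] at hstep
  have h3 := mem_skewAdjointLieSubalgebra.1 S.e_mem z y
  have h4 : B (e z) y = 0 := hy _ (hstep ⟨z, hz, rfl⟩)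
  rw [h4] at h3
  exact neg_eq_zero.1 h3.symm

lemma finrank_range_pow (s : ℕ) : finrank F (LinearMap.range (e ^ s)) =
    (n + 3 - s) + (n + 1 - s) +
      finrank F ((B.orthogonal (doubleSpan e n u v)).map (e ^ s)) := by
  have := (S.isChainFamily_doubleChain hv hvu).finrank_range_pow
    (S.linearIndependent_doubleChain hv hvu hform) (S.isCompl_doubleSpan hv hvu hform)
    (fun y hy => S.e_mem_orthogonal hv hvu hy) s
  rw [this, Fin.sum_univ_two]
  rfl

lemma finrank_orthogonal : finrank F V =
    2 * (n + 2) + finrank F (B.orthogonal (doubleSpan e n u v)) := by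
  have := S.finrank_range_pow hv hvu hform 0
  rw [pow_zero, Module.End.one_eq_id, LinearMap.range_id, finrank_top, Submodule.map_id] at this
  omega

omit hform hvu hv S [CharZero F] [FiniteDimensional F V] [IsAlgClosed F] in
lemma simpleCyclic_apply_of_mem_orthogonal {y : V}
    (hy : y ∈ B.orthogonal (doubleSpan e n u v)) : simpleCyclic B e n u v α y = e y := by
  have h1 : B u y = 0 :=
    hy u (Submodule.subset_span ⟨⟨0, ⟨0, by simp⟩⟩, by simp [doubleChain]⟩)
  have h2 : B v y = 0 :=
    hy v (Submodule.subset_span ⟨⟨1, ⟨0, by simp⟩⟩, by simp [doubleChain]⟩)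
  have h3 : B (e u) y = 0 :=
    hy (e u) (Submodule.subset_span ⟨⟨0, ⟨1, by simp⟩⟩, by simp [doubleChain]⟩)
  rw [simpleCyclic_apply, map_add, map_smul, LinearMap.add_apply, LinearMap.smul_apply, h1, h2, h3]
  simp

lemma finrank_range_eq_iff : finrank F (LinearMap.range e) = 2 * n + 2 ↔
    ∀ y ∈ B.orthogonal (doubleSpan e n u v), e y = 0 := by
  have h1 := S.finrank_range_pow hv hvu hform 1
  rw [pow_one] at h1
  have h2 : finrank F (LinearMap.range e) = 2 * n + 2 ↔
      finrank F ((B.orthogonal (doubleSpan e n u v)).map e) = 0 := by omega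
  rw [h2, Submodule.finrank_eq_zero, eq_bot_iff, Submodule.map_le_iff_le_comap]
  rfl

/-- A cyclic element is the nilpotent operator `e` on the orthogonal complement of the two chains,
so `e` vanishes there if the cyclic element is semisimple. -/
lemma finrank_range_of_isSemisimple (hss : (simpleCyclic B e n u v α).IsSemisimple) :
    finrank F (LinearMap.range e) = 2 * n + 2 := by
  rw [S.finrank_range_eq_iff hv hvu hform]
  exact fun y hy => apply_eq_zero_of_isSemisimple_of_eqOn hss
    (S.triple.hasDegree_e.isNilpotent (by norm_num)) (fun _ => S.e_mem_orthogonal hv hvu)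
    (fun _ => simpleCyclic_apply_of_mem_orthogonal) hy

/-- The polynomial `X ^ (2(n + 2)) - 2α X ^ (n + 2) - γ`, where `γ` is the value of `simpleForm`,
annihilates the cyclic element on the span of the two chains; the factor `X` is needed if that span
is not the whole of `V`. -/
lemma natDegree_minpoly_le_of_finrank (hrange : finrank F (LinearMap.range e) = 2 * n + 2) :
    (minpoly F (simpleCyclic B e n u v α)).natDegree ≤
      2 * (n + 2) + min 1 (finrank F V - 2 * (n + 2)) := by
  have hQ := (S.finrank_range_eq_iff hv hvu hform).1 hrange
  have hdim := S.finrank_orthogonal hv hvu hform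
  set x := simpleCyclic B e n u v α with hx
  set δ := min 1 (finrank F V - 2 * (n + 2)) with hδ
  set q : F[X] := C 1 * X ^ 2 + C (-(2 * α)) * X + C (-simpleForm B e n u v) with hq
  have hq2 : q.natDegree = 2 := natDegree_quadratic one_ne_zero
  have hq0 : q ≠ 0 := by
    intro h0
    rw [h0, natDegree_zero] at hq2
    exact absurd hq2 (by norm_num)
  have hexp : expand F (n + 2) q ≠ 0 := (expand_ne_zero (by omega)).2 hq0
  have hp0 : X ^ δ * expand F (n + 2) q ≠ 0 := mul_ne_zero (pow_ne_zero _ X_ne_zero) hexp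
  have hqu : aeval x (expand F (n + 2) q) u = 0 := by
    have h1 := S.simpleCyclic_pow_two_mul (α := α) hv hvu
    rw [expand_aeval, hq]
    simp only [map_add, map_mul, map_pow, aeval_X, aeval_C, map_one, one_mul, map_neg,
      LinearMap.add_apply, Module.End.mul_apply, LinearMap.neg_apply, Module.algebraMap_end_apply]
    rw [← pow_mul, mul_comm (n + 2), h1]
    module
  refine (natDegree_minpoly_le hp0 ?_).trans ?_
  · rw [← LinearMap.ker_eq_top, eq_top_iff, ← (S.isCompl_doubleSpan hv hvu hform).sup_eq_top]
    refine sup_le ?_ fun y hy => ?_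
    · rw [doubleSpan, Submodule.span_le]
      rintro _ ⟨⟨i, j⟩, rfl⟩
      rw [SetLike.mem_coe, LinearMap.mem_ker, map_mul, Module.End.mul_apply]
      have hmem : doubleChain e n u v ⟨i, j⟩ ∈
          Submodule.span F (Set.range fun i : ℕ => (x ^ i) u) := by
        fin_cases i
        · exact S.e_pow_mem_span hv hvu _
        · exact S.e_pow_mem_span_orthogonal hv hvu _
      rw [aeval_apply_of_mem_span_pow hqu hmem, map_zero]
    · rw [LinearMap.mem_ker]
      rcases Nat.eq_zero_or_pos (finrank F (B.orthogonal (doubleSpan e n u v))) with h0 | h0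
      · rw [Submodule.finrank_eq_zero.1 h0, Submodule.mem_bot] at hy
        rw [hy, map_zero]
      · have hδ1 : δ = 1 := by omega
        rw [hδ1, pow_one, mul_comm, map_mul, Module.End.mul_apply, aeval_X, hx,
          simpleCyclic_apply_of_mem_orthogonal hy, hQ y hy, map_zero]
  · rw [natDegree_mul (pow_ne_zero _ X_ne_zero) hexp, natDegree_expand, natDegree_X_pow, hq2]
    omega

/-- For `α = 0` the eigenvalues are the roots of `X ^ (2(n + 2)) = γ`, where `γ` is the value of
`simpleForm`, and `0` if the two chains do not span `V`. -/
lemma exists_finset_eigenvalues_double (hrange : finrank F (LinearMap.range e) = 2 * n + 2) :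
    ∃ Z : Finset F, 2 * (n + 2) + min 1 (finrank F V - 2 * (n + 2)) ≤ Z.card ∧
      ∀ ζ ∈ Z, (simpleCyclic B e n u v 0).HasEigenvalue ζ := by
  classical
  have hQ := (S.finrank_range_eq_iff hv hvu hform).1 hrange
  have hdim := S.finrank_orthogonal hv hvu hform
  have hform' : simpleForm B e n u v ≠ 0 :=
    neg_ne_zero.2 (mul_ne_zero (inv_ne_zero S.pairing_ne_zero) hform)
  obtain ⟨Z, hZcard, hZ, hZ0⟩ := exists_finset_roots (n := 2 * (n + 2)) (by omega)
    {simpleForm B e n u v} (by simpa using hform'.symm)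
  rw [Finset.card_singleton, one_mul] at hZcard
  have hZev : ∀ ζ ∈ Z, (simpleCyclic B e n u v 0).HasEigenvalue ζ := by
    intro ζ hζ
    have hpow := S.simpleCyclic_pow_two_mul (α := 0) hv hvu
    rw [mul_zero, zero_smul, zero_add] at hpow
    refine hasEigenvalue_of_pow_apply (n := 2 * (n + 2)) (by omega) (fun h => hZ0 (h ▸ hζ))
      (u := u) ?_ (B ((e ^ (n + 2)) u)) ?_ fun i hi0 hi => ?_
    · rw [Finset.mem_singleton.1 (hZ ζ hζ), hpow]
    · rw [S.symm]
      exact S.pairing_ne_zero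
    · have h2 : ∀ j, j ≠ 0 → B ((e ^ (n + 2)) u) ((e ^ j) u) = 0 := fun j hj =>
        apply_eq_zero_of_weights S.h_mem (by omega) S.mem_weight_top (S.e_pow_mem j)
      rcases lt_trichotomy i (n + 2) with h3 | rfl | h3
      · rw [S.simpleCyclic_pow hv hvu (by omega), h2 _ (by omega)]
      · rw [S.simpleCyclic_pow_top hv hvu, zero_smul, add_zero, h2 _ (by omega)]
      · obtain ⟨j, rfl⟩ := Nat.exists_eq_add_of_le' (show n + 3 ≤ i by omega)
        rw [pow_add _ j, Module.End.mul_apply, S.simpleCyclic_pow_succ_top hv hvu, mul_zero, zero_smul,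
          zero_add, S.simpleCyclic_pow_orthogonal hv hvu (by omega)]
        exact apply_eq_zero_of_weights S.h_mem (by omega) S.mem_weight_top
          (S.triple.e_pow_mem hv j)
  rcases Nat.eq_zero_or_pos (finrank F (B.orthogonal (doubleSpan e n u v))) with h0 | h0
  · exact ⟨Z, by omega, hZev⟩
  · refine ⟨insert 0 Z, by rw [Finset.card_insert_of_notMem hZ0]; omega, fun ζ hζ => ?_⟩
    rcases Finset.mem_insert.1 hζ with rfl | hζ
    · obtain ⟨y, hy, hy0⟩ := Submodule.exists_mem_ne_zero_of_ne_bot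
        (Submodule.one_le_finrank_iff.1 h0)
      refine Module.End.hasEigenvalue_of_hasEigenvector (x := y)
        ⟨Module.End.mem_eigenspace_iff.2 ?_, hy0⟩
      rw [simpleCyclic_apply_of_mem_orthogonal hy, hQ y hy, zero_smul]
    · exact hZev ζ hζ

end

/-- On the orthogonal complement of the chain of `u` in the component of weight `-n`, the form
`(v, w) ↦ B v (e ^ n w)` is symmetric and non-degenerate, hence it is not alternating. -/
lemma exists_form_ne_zero (S : HasSimpleTop B h e f n u) (hv : v ∈ weightSpace h (-n))
    (hvu : B v ((e ^ (n + 1)) u) = 0) (hv0 : v ≠ 0) :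
    ∃ w ∈ weightSpace h (-n), B w ((e ^ (n + 1)) u) = 0 ∧ B w ((e ^ n) w) ≠ 0 := by
  by_contra! hcon
  have hsymm : ∀ x y, B x ((e ^ n) y) = B y ((e ^ n) x) := by
    intro x y
    rw [S.symm x, skew_pow_apply S.e_mem, S.even.neg_one_pow, one_mul]
  -- `v` is a lowest weight vector
  have hfu : f u = 0 := S.weightsLE _ _ (S.triple.hasDegree_f.apply_mem S.mem) (by
    rw [abs_of_neg (by omega)]; push_cast; omega)
  have hfv : f v = 0 := by
    obtain ⟨c, hc⟩ := S.exists_smul (f v) (by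
      have := S.triple.hasDegree_f.apply_mem hv
      rwa [show -(n : ℤ) + -2 = -(n + 2) by ring] at this)
    have h1 := S.triple.symm.e_f_pow_apply (n + 1) hfu
    have h2 := mem_skewAdjointLieSubalgebra.1 S.f_mem v ((e ^ (n + 2)) u)
    have h3 : -h u - ((n + 1 : ℕ) : F) • u = u := by
      rw [mem_weightSpace.1 S.mem]
      push_cast
      module
    rw [LinearMap.neg_apply, h3] at h1
    rw [hc, h1, map_smul, map_smul, LinearMap.smul_apply, hvu, smul_zero, neg_zero] at h2
    rw [hc, (smul_eq_zero.1 h2).resolve_right S.pairing_ne_zero, zero_smul]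
  have hne : (e ^ n) v ≠ 0 := by
    intro h0
    have h1 := S.triple.symm.e_pow_f_pow_of_e_apply_eq_zero (mem_weightSpace_neg.2 hv) hfv
    rw [h0, map_zero] at h1
    exact hv0 ((smul_eq_zero.1 h1.symm).resolve_left (topScalar_ne_zero n))
  refine hne (S.triple.eq_zero_of_pairing S.nondegenerate S.h_mem (i := n) ?_ fun w hw => ?_)
  · have := S.triple.e_pow_mem hv n
    rwa [show -(n : ℤ) + 2 * n = n by ring] at this
  · obtain ⟨h1, h2⟩ := S.exists_decomposition hw
    set c := (B u ((e ^ (n + 2)) u))⁻¹ * B w ((e ^ (n + 1)) u)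
    have h3 : B (e u) ((e ^ n) v) = 0 := by
      rw [mem_skewAdjointLieSubalgebra.1 S.e_mem, ← Module.End.mul_apply, ← pow_succ',
        S.e_pow_succ_eq_zero hv hvu, map_zero, neg_zero]
    have h4 : ∀ x ∈ weightSpace h (-n), B x ((e ^ (n + 1)) u) = 0 → B x ((e ^ n) v) = 0 := by
      intro x hx hxu
      have h5 := hcon (x + v) (add_mem hx hv) (by
        rw [map_add, LinearMap.add_apply, hxu, hvu, add_zero])
      rw [map_add, map_add, LinearMap.add_apply, map_add, map_add, hcon x hx hxu, hcon v hv hvu,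
        hsymm v] at h5
      have h6 : (2 : F) * B x ((e ^ n) v) = 0 := by linear_combination h5
      exact (mul_eq_zero.1 h6).resolve_left two_ne_zero
    replace h4 := h4 _ h1 h2
    rw [map_add, LinearMap.add_apply, map_smul, LinearMap.smul_apply, h3, smul_zero, add_zero] at h4
    rw [S.symm, h4]

end HasSimpleTop

end DoubleChain

/-! ### Simple top block: elements of semisimple type -/

section SimpleTopTypes

variable {F V : Type*} [Field F] [AddCommGroup V] [Module F V]
  [CharZero F] [FiniteDimensional F V] [IsAlgClosed F]
  {B : LinearMap.BilinForm F V} {h e f : skewAdjointLieSubalgebra B} {n : ℕ} {u v : V} {α : F}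

omit [FiniteDimensional F V] [IsAlgClosed F] in
lemma linearIndependent_of_weights {h : End F V} {i j : ℤ} (hij : i ≠ j)
    (hu : u ∈ weightSpace h i) (hv : v ∈ weightSpace h j) (hu0 : u ≠ 0) (hv0 : v ≠ 0) :
    LinearIndependent F ![u, v] := by
  rw [LinearIndependent.pair_iff]
  intro s t hst
  have h1 := congrArg h hst
  rw [map_add, map_smul, map_smul, mem_weightSpace.1 hu, mem_weightSpace.1 hv, map_zero] at h1
  have h2 : (s * ((i - j : ℤ) : F)) • u = 0 := by
    calc (s * ((i - j : ℤ) : F)) • u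
        = (s • (i : F) • u + t • (j : F) • v) - (j : F) • (s • u + t • v) := by push_cast; module
      _ = 0 := by rw [h1, hst, smul_zero, sub_zero]
  have hs : s = 0 := (mul_eq_zero.1 ((smul_eq_zero.1 h2).resolve_right hu0)).resolve_right
    (Int.cast_ne_zero.2 (sub_ne_zero.2 hij))
  rw [hs, zero_smul, zero_add] at hst
  exact ⟨hs, (smul_eq_zero.1 hst).resolve_right hv0⟩

/-- When the component of lowest weight `-N` is a line spanned by `u`, an element of `so(V)` of
degree `2N` vanishes: the form `(x, y) ↦ B (y x) x` is alternating. -/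
lemma eq_zero_of_hasDegree_two_mul {N : ℕ} {h e f y : End F V} (t : IsSl2Triple h e f)
    (hN : WeightsLE h N) (hnd : B.Nondegenerate) (hB : ∀ u v, B u v = B v u)
    (hh : h ∈ skewAdjointLieSubalgebra B) (hu : u ∈ weightSpace h (-N))
    (hspan : ∀ v ∈ weightSpace h (-N), ∃ c : F, v = c • u)
    (hyB : y ∈ skewAdjointLieSubalgebra B) (hy : HasDegree h y (2 * N)) : y = 0 := by
  have hyu : y u = 0 := by
    have h1 := hy.apply_mem hu
    rw [show -(N : ℤ) + 2 * N = N by ring] at h1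
    refine t.eq_zero_of_pairing hnd hh h1 fun w hw => ?_
    obtain ⟨c, rfl⟩ := hspan w hw
    have h2 := mem_skewAdjointLieSubalgebra.1 hyB u u
    rw [hB u] at h2
    have h3 : (2 : F) * B (y u) u = 0 := by linear_combination h2
    rw [map_smul, (mul_eq_zero.1 h3).resolve_left two_ne_zero, smul_zero]
  ext v
  induction v using t.weight_induction with
  | h0 => simp
  | hadd v w hv hw => rw [map_add, map_add, hv, hw]
  | hwt i v hv =>
    rw [LinearMap.zero_apply]
    by_cases hi : i = -N
    · obtain ⟨c, rfl⟩ := hspan v (hi ▸ hv)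
      rw [map_smul, hyu, smul_zero]
    · by_cases hi' : (N : ℤ) < |i|
      · rw [hN i v hv hi', map_zero]
      · refine hN.eq_zero_of_hasDegree hy hv ?_
        rw [not_lt, abs_le] at hi'
        rw [abs_of_pos (by omega)]
        omega

/-- For an element of even depth in `so(V)`, a component of highest weight of dimension one lies in
even degree, and there are no vectors in the next lower degree. -/
lemma exists_hasSimpleTop {N : ℕ} (hnd : B.Nondegenerate) (hB : ∀ u v, B u v = B v u)
    (t : IsSl2Triple h e f) (hN : WeightsLE (h : End F V) N) (hN1 : 1 ≤ N)
    (hk : finrank F (weightSpace (h : End F V) (-N)) = 1) (hd : Even (gradingDepth F h)) :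
    ∃ (n : ℕ) (u : V), N = n + 2 ∧ HasSimpleTop B (h : End F V) e f n u := by
  have t' := isSl2Triple_coe t
  have hB' : ∀ u v, B u v = 1 * B v u := by simpa using hB
  have hev : Even N := by
    by_contra hodd
    rw [Nat.not_even_iff_odd] at hodd
    have := even_finrank_of_antisymm (t'.bottomForm_nondegenerate hN hnd hB' h.2 e.2)
      fun u v => by rw [bottomForm_symm hB' e.2, hodd.neg_one_pow]; ring
    rw [hk] at this
    exact Nat.not_even_one this
  obtain ⟨n, rfl⟩ : ∃ n, N = n + 2 := Nat.exists_eq_add_of_le' (by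
    obtain ⟨r, rfl⟩ := hev
    omega)
  obtain ⟨u, hu0, hu⟩ := finrank_eq_one_iff'.1 hk
  have hspan : ∀ v ∈ weightSpace (h : End F V) (-(n + 2 : ℕ)), ∃ c : F, v = c • (u : V) := by
    intro v hv
    obtain ⟨c, hc⟩ := hu ⟨v, hv⟩
    exact ⟨c, (congrArg Subtype.val hc).symm⟩
  have hu0' : (u : V) ≠ 0 := fun h0 => hu0 (Subtype.ext h0)
  have hcast : ((n + 2 : ℕ) : ℤ) = n + 2 := by push_cast; rfl
  refine ⟨n, u, rfl, ⟨t', hnd, hB, h.2, e.2, f.2, (Nat.even_add.1 hev).2 even_two, hN, ?_,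
    hcast ▸ u.2, hcast ▸ hspan, fun h0 => ?_⟩⟩
  · intro w hw
    by_contra hw0
    -- otherwise `e ^ (n + 2) u ∧ w` is an element of highest degree, which is odd
    have htop := t'.e_pow_mem u.2 (n + 2)
    rw [show -((n + 2 : ℕ) : ℤ) + 2 * ((n + 2 : ℕ) : ℤ) = n + 2 by push_cast; ring] at htop
    have hdepth : gradingDepth F h = 2 * n + 3 := by
      refine gradingDepth_eq ⟨⟨_, wedge_mem hB' (one_mul 1) (((e : End F V) ^ (n + 2)) u) w⟩,
        fun h0 => ?_, ?_⟩ fun j hj y hy => Subtype.ext ?_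
      · exact wedge_ne_zero hnd (linearIndependent_of_weights (by omega) htop hw
          (fun h1 => hu0' (t'.eq_zero_of_e_pow hN u.2 h1)) hw0) (congrArg Subtype.val h0)
      · have := hasDegree_wedge (ε := 1) h.2 htop hw
        rwa [show (n : ℤ) + 2 + (n + 1) = ((2 * n + 3 : ℕ) : ℤ) by push_cast; ring] at this
      · rcases eq_or_lt_of_le (Nat.succ_le_of_lt hj) with hj' | hj'
        · refine eq_zero_of_hasDegree_two_mul t' hN hnd hB h.2 u.2 hspan y.2 ?_
          rwa [← hj', show ((2 * n + 3).succ : ℤ) = 2 * ((n + 2 : ℕ) : ℤ) by push_cast; ring] at hy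
        · exact t'.eq_zero_of_hasDegree hN (by push_cast; omega) hy
    rw [hdepth] at hd
    obtain ⟨r, hr⟩ := hd
    omega
  · refine hu0' (t'.eq_zero_of_bottomForm hN hnd h.2 u.2 fun m hm => ?_)
    obtain ⟨c, rfl⟩ := hspan m hm
    rw [map_smul, map_smul, h0, smul_zero]

namespace HasSimpleTop

lemma finrank_eq {h e f : End F V} (S : HasSimpleTop B h e f n u) :
    finrank F V = n + 3 + finrank F (core e f (n + 2)) := by
  have hcast : ((n + 2 : ℕ) : ℤ) = n + 2 := by push_cast; rfl
  have hu : u ∈ weightSpace h (-(n + 2 : ℕ)) := hcast ▸ S.mem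
  have h1 : finrank F (weightSpace h (-(n + 2 : ℕ))) = 1 := by
    refine finrank_eq_one_iff'.2 ⟨⟨u, hu⟩, fun h0 => S.pairing_ne_zero ?_, fun w => ?_⟩
    · rw [show u = 0 from congrArg Subtype.val h0]
      simp
    · obtain ⟨c, hc⟩ := S.exists_smul w (hcast ▸ w.2)
      exact ⟨c, Subtype.ext hc.symm⟩
  have := S.triple.finrank_eq S.weightsLE
  rw [h1] at this
  omega

omit [CharZero F] [FiniteDimensional F V] [IsAlgClosed F] in
lemma hasDegree_wedge_lowest {h e f : End F V} (S : HasSimpleTop B h e f n u)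
    (hv : v ∈ weightSpace h (-n)) : HasDegree h (wedge B 1 u v) (-(2 * n + 2 : ℕ)) := by
  have := hasDegree_wedge (ε := 1) S.h_mem S.mem hv
  rwa [show -((n : ℤ) + 2) + -n = -((2 * n + 2 : ℕ) : ℤ) by push_cast; ring] at this

/-- The depth is `2n + 2`, one step `2` below the largest conceivable value `2(n + 2)`. -/
lemma gradingDepth_eq (S : HasSimpleTop B (h : End F V) e f n u) :
    gradingDepth F h = 2 * n + 2 ∧ ∃ y : skewAdjointLieSubalgebra B, y ≠ 0 ∧
      HasDegree (h : End F V) (y : End F V) (-(2 * n + 2 : ℕ)) := by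
  have hB' : ∀ u v, B u v = 1 * B v u := by simpa using S.symm
  have hne : ∀ j ≤ n + 2, ((e : End F V) ^ j) u ≠ 0 := by
    intro j hj h0
    obtain ⟨i, hi⟩ := Nat.exists_eq_add_of_le' hj
    refine S.pairing_ne_zero ?_
    rw [hi, pow_add, Module.End.mul_apply, h0, map_zero, map_zero]
  have hu0 : u ≠ 0 := by simpa using hne 0 (by omega)
  have heu0 : (e : End F V) u ≠ 0 := by simpa using hne 1 (by omega)
  have hspan : ∀ v ∈ weightSpace (h : End F V) (-(n + 2 : ℕ)), ∃ c : F, v = c • u := by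
    intro v hv
    exact S.exists_smul v (by rwa [Nat.cast_add, Nat.cast_ofNat] at hv)
  constructor
  · refine _root_.gradingDepth_eq ⟨⟨_, wedge_mem hB' (one_mul 1)
      (((e : End F V) ^ (n + 2)) u) (((e : End F V) ^ (n + 1)) u)⟩, fun h0 => ?_, ?_⟩
      fun j hj y hy => Subtype.ext ?_
    · exact wedge_ne_zero S.nondegenerate (linearIndependent_of_weights (by push_cast; omega)
        (S.e_pow_mem _) (S.e_pow_mem _) (hne _ le_rfl) (hne _ (by omega)))
        (congrArg Subtype.val h0)
    · have := hasDegree_wedge (ε := 1) h.2 (S.e_pow_mem (n + 2)) (S.e_pow_mem (n + 1))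
      rwa [show -((n : ℤ) + 2) + 2 * ((n + 2 : ℕ) : ℤ) + (-((n : ℤ) + 2) + 2 * ((n + 1 : ℕ) : ℤ)) =
        ((2 * n + 2 : ℕ) : ℤ) by push_cast; ring] at this
    · rcases lt_trichotomy j (2 * n + 4) with hj' | hj' | hj'
      · obtain rfl : j = 2 * n + 3 := by omega
        -- an element of degree `2n + 3` shifts weights to or from `±(n + 1)`
        ext v
        rw [ZeroMemClass.coe_zero, LinearMap.zero_apply]
        induction v using S.triple.weight_induction with
        | h0 => simp
        | hadd v w hv hw => rw [map_add, hv, hw, add_zero]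
        | hwt i v hv =>
          have hyv := hy.apply_mem hv
          by_cases hi : i = -(n + 1)
          · have hv0 : v = 0 :=
              S.triple.eq_zero_of_pairing S.nondegenerate S.h_mem hv fun w hw => by
                rw [S.eq_zero_of_mem w (by rwa [hi, neg_neg] at hw), map_zero]
            rw [hv0, map_zero]
          by_cases hi2 : i = -(n + 2)
          · refine S.eq_zero_of_mem _ ?_
            rwa [hi2, show -((n : ℤ) + 2) + ((2 * n + 3 : ℕ) : ℤ) = n + 1 by
              push_cast; ring] at hyv
          by_cases hi3 : ((n + 2 : ℕ) : ℤ) < |i|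
          · rw [S.weightsLE i v hv hi3, map_zero]
          · refine S.weightsLE _ _ hyv ?_
            rw [not_lt, abs_le] at hi3
            push_cast at hi3 ⊢
            rw [abs_of_pos (by omega)]
            omega
      · refine eq_zero_of_hasDegree_two_mul S.triple S.weightsLE S.nondegenerate S.symm h.2
          (by rw [Nat.cast_add, Nat.cast_ofNat]; exact S.mem) hspan y.2 ?_
        rwa [hj', show ((2 * n + 4 : ℕ) : ℤ) = 2 * ((n + 2 : ℕ) : ℤ) by push_cast; ring] at hy
      · exact S.triple.eq_zero_of_hasDegree S.weightsLE (by push_cast; omega) hy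
  · refine ⟨⟨_, wedge_mem hB' (one_mul 1) u ((e : End F V) u)⟩, fun h0 => ?_,
      S.hasDegree_wedge_lowest S.e_apply_mem⟩
    exact wedge_ne_zero S.nondegenerate (linearIndependent_of_weights (by omega) S.mem
      S.e_apply_mem hu0 heu0) (congrArg Subtype.val h0)

omit [FiniteDimensional F V] [IsAlgClosed F] in
lemma exists_lowest_element (S : HasSimpleTop B (h : End F V) e f n u)
    (hv : v ∈ weightSpace (h : End F V) (-n)) (α : F) :
    ∃ E : skewAdjointLieSubalgebra B, HasDegree (h : End F V) (E : End F V) (-(2 * n + 2 : ℕ)) ∧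
      (E : End F V) (((e : End F V) ^ (n + 2)) u) = α • (e : End F V) u + v ∧
      (e : End F V) + E = simpleCyclic B (e : End F V) n u v α := by
  have hw : α • (e : End F V) u + v ∈ weightSpace (h : End F V) (-n) :=
    add_mem (Submodule.smul_mem _ _ S.e_apply_mem) hv
  refine ⟨⟨_, Submodule.smul_mem (skewAdjointLieSubalgebra B).toSubmodule _
    (wedge_mem (by simpa using S.symm) (one_mul 1) u (α • (e : End F V) u + v))⟩,
    (S.hasDegree_wedge_lowest hw).smul _, ?_, rfl⟩
  rw [LinearMap.smul_apply, wedge_apply,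
    apply_eq_zero_of_weights S.h_mem (by omega) hw S.mem_weight_top, mul_zero, zero_smul, sub_zero,
    smul_smul, inv_mul_cancel₀ S.pairing_ne_zero, one_smul]

/-- The case in which the chain of `u` exhausts the component of weight `-n`. -/
theorem semisimpleType_iff_of_forall (S : HasSimpleTop B (h : End F V) e f n u)
    (hM : ∀ v ∈ weightSpace (h : End F V) (-n), B v (((e : End F V) ^ (n + 1)) u) = 0 → v = 0) :
    (IsOfSemisimpleType F h e ↔
      ∀ v ∈ core (e : End F V) (f : End F V) (n + 2), (e : End F V) v = 0) ∧
    (IsOfRegularSemisimpleType F h e ↔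
      (∀ v ∈ core (e : End F V) (f : End F V) (n + 2), (e : End F V) v = 0) ∧
        finrank F (core (e : End F V) (f : End F V) (n + 2)) ≤ 1) := by
  have hL := skewAdjointLieSubalgebra_detectsSemisimplicity (ε := 1) S.nondegenerate
    (by simpa using S.symm) (one_mul 1)
  obtain ⟨hd, hne⟩ := S.gradingDepth_eq
  have hX : ∀ E : skewAdjointLieSubalgebra B,
      HasDegree (h : End F V) (E : End F V) (-(2 * n + 2 : ℕ)) →
      ∃ α, (e : End F V) + E = simpleCyclic B (e : End F V) n u 0 α := by
    intro E hE
    obtain ⟨α, v, hv, hvu, -, hE'⟩ := S.add_eq_simpleCyclic (by simpa using hE) E.2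
    rw [hM v hv hvu] at hE'
    exact ⟨α, hE'⟩
  obtain ⟨E₀, hE₀, -, hE₀'⟩ := S.exists_lowest_element (zero_mem _) 1
  refine semisimpleType_criterion (Good := fun _ => True) (E₀ := E₀) (r := n + 3) hL hd hne
    (HoldsGenerically.of_forall fun _ => trivial) ?_ ?_ hE₀ trivial ?_ ?_
  · intro E hE _ hss
    obtain ⟨α, hα⟩ := hX E hE
    exact S.core_le_ker (hα ▸ hss)
  · intro hcore E hE _
    obtain ⟨α, hα⟩ := hX E hE
    rw [hα]
    exact S.natDegree_minpoly_le_of_core hcore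
  · intro _
    rw [hE₀']
    exact S.exists_finset_eigenvalues_simple
  · intro hcore E hE _ hss hdeg
    obtain ⟨α, hα⟩ := hX E hE
    have hlt : core (e : End F V) (f : End F V) (n + 2) <
        ((e + E : skewAdjointLieSubalgebra B) : End F V).eigenspace 0 := by
      rw [show ((e + E : skewAdjointLieSubalgebra B) : End F V) = simpleCyclic B _ n u 0 α from hα]
      obtain ⟨h1, h2⟩ := S.simpleCyclic_kernel (α := α)
      refine lt_of_le_of_ne (fun v hv => ?_) fun h3 => h2 ?_
      · rw [Module.End.mem_eigenspace_iff, zero_smul, S.simpleCyclic_apply_of_mem_core hv,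
          hcore v hv]
      · rw [h3, Module.End.mem_eigenspace_iff, h1, zero_smul]
    have hker := Submodule.finrank_lt_finrank_of_lt hlt
    have hdim := S.finrank_eq
    refine ⟨fun hreg => ?_, fun hle => ?_⟩
    · by_contra! hgt
      exact not_isRegularSemisimpleElement_so_of_finrank_ker S.nondegenerate S.symm hss (by omega)
        hreg
    · refine isRegularSemisimpleElement_skew_of_finrank_le S.nondegenerate S.symm hss ?_
      rw [hdeg]
      omega

/-- The case in which some vector of weight `-n` is orthogonal to the chain of `u`. -/
theorem semisimpleType_iff_of_exists (S : HasSimpleTop B (h : End F V) e f n u)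
    (hv : v ∈ weightSpace (h : End F V) (-n)) (hvu : B v (((e : End F V) ^ (n + 1)) u) = 0)
    (hv0 : v ≠ 0) :
    (IsOfSemisimpleType F h e ↔
      finrank F (LinearMap.range (e : End F V)) = 2 * n + 2) ∧
    (IsOfRegularSemisimpleType F h e ↔
      finrank F (LinearMap.range (e : End F V)) = 2 * n + 2 ∧ finrank F V ≤ 2 * n + 6) := by
  have hL := skewAdjointLieSubalgebra_detectsSemisimplicity (ε := 1) S.nondegenerate
    (by simpa using S.symm) (one_mul 1)
  obtain ⟨hd, hne⟩ := S.gradingDepth_eq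
  obtain ⟨w, hw, hwu, hwform⟩ := S.exists_form_ne_zero hv hvu hv0
  -- the projection along `e u` onto the orthogonal complement of the chain of `u`
  set P : V →ₗ[F] V := LinearMap.id + ((B u (((e : End F V) ^ (n + 2)) u))⁻¹ •
    B.flip (((e : End F V) ^ (n + 1)) u)).smulRight ((e : End F V) u) with hP
  have hPapply : ∀ (α : F) (v : V), B v (((e : End F V) ^ (n + 1)) u) = 0 →
      P (α • (e : End F V) u + v) = v := by
    intro α v hvu
    have := S.pairing_ne_zero
    simp only [hP, LinearMap.add_apply, LinearMap.id_apply, LinearMap.smulRight_apply,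
      LinearMap.smul_apply, LinearMap.BilinForm.flip_apply, map_add, map_smul, hvu, S.pairing_e_apply,
      smul_eq_mul]
    rw [mul_neg, inv_mul_cancel₀ this, mul_zero]
    module
  set Good : skewAdjointLieSubalgebra B → Prop := fun E =>
    B (P ((E : End F V) (((e : End F V) ^ (n + 2)) u)))
      (((e : End F V) ^ n) (P ((E : End F V) (((e : End F V) ^ (n + 2)) u)))) ≠ 0 with hGood
  have hX : ∀ E : skewAdjointLieSubalgebra B,
      HasDegree (h : End F V) (E : End F V) (-(2 * n + 2 : ℕ)) → Good E →
      ∃ (α : F) (v : V), v ∈ weightSpace (h : End F V) (-n) ∧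
        B v (((e : End F V) ^ (n + 1)) u) = 0 ∧ B v (((e : End F V) ^ n) v) ≠ 0 ∧
        (e : End F V) + E = simpleCyclic B (e : End F V) n u v α := by
    intro E hE hgood
    obtain ⟨α, v, hv, hvu, hEv, hE'⟩ := S.add_eq_simpleCyclic (by simpa using hE) E.2
    simp only [hGood, hEv, hPapply α v hvu] at hgood
    exact ⟨α, v, hv, hvu, hgood, hE'⟩
  obtain ⟨E₀, hE₀, hE₀w, hE₀'⟩ := S.exists_lowest_element hw 0
  have hE₀good : Good E₀ := by
    simp only [hGood, hE₀w, hPapply 0 w hwu]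
    exact hwform
  have hgood : HoldsGenerically F
      fun E : gradedPiece F h (-(gradingDepth F h : ℤ)) => Good E := by
    have hmem : E₀ ∈ gradedPiece F h (-(gradingDepth F h : ℤ)) := by
      rwa [mem_gradedPiece, hd]
    set φ : gradedPiece F h (-(gradingDepth F h : ℤ)) →ₗ[F] V :=
      P ∘ₗ LinearMap.applyₗ (((e : End F V) ^ (n + 2)) u) ∘ₗ lowestPieceEmbedding h
    exact HoldsGenerically.of_polynomialFunction
      (bilin_mem_polyFunctionAlgebra B φ (((e : End F V) ^ n) ∘ₗ φ)) (w₀ := ⟨E₀, hmem⟩)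
      hE₀good fun E hE => hE
  refine semisimpleType_criterion (E₀ := E₀)
    (r := 2 * (n + 2) + min 1 (finrank F V - 2 * (n + 2))) hL hd hne hgood ?_ ?_ hE₀ hE₀good ?_ ?_
  · intro E hE hgood hss
    obtain ⟨α, v, hv, hvu, hform, hα⟩ := hX E hE hgood
    exact S.finrank_range_of_isSemisimple hv hvu hform (hα ▸ hss)
  · intro hrange E hE hgood
    obtain ⟨α, v, hv, hvu, hform, hα⟩ := hX E hE hgood
    rw [hα]
    exact S.natDegree_minpoly_le_of_finrank hv hvu hform hrange
  · intro hrange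
    rw [hE₀']
    exact S.exists_finset_eigenvalues_double hw hwu hwform hrange
  · intro hrange E hE hgood hss hdeg
    obtain ⟨α, v, hv, hvu, hform, hα⟩ := hX E hE hgood
    have hker : B.orthogonal (doubleSpan (e : End F V) n u v) ≤
        ((e + E : skewAdjointLieSubalgebra B) : End F V).eigenspace 0 := by
      rw [show ((e + E : skewAdjointLieSubalgebra B) : End F V) = simpleCyclic B _ n u v α from hα]
      intro y hy
      rw [Module.End.mem_eigenspace_iff, zero_smul, simpleCyclic_apply_of_mem_orthogonal hy]
      exact (S.finrank_range_eq_iff hv hvu hform).1 hrange y hy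
    have hker' := Submodule.finrank_mono hker
    have hdim := S.finrank_orthogonal hv hvu hform
    refine ⟨fun hreg => ?_, fun hle => ?_⟩
    · by_contra! hgt
      exact not_isRegularSemisimpleElement_so_of_finrank_ker S.nondegenerate S.symm hss (by omega)
        hreg
    · refine isRegularSemisimpleElement_skew_of_finrank_le S.nondegenerate S.symm hss ?_
      rw [hdeg]
      omega

/-- If the chain of `u` exhausts the component of weight `-n`, there is no Jordan block of order
`n + 1` or `n + 2`. -/
lemma map_core_eq_bot {h e f : End F V} (S : HasSimpleTop B h e f n u)
    (hM : ∀ v ∈ weightSpace h (-n), B v ((e ^ (n + 1)) u) = 0 → v = 0) :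
    (core e f (n + 2)).map (e ^ n) = ⊥ := by
  have hzero : ∀ c ∈ core e f (n + 2), ∀ j : ℕ, B ((e ^ j) u) c = 0 := by
    intro c hc j
    induction j generalizing c with
    | zero => simpa using S.pairing_core hc
    | succ j ih =>
      rw [pow_succ', Module.End.mul_apply, mem_skewAdjointLieSubalgebra.1 S.e_mem,
        ih _ (e_mem_core hc), neg_zero]
  rw [eq_bot_iff, Submodule.map_le_iff_le_comap]
  intro c hc
  refine S.nondegenerate.2 _ fun w => ?_
  have hw : ∀ w, B c ((e ^ n) w) = 0 := by
    intro w
    induction w using S.triple.weight_induction with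
    | h0 => simp
    | hadd v w hv hw => rw [map_add, map_add, hv, hw, add_zero]
    | hwt i w hw =>
      -- by weight, `e ^ n w` is a multiple of a vector of the chain of `u`
      have hmem := S.triple.e_pow_mem hw n
      rcases lt_trichotomy i (-n) with hi | rfl | hi
      · by_cases hi2 : i = -(n + 2)
        · obtain ⟨a, rfl⟩ := S.exists_smul w (hi2 ▸ hw)
          rw [map_smul, map_smul, S.symm c, hzero c hc, smul_zero]
        · rw [show w = 0 from ?_, map_zero, map_zero]
          by_cases hi1 : i = -(n + 1)
          · refine S.triple.eq_zero_of_pairing S.nondegenerate S.h_mem hw fun y hy => ?_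
            rw [S.eq_zero_of_mem y (by rwa [hi1, neg_neg] at hy), map_zero]
          · exact S.weightsLE i w hw (by
              rw [abs_of_nonpos (by omega)]
              push_cast
              omega)
      · obtain ⟨h1, h2⟩ := S.exists_decomposition hw
        rw [eq_neg_of_add_eq_zero_left (hM _ h1 h2), map_neg, map_smul, ← Module.End.mul_apply,
          ← pow_succ, map_neg, map_smul, S.symm c, hzero c hc, smul_zero, neg_zero]
      · by_cases hi2 : i + 2 * n = n + 2
        · rw [hi2] at hmem
          have h1 := S.triple.e_pow_f_pow_of_mem_top S.weightsLE (by exact_mod_cast hmem)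
          have h2 := S.triple.f_pow_mem hmem (n + 2)
          obtain ⟨a, ha⟩ := S.exists_smul _ (by
            rwa [show (n : ℤ) + 2 - 2 * ((n + 2 : ℕ) : ℤ) = -(n + 2) by push_cast; ring] at h2)
          rw [ha, map_smul] at h1
          rw [← inv_smul_smul₀ (topScalar_ne_zero (F := F) (n + 2)) ((e ^ n) w), ← h1, map_smul,
            map_smul, S.symm c, hzero c hc, smul_zero, smul_zero]
        · rw [show (e ^ n) w = 0 from ?_, map_zero]
          by_cases hi1 : i + 2 * n = n + 1
          · exact S.eq_zero_of_mem _ (hi1 ▸ hmem)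
          · exact S.weightsLE _ _ hmem (by
              rw [abs_of_nonneg (by omega)]
              push_cast
              omega)
  rw [S.symm, skew_pow_apply S.e_mem, hw, mul_zero]

end HasSimpleTop

end SimpleTopTypes

/-! ### Partitions -/

section Partitions

variable {s : Multiset ℕ} {N k k' l n₁ m : ℕ}

lemma eq_of_replicate_add_eq (hk : 0 < k) (hN : 1 ≤ N) (hs : ∀ m ∈ s, 1 ≤ m ∧ m ≤ N)
    (heq : Multiset.replicate k (N + 1) + s = Multiset.replicate k' n₁ + Multiset.replicate l 1) :
    n₁ = N + 1 ∧ k' = k ∧ s = Multiset.replicate l 1 := by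
  have hsN : s.count (N + 1) = 0 := Multiset.count_eq_zero.2 fun h => by
    have := hs _ h
    omega
  have hcount := congrArg (Multiset.count (N + 1)) heq
  simp only [Multiset.count_add, Multiset.count_replicate, hsN, if_true, add_zero,
    if_neg (show 1 ≠ N + 1 by omega)] at hcount
  split_ifs at hcount with h1
  · subst h1 hcount
    exact ⟨rfl, rfl, add_left_cancel heq⟩
  · omega

lemma eq_of_replicate_add_eq_cons (hk : 0 < k) (hN : 1 ≤ N) (hs : ∀ m ∈ s, 1 ≤ m ∧ m ≤ N)
    (heq : Multiset.replicate k (N + 1) + s = n₁ ::ₘ Multiset.replicate l 1) :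
    n₁ = N + 1 ∧ k = 1 ∧ s = Multiset.replicate l 1 := by
  obtain ⟨h1, h2, h3⟩ := eq_of_replicate_add_eq (k' := 1) (n₁ := n₁) (l := l) hk hN hs
    (by rw [heq, Multiset.replicate_one, Multiset.singleton_add])
  exact ⟨h1, h2.symm, h3⟩

lemma eq_of_replicate_add_eq_cons_cons (hk : 0 < k) (hN : 1 ≤ N) (hs : ∀ m ∈ s, 1 ≤ m ∧ m ≤ N)
    (hm : 1 ≤ m) (heq : Multiset.replicate k (N + 1) + s =
      (2 * m + 1) ::ₘ (2 * m - 1) ::ₘ Multiset.replicate l 1) :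
    2 * m = N ∧ k = 1 ∧ s = (2 * m - 1) ::ₘ Multiset.replicate l 1 := by
  have hle : 2 * m + 1 ≤ N + 1 := by
    have h1 : 2 * m + 1 ∈ Multiset.replicate k (N + 1) + s := by
      rw [heq]
      exact Multiset.mem_cons_self _ _
    rcases Multiset.mem_add.1 h1 with h1 | h1
    · exact (Multiset.eq_of_mem_replicate h1).le
    · exact (hs _ h1).2.trans (Nat.le_succ N)
  have hsN : s.count (N + 1) = 0 := Multiset.count_eq_zero.2 fun h => by
    have := hs _ h
    omega
  have hcount := congrArg (Multiset.count (N + 1)) heq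
  simp only [Multiset.count_add, Multiset.count_replicate, Multiset.count_cons, hsN, if_true,
    add_zero, if_neg (show 1 ≠ N + 1 by omega), if_neg (show N + 1 ≠ 2 * m - 1 by omega),
    zero_add] at hcount
  split_ifs at hcount with h1
  · subst hcount
    rw [← h1, Multiset.replicate_one, Multiset.singleton_add] at heq
    exact ⟨by omega, rfl, (Multiset.cons_inj_right _).1 heq⟩
  · omega

lemma exists_replicate_iff (hk : 0 < k) (hN : 1 ≤ N) (hs : ∀ m ∈ s, 1 ≤ m ∧ m ≤ N) :
    (∃ n₁ k' l : ℕ, 0 < k' ∧ Multiset.replicate k (N + 1) + s =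
      Multiset.replicate k' n₁ + Multiset.replicate l 1) ↔ ∃ l, s = Multiset.replicate l 1 :=
  ⟨fun ⟨_, _, l, _, h⟩ => ⟨l, (eq_of_replicate_add_eq hk hN hs h).2.2⟩,
    fun ⟨l, h⟩ => ⟨N + 1, k, l, hk, by rw [h]⟩⟩

/-- The only multiset of positive integers, at least one of them being `≥ n + 1`, whose sum after
decreasing all its members by `1` is `n`, is `n + 1, 1, …, 1`. -/
lemma eq_cons_replicate_of_sum_eq (hs : ∀ m ∈ s, 1 ≤ m) {n : ℕ} (hsn : ∃ m ∈ s, n + 1 ≤ m)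
    (hsum : (s.map fun m => m - 1).sum = n) :
    s = (n + 1) ::ₘ Multiset.replicate (s.card - 1) 1 := by
  obtain ⟨m, hm, hnm⟩ := hsn
  obtain ⟨s, rfl⟩ := Multiset.exists_cons_of_mem hm
  rw [Multiset.map_cons, Multiset.sum_cons] at hsum
  have h0 : (s.map fun m => m - 1).sum = 0 := by omega
  have hmn : m = n + 1 := by omega
  rw [Multiset.sum_eq_zero_iff] at h0
  rw [hmn, Multiset.card_cons, Nat.add_sub_cancel]
  congr 1
  refine Multiset.eq_replicate_card.2 fun a ha => ?_
  have := h0 _ (Multiset.mem_map_of_mem _ ha)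
  have := hs a (Multiset.mem_cons_of_mem ha)
  omega

/-- The Jordan types of nilpotent elements of semisimple type in an orthogonal Lie algebra. -/
def IsOrthogonalSemisimpleType (p : Multiset ℕ) : Prop :=
  (∃ n₁ k l : ℕ, 2 ≤ n₁ ∧ 0 < k ∧ Even k ∧
    p = Multiset.replicate k n₁ + Multiset.replicate l 1) ∨
  (∃ m l : ℕ, 1 ≤ m ∧ p = (2 * m + 1) ::ₘ (2 * m - 1) ::ₘ Multiset.replicate l 1) ∨
  (∃ n₁ l : ℕ, (5 ≤ n₁ ∨ l = 0) ∧ p = n₁ ::ₘ Multiset.replicate l 1)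

/-- The Jordan types of nilpotent elements of regular semisimple type in an orthogonal Lie
algebra. -/
def IsOrthogonalRegularType (p : Multiset ℕ) : Prop :=
  (∃ n₁ k l : ℕ, 2 ≤ n₁ ∧ 0 < k ∧ Even k ∧
    p = Multiset.replicate k n₁ + Multiset.replicate l 1 ∧ Odd n₁ ∧ p.count 1 ≤ 2) ∨
  (∃ m l : ℕ, 1 ≤ m ∧ p = (2 * m + 1) ::ₘ (2 * m - 1) ::ₘ Multiset.replicate l 1 ∧
    p.card ≤ 4) ∨
  (∃ n₁ l : ℕ, (5 ≤ n₁ ∨ l = 0) ∧ p = n₁ ::ₘ Multiset.replicate l 1 ∧ p.card ≤ 2)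

lemma IsOrthogonalRegularType.isOrthogonalSemisimpleType {p : Multiset ℕ}
    (h : IsOrthogonalRegularType p) : IsOrthogonalSemisimpleType p := by
  rcases h with ⟨n₁, k, l, h1, h2, h3, h4, -⟩ | ⟨m, l, h1, h2, -⟩ | ⟨n₁, l, h1, h2, -⟩
  · exact Or.inl ⟨n₁, k, l, h1, h2, h3, h4⟩
  · exact Or.inr (Or.inl ⟨m, l, h1, h2⟩)
  · exact Or.inr (Or.inr ⟨n₁, l, h1, h2⟩)

lemma isOrthogonalSemisimpleType_iff_of_even (hk : 0 < k) (hN : 1 ≤ N)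
    (hs : ∀ m ∈ s, 1 ≤ m ∧ m ≤ N) (hke : Even k) :
    (IsOrthogonalSemisimpleType (Multiset.replicate k (N + 1) + s) ↔
      ∃ l, s = Multiset.replicate l 1) ∧
    (IsOrthogonalRegularType (Multiset.replicate k (N + 1) + s) ↔
      (∃ l, s = Multiset.replicate l 1) ∧ Even N ∧ s.card ≤ 2) := by
  have hk1 : k ≠ 1 := by
    rintro rfl
    exact absurd hke (by decide)
  refine ⟨⟨?_, ?_⟩, ⟨?_, ?_⟩⟩
  · rintro (⟨n₁, k', l, -, -, -, h⟩ | ⟨m, l, hm, h⟩ | ⟨n₁, l, -, h⟩)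
    · exact ⟨l, (eq_of_replicate_add_eq hk hN hs h).2.2⟩
    · exact absurd (eq_of_replicate_add_eq_cons_cons hk hN hs hm h).2.1 hk1
    · exact absurd (eq_of_replicate_add_eq_cons hk hN hs h).2.1 hk1
  · rintro ⟨l, rfl⟩
    exact Or.inl ⟨N + 1, k, l, by omega, hk, hke, rfl⟩
  · rintro (⟨n₁, k', l, -, -, -, h, hodd, hcard⟩ | ⟨m, l, hm, h, -⟩ | ⟨n₁, l, -, h, -⟩)
    · obtain ⟨rfl, rfl, rfl⟩ := eq_of_replicate_add_eq hk hN hs h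
      refine ⟨⟨l, rfl⟩, by simpa [Nat.odd_add_one] using hodd, ?_⟩
      rw [Multiset.count_add, Multiset.count_replicate_self] at hcard
      rw [Multiset.card_replicate]
      omega
    · exact absurd (eq_of_replicate_add_eq_cons_cons hk hN hs hm h).2.1 hk1
    · exact absurd (eq_of_replicate_add_eq_cons hk hN hs h).2.1 hk1
  · rintro ⟨⟨l, rfl⟩, heven, hcard⟩
    refine Or.inl ⟨N + 1, k, l, by omega, hk, hke, rfl, heven.add_one, ?_⟩
    rw [Multiset.count_add, Multiset.count_replicate_self, Multiset.count_replicate,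
      if_neg (by omega)]
    rw [Multiset.card_replicate] at hcard
    omega

lemma not_isOrthogonalSemisimpleType_of_odd (hk : Odd k) (hk1 : k ≠ 1) (hN : 1 ≤ N)
    (hs : ∀ m ∈ s, 1 ≤ m ∧ m ≤ N) :
    ¬ IsOrthogonalSemisimpleType (Multiset.replicate k (N + 1) + s) := by
  rintro (⟨n₁, k', l, -, -, hk', h⟩ | ⟨m, l, hm, h⟩ | ⟨n₁, l, -, h⟩)
  · rw [(eq_of_replicate_add_eq hk.pos hN hs h).2.1] at hk'
    exact Nat.not_even_iff_odd.2 hk hk'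
  · exact absurd (eq_of_replicate_add_eq_cons_cons hk.pos hN hs hm h).2.1 hk1
  · exact absurd (eq_of_replicate_add_eq_cons hk.pos hN hs h).2.1 hk1

lemma isOrthogonalSemisimpleType_iff_of_forall_le {n : ℕ} (hn : Even n)
    (hs : ∀ m ∈ s, 1 ≤ m ∧ m ≤ n) :
    (IsOrthogonalSemisimpleType (Multiset.replicate 1 (n + 2 + 1) + s) ↔
      ∃ l, s = Multiset.replicate l 1) ∧
    (IsOrthogonalRegularType (Multiset.replicate 1 (n + 2 + 1) + s) ↔
      (∃ l, s = Multiset.replicate l 1) ∧ s.card ≤ 1) := by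
  have hs2 : ∀ m ∈ s, 1 ≤ m ∧ m ≤ n + 2 := fun m hm => ⟨(hs m hm).1, by linarith [(hs m hm).2]⟩
  have hle : IsOrthogonalSemisimpleType (Multiset.replicate 1 (n + 2 + 1) + s) →
      ∃ l, s = Multiset.replicate l 1 := by
    rintro (⟨n₁, k', l, -, -, hk', h⟩ | ⟨m, l, hm, h⟩ | ⟨n₁, l, -, h⟩)
    · rw [(eq_of_replicate_add_eq one_pos (by omega) hs2 h).2.1] at hk'
      exact absurd hk' (by decide)
    · obtain ⟨h1, -, h2⟩ := eq_of_replicate_add_eq_cons_cons one_pos (by omega) hs2 hm h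
      have := (hs (2 * m - 1) (by rw [h2]; exact Multiset.mem_cons_self _ _)).2
      omega
    · exact ⟨l, (eq_of_replicate_add_eq_cons one_pos (by omega) hs2 h).2.2⟩
  have hge : ∀ l, s = Multiset.replicate l 1 → 5 ≤ n + 2 + 1 ∨ l = 0 := by
    rintro l rfl
    by_contra! hl
    have := (hs 1 (Multiset.mem_replicate.2 ⟨hl.2, rfl⟩)).2
    obtain ⟨r, rfl⟩ := hn
    omega
  refine ⟨⟨hle, ?_⟩, fun h => ⟨hle h.isOrthogonalSemisimpleType, ?_⟩, ?_⟩
  · rintro ⟨l, h⟩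
    exact Or.inr (Or.inr ⟨n + 2 + 1, l, hge l h, by rw [h]; rfl⟩)
  · obtain ⟨l, hl⟩ := hle h.isOrthogonalSemisimpleType
    rcases h with ⟨n₁, k', l, -, -, hk', h, -⟩ | ⟨m, l, hm, h, -⟩ | ⟨n₁, l, -, -, h⟩
    · rw [(eq_of_replicate_add_eq one_pos (by omega) hs2 h).2.1] at hk'
      exact absurd hk' (by decide)
    · obtain ⟨h1, -, h2⟩ := eq_of_replicate_add_eq_cons_cons one_pos (by omega) hs2 hm h
      have := (hs (2 * m - 1) (by rw [h2]; exact Multiset.mem_cons_self _ _)).2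
      omega
    · rw [Multiset.card_add, Multiset.card_replicate] at h
      omega
  · rintro ⟨⟨l, h⟩, hcard⟩
    refine Or.inr (Or.inr ⟨n + 2 + 1, l, hge l h, by rw [h]; rfl, ?_⟩)
    rw [Multiset.card_add, Multiset.card_replicate]
    omega

lemma isOrthogonalSemisimpleType_iff_of_exists_le {n : ℕ} (hn : Even n)
    (hs : ∀ m ∈ s, 1 ≤ m ∧ m ≤ n + 2) (hsn : ∃ m ∈ s, n + 1 ≤ m) :
    (IsOrthogonalSemisimpleType (Multiset.replicate 1 (n + 2 + 1) + s) ↔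
      (s.map fun m => m - 1).sum = n) ∧
    (IsOrthogonalRegularType (Multiset.replicate 1 (n + 2 + 1) + s) ↔
      (s.map fun m => m - 1).sum = n ∧ s.sum ≤ n + 3) := by
  have hle : IsOrthogonalSemisimpleType (Multiset.replicate 1 (n + 2 + 1) + s) →
      ∃ l, s = (n + 1) ::ₘ Multiset.replicate l 1 := by
    rintro (⟨n₁, k', l, -, -, hk', h⟩ | ⟨m, l, hm, h⟩ | ⟨n₁, l, hl, h⟩)
    · rw [(eq_of_replicate_add_eq one_pos (by omega) hs h).2.1] at hk'
      exact absurd hk' (by decide)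
    · obtain ⟨h1, -, h2⟩ := eq_of_replicate_add_eq_cons_cons one_pos (by omega) hs hm h
      exact ⟨l, by rw [h2, show 2 * m - 1 = n + 1 by omega]⟩
    · obtain ⟨h1, -, h2⟩ := eq_of_replicate_add_eq_cons one_pos (by omega) hs h
      obtain ⟨m, hm, hnm⟩ := hsn
      rw [h2, Multiset.mem_replicate] at hm
      omega
  have hsum : ∀ l, s = (n + 1) ::ₘ Multiset.replicate l 1 →
      (s.map fun m => m - 1).sum = n ∧ s.sum = n + 1 + l ∧ s.card = l + 1 := by
    rintro l rfl
    simp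
  have hge : (s.map fun m => m - 1).sum = n → ∃ m l : ℕ, 1 ≤ m ∧
      Multiset.replicate 1 (n + 2 + 1) + s =
        (2 * m + 1) ::ₘ (2 * m - 1) ::ₘ Multiset.replicate l 1 ∧
      s = (n + 1) ::ₘ Multiset.replicate l 1 := by
    intro h
    have h1 := eq_cons_replicate_of_sum_eq (fun m hm => (hs m hm).1) hsn h
    obtain ⟨r, rfl⟩ := hn
    refine ⟨r + 1, s.card - 1, by omega, ?_, h1⟩
    conv_lhs => rw [h1]
    rw [show 2 * (r + 1) + 1 = r + r + 2 + 1 by ring, show 2 * (r + 1) - 1 = r + r + 1 by omega]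
    rfl
  refine ⟨⟨fun h => ?_, fun h => ?_⟩, fun h => ?_, fun ⟨h, hcard⟩ => ?_⟩
  · obtain ⟨l, hl⟩ := hle h
    exact (hsum l hl).1
  · obtain ⟨m, l, hm, h1, -⟩ := hge h
    exact Or.inr (Or.inl ⟨m, l, hm, h1⟩)
  · obtain ⟨l, hl⟩ := hle h.isOrthogonalSemisimpleType
    obtain ⟨h1, h2, h3⟩ := hsum l hl
    refine ⟨h1, ?_⟩
    rcases h with ⟨n₁, k', l, -, -, hk', h, -⟩ | ⟨m, l, hm, -, h⟩ | ⟨n₁, l, hl, -, h⟩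
    · rw [(eq_of_replicate_add_eq one_pos (by omega) hs h).2.1] at hk'
      exact absurd hk' (by decide)
    all_goals
      rw [Multiset.card_add, Multiset.card_replicate] at h
      omega
  · obtain ⟨m, l, hm, h1, h2⟩ := hge h
    refine Or.inr (Or.inl ⟨m, l, hm, h1, ?_⟩)
    rw [Multiset.card_add, Multiset.card_replicate]
    have := hsum l h2
    omega

end Partitions

/-! ### The classification -/

section Classification

variable {F V : Type*} [Field F] [AddCommGroup V] [Module F V]
  [CharZero F] [FiniteDimensional F V] [IsAlgClosed F]

omit [CharZero F] [IsAlgClosed F] in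
/-- If `s` is the multiset of orders of the Jordan blocks of `e` on `core e f N`, then `e` vanishes
there if and only if all members of `s` are `1`. -/
lemma core_apply_eq_zero_iff {e f : End F V} {N : ℕ} {s : Multiset ℕ} (hs : ∀ m ∈ s, 1 ≤ m)
    (hsum : ∀ r, (s.map fun m => m - r).sum = finrank F ((core e f N).map (e ^ r))) :
    ((∀ v ∈ core e f N, e v = 0) ↔ ∃ l, s = Multiset.replicate l 1) ∧
      ∀ c, ((∀ v ∈ core e f N, e v = 0) ∧ finrank F (core e f N) ≤ c ↔
        (∃ l, s = Multiset.replicate l 1) ∧ s.card ≤ c) := by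
  have h0 := hsum 0
  have h1 := hsum 1
  rw [pow_zero, Module.End.one_eq_id, Submodule.map_id] at h0
  simp only [Nat.sub_zero, Multiset.map_id'] at h0
  rw [pow_one] at h1
  have h2 : (∀ v ∈ core e f N, e v = 0) ↔ finrank F ((core e f N).map e) = 0 := by
    rw [Submodule.finrank_eq_zero, eq_bot_iff, Submodule.map_le_iff_le_comap]
    exact Iff.rfl
  have h3 : (∀ v ∈ core e f N, e v = 0) ↔ ∃ l, s = Multiset.replicate l 1 := by
    rw [h2, ← h1, Multiset.sum_eq_zero_iff]
    constructor
    · intro h3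
      refine ⟨s.card, Multiset.eq_replicate_card.2 fun m hm => ?_⟩
      have := h3 _ (Multiset.mem_map_of_mem _ hm)
      have := hs m hm
      omega
    · rintro ⟨l, rfl⟩ m hm
      rw [Multiset.map_replicate] at hm
      exact Multiset.eq_of_mem_replicate hm
  refine ⟨h3, fun c => ?_⟩
  rw [h3]
  refine and_congr_right fun ⟨l, hl⟩ => ?_
  rw [← h0, hl]
  simp

/-- The answer for `sl` and `sp` in terms of partitions. -/
lemma jordanType_iff_of_core {h e f : End F V} {N : ℕ} {P Q : Prop} (t : IsSl2Triple h e f)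
    (hN : WeightsLE h N) (hN1 : 1 ≤ N) (hbot : weightSpace h (-N) ≠ ⊥)
    {p : Multiset ℕ} (hp : HasJordanType e p) (hpos : ∀ m ∈ p, 0 < m)
    (hPQ : (P ↔ ∀ v ∈ core e f N, e v = 0) ∧
      (Q ↔ (∀ v ∈ core e f N, e v = 0) ∧ finrank F (core e f N) ≤ 1)) :
    (P ↔ ∃ n₁ k l : ℕ, 0 < k ∧ p = Multiset.replicate k n₁ + Multiset.replicate l 1) ∧
    (Q ↔ (∃ n₁ k l : ℕ, 0 < k ∧ p = Multiset.replicate k n₁ + Multiset.replicate l 1) ∧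
      p.count 1 ≤ 1) := by
  obtain ⟨s, rfl, hs, hsum⟩ := t.exists_parts_eq hN hp hpos
  obtain ⟨h1, h2⟩ := core_apply_eq_zero_iff (fun m hm => (hs m hm).1) hsum
  rw [hPQ.1, hPQ.2, h2, h1,
    exists_replicate_iff (Submodule.one_le_finrank_iff.2 hbot) hN1 hs]
  refine ⟨Iff.rfl, and_congr_right fun ⟨l, hl⟩ => ?_⟩
  rw [Multiset.count_add, Multiset.count_replicate, if_neg (by omega), hl,
    Multiset.count_replicate_self, Multiset.card_replicate, zero_add]

lemma so_jordanType_iff {B : LinearMap.BilinForm F V} (hnd : B.Nondegenerate)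
    (hB : ∀ u v, B u v = B v u) {h e f : skewAdjointLieSubalgebra B} (t : IsSl2Triple h e f)
    (hd : Even (gradingDepth F h)) {p : Multiset ℕ} (hp : HasJordanType (e : End F V) p)
    (hpos : ∀ m ∈ p, 0 < m) :
    (IsOfSemisimpleType F h e ↔ IsOrthogonalSemisimpleType p) ∧
      (IsOfRegularSemisimpleType F h e ↔ IsOrthogonalRegularType p) := by
  have t' := isSl2Triple_coe t
  obtain ⟨N, hN1, hN, hbot⟩ := t'.exists_weightsLE
  have hp' := hp
  obtain ⟨s, rfl, hs, hsum⟩ := t'.exists_parts_eq hN hp hpos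
  have hcore := core_apply_eq_zero_iff (fun m hm => (hs m hm).1) hsum
  have hk := Submodule.one_le_finrank_iff.2 hbot
  rcases Nat.even_or_odd (finrank F (weightSpace (h : End F V) (-N))) with hke | hko
  · have h1 := so_semisimpleType_iff_of_even hnd hB t hN hbot hke
    have h2 := isOrthogonalSemisimpleType_iff_of_even hk hN1 hs hke
    refine ⟨by rw [h1.1, h2.1, hcore.1], ?_⟩
    rw [h1.2, h2.2, and_left_comm, hcore.2, and_left_comm]
  by_cases hk1 : finrank F (weightSpace (h : End F V) (-N)) = 1
  swap
  · have h1 := so_not_semisimpleType_of_odd hnd hB t hN hN1 hko hk1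
    have h2 := not_isOrthogonalSemisimpleType_of_odd hko hk1 hN1 hs
    exact ⟨iff_of_false h1 h2, iff_of_false (fun h => h1 h.isOfSemisimpleType)
      fun h => h2 h.isOrthogonalSemisimpleType⟩
  obtain ⟨n, u, rfl, S⟩ := exists_hasSimpleTop hnd hB t hN hN1 hk1 hd
  rw [hk1]
  by_cases hM : ∀ v ∈ weightSpace (h : End F V) (-n), B v (((e : End F V) ^ (n + 1)) u) = 0 → v = 0
  · have h1 := S.semisimpleType_iff_of_forall hM
    have hsn : ∀ m ∈ s, 1 ≤ m ∧ m ≤ n := by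
      intro m hm
      have h0 := hsum n
      rw [S.map_core_eq_bot hM, finrank_bot, Multiset.sum_eq_zero_iff] at h0
      have := h0 _ (Multiset.mem_map_of_mem _ hm)
      have := hs m hm
      omega
    have h2 := isOrthogonalSemisimpleType_iff_of_forall_le S.even hsn
    exact ⟨by rw [h1.1, h2.1, hcore.1], by rw [h1.2, h2.2, hcore.2]⟩
  · push Not at hM
    obtain ⟨v, hv, hvu, hv0⟩ := hM
    have h1 := S.semisimpleType_iff_of_exists hv hvu hv0
    have hsn : ∃ m ∈ s, n + 1 ≤ m := by
      obtain ⟨w, hw, hwu, hform⟩ := S.exists_form_ne_zero hv hvu hv0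
      by_contra! hcon
      have h2 : (s.map fun m => m - n).sum = 0 := Multiset.sum_eq_zero fun a ha => by
        obtain ⟨m, hm, rfl⟩ := Multiset.mem_map.1 ha
        have := hcon m hm
        omega
      have h3 := S.finrank_range_pow hw hwu hform n
      rw [t'.finrank_range_e_pow hN n, ← hsum n, h2, hk1] at h3
      omega
    have h2 := isOrthogonalSemisimpleType_iff_of_exists_le S.even hs hsn
    have h3 := t'.finrank_range_e_pow hN 1
    rw [← hsum 1, hk1, pow_one] at h3
    have h4 := S.finrank_eq
    have h5 := hsum 0
    rw [pow_zero, Module.End.one_eq_id, Submodule.map_id] at h5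
    simp only [Nat.sub_zero, Multiset.map_id'] at h5
    rw [h1.1, h1.2, h2.1, h2.2, h3, h4, h5]
    omega

end Classification

theorem theorem4p3 {F V : Type*} [Field F] [IsAlgClosed F] [CharZero F]
    [AddCommGroup V] [Module F V] [FiniteDimensional F V] :
    -- the case of `sl(V)`
    (∀ (h e f : slSubalgebra F V), IsSl2Triple h e f → Even (gradingDepth F h) →
      ∀ (lam : Nat.Partition (Module.finrank F V)),
        HasJordanType (e : Module.End F V) lam.parts →
        (IsOfSemisimpleType F h e ↔
          ∃ n₁ k l : ℕ, 0 < k ∧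
            lam.parts = Multiset.replicate k n₁ + Multiset.replicate l 1) ∧
        (IsOfRegularSemisimpleType F h e ↔
          (∃ n₁ k l : ℕ, 0 < k ∧
            lam.parts = Multiset.replicate k n₁ + Multiset.replicate l 1) ∧
          lam.parts.count 1 ≤ 1)) ∧
    -- the case of `sp(V)`
    (∀ (B : LinearMap.BilinForm F V), B.IsAlt → B.Nondegenerate →
      ∀ (h e f : skewAdjointLieSubalgebra B), IsSl2Triple h e f → Even (gradingDepth F h) →
      ∀ (lam : Nat.Partition (Module.finrank F V)),
        HasJordanType (e : Module.End F V) lam.parts →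
        (IsOfSemisimpleType F h e ↔
          ∃ n₁ k l : ℕ, 0 < k ∧
            lam.parts = Multiset.replicate k n₁ + Multiset.replicate l 1) ∧
        (IsOfRegularSemisimpleType F h e ↔
          (∃ n₁ k l : ℕ, 0 < k ∧
            lam.parts = Multiset.replicate k n₁ + Multiset.replicate l 1) ∧
          lam.parts.count 1 ≤ 1)) ∧
    -- the case of `so(V)`
    (∀ (B : LinearMap.BilinForm F V), B.IsSymm → B.Nondegenerate →
      ∀ (h e f : skewAdjointLieSubalgebra B), IsSl2Triple h e f → Even (gradingDepth F h) →
      ∀ (lam : Nat.Partition (Module.finrank F V)),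
        HasJordanType (e : Module.End F V) lam.parts →
        (IsOfSemisimpleType F h e ↔
          (∃ n₁ k l : ℕ, 2 ≤ n₁ ∧ 0 < k ∧ Even k ∧
            lam.parts = Multiset.replicate k n₁ + Multiset.replicate l 1) ∨
          (∃ m l : ℕ, 1 ≤ m ∧
            lam.parts = (2 * m + 1) ::ₘ (2 * m - 1) ::ₘ Multiset.replicate l 1) ∨
          (∃ n₁ l : ℕ, (5 ≤ n₁ ∨ l = 0) ∧
            lam.parts = n₁ ::ₘ Multiset.replicate l 1)) ∧
        (IsOfRegularSemisimpleType F h e ↔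
          (∃ n₁ k l : ℕ, 2 ≤ n₁ ∧ 0 < k ∧ Even k ∧
            lam.parts = Multiset.replicate k n₁ + Multiset.replicate l 1 ∧
            Odd n₁ ∧ lam.parts.count 1 ≤ 2) ∨
          (∃ m l : ℕ, 1 ≤ m ∧
            lam.parts = (2 * m + 1) ::ₘ (2 * m - 1) ::ₘ Multiset.replicate l 1 ∧
            lam.parts.card ≤ 4) ∨
          (∃ n₁ l : ℕ, (5 ≤ n₁ ∨ l = 0) ∧
            lam.parts = n₁ ::ₘ Multiset.replicate l 1 ∧
            lam.parts.card ≤ 2))) := by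
  refine ⟨fun h e f t _ lam hlam => ?_, fun B hB hnd h e f t _ lam hlam => ?_,
    fun B hB hnd h e f t hd lam hlam => ?_⟩
  · obtain ⟨N, hN1, hN, hbot⟩ := (isSl2Triple_coe t).exists_weightsLE
    exact jordanType_iff_of_core (isSl2Triple_coe t) hN hN1 hbot hlam (fun _ => lam.parts_pos)
      (sl_semisimpleType_iff t hN hN1 hbot)
  · obtain ⟨N, hN1, hN, hbot⟩ := (isSl2Triple_coe t).exists_weightsLE
    exact jordanType_iff_of_core (isSl2Triple_coe t) hN hN1 hbot hlam (fun _ => lam.parts_pos)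
      (sp_semisimpleType_iff hnd (fun u v => by rw [neg_one_mul, hB.neg_eq]) t hN hbot)
  · exact so_jordanType_iff hnd (fun u v => hB.eq u v) t hd hlam fun _ => lam.parts_pos
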